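/- Let $\mathbb F$ be a field of characteristic $0$. A DGCA is a unital differential graded algebra $(\mathcal A^*,d)$ over $\mathbb F$, $\deg d=+1$, that is commutative in the graded sense; $H(\mathcal A)$ denotes its cohomology algebra. A Poincaré DGCA of degree $n$ is a DGCA $\mathcal A=\bigoplus_{k=0}^n\mathcal A^k$ with finite dimensional cohomology together with a linear functional $\int:H^n(\mathcal A)\to\mathbb F$ such that the pairing $\langle\alpha,\beta\rangle=\int\alpha\beta$ on $H(\mathcal A)$ (zero unless the degrees add up to $n$) is non-degenerate. It induces the pairing $\langle x,y\rangle=\int[xy]$ on $\mathcal A$ (again zero unless the degrees add up to $n$). A Hodge type decomposition of $\mathcal A$ is a direct sum decomposition into graded subspaces $\mathcal A=d\mathcal A\oplus\mathcal H\oplus\mathcal B$ with $\ker d=d\mathcal A\oplus\mathcal H$ and $\langle\mathcal H\oplus\mathcal B,\mathcal B\rangle=0$; $\mathcal A$ is of Hodge type if it admits one. $\mathcal A$ is $m$-connected if $H^0(\mathcal A)\cong\mathbb F$ and $H^k(\mathcal A)=0$ for $1\le k\le m$. Given a Hodge type decomposition, let $d^-:\mathcal A^*\to\mathcal A^{*-1}$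 be zero on $\mathcal H\oplus\mathcal B$ and the inverse of the bijection $d:\mathcal B\to d\mathcal A$ on $d\mathcal A$, let $\pi_{\mathcal H}:\mathcal A\to\mathcal H$ be the projection along $d\mathcal A\oplus\mathcal B$, and let $\iota:H(\mathcal A)\to\mathcal H$ send a class to its representative in $\mathcal H$. Put $$\mu_3(\alpha,\beta,\gamma)=\big[\pi_{\mathcal H}\big(d^-(\iota\alpha\cdot\iota\beta)\cdot\iota\gamma-(-1)^{|\alpha|}\,\iota\alpha\cdot d^-(\iota\beta\cdot\iota\gamma)\big)\big].$$ This is a Hochschild cocycle of the graded algebra $H(\mathcal A)$, of arity $3$ and degree $-1$; here the Hochschild differential of a $p$-linear map $f$ of degree $q$ is $(\delta f)(a_0,\dots,a_p)=(-1)^{q|a_0|}a_0f(a_1,\dots,a_p)+\sum_{i=0}^{p-1}(-1)^{i+1}f(\dots,a_ia_{i+1},\dots)+(-1)^{p+1}f(a_0,\dots,a_{p-1})a_p$. An $A_\infty$-quasi-isomorphism of DGCAs is a morphism of $A_\infty$-algebras (a DGCA being an $A_\infty$-algebra with $m_1=d$, $m_2$ the product and $m_k=0$ for $k\ge3$) whose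 linear component induces an isomorphism in cohomology. **Theorem.** Let $r>1$, and let $\mathcal A_1,\mathcal A_2$ be $(r-1)$-connected Poincaré DGCAs of Hodge type over $\mathbb F$, of degrees $n_1,n_2\le 5r-3$. Then the class $[\mu_3^{\mathcal A_i}]=[\mu_3]\in\mathsf{Hoch}^{3,-1}(H(\mathcal A_i),H(\mathcal A_i))$ does not depend on the choice of the Hodge type decomposition of $\mathcal A_i$ $(i=1,2)$, and there is an $A_\infty$-quasi-isomorphism $\mathcal A_1\to\mathcal A_2$ if and only if there is an isomorphism of graded algebras $\phi:H(\mathcal A_1)\to H(\mathcal A_2)$ with $$\big[\phi^{-1}\circ\mu_3^{\mathcal A_2}\circ(\phi\otimes\phi\otimes\phi)\big]=[\mu_3^{\mathcal A_1}]\quad\text{in }\mathsf{Hoch}^{3,-1}(H(\mathcal A_1),H(\mathcal A_1)).$$ -/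

import Mathlib

/-- A unital differential graded commutative algebra over the field `F`: a `ℤ`-graded associative
unital algebra `⨁ deg k`, commutative in the graded sense, with a differential of degree `+1` that
is a graded derivation of square zero. -/
structure DGCA.{u, v} (F : Type u) [Field F] : Type (max u (v + 1)) where
  carrier : Type v
  [instRing : Ring carrier]
  [instAlgebra : Algebra F carrier]
  deg : ℤ → Submodule F carrier
  [instGraded : GradedAlgebra deg]
  d : carrier →ₗ[F] carrier
  d_mem : ∀ (k : ℤ) (x : carrier), x ∈ deg k → d x ∈ deg (k + 1)
  d_d : ∀ x : carrier, d (d x) = 0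
  leibniz : ∀ (k : ℤ) (x y : carrier), x ∈ deg k →
    d (x * y) = d x * y + ((-1 : F) ^ k) • (x * d y)
  graded_comm : ∀ (k l : ℤ) (x y : carrier), x ∈ deg k → y ∈ deg l →
    x * y = ((-1 : F) ^ (k * l)) • (y * x)

attribute [instance] DGCA.instRing DGCA.instAlgebra DGCA.instGraded

namespace DGCA

variable {F : Type*} [Field F] (A : DGCA F)

instance : CoeSort (DGCA F) (Type _) := ⟨DGCA.carrier⟩

/-- The linear projection of `A` onto its component of degree `k`. -/
noncomputable def proj (k : ℤ) : A →ₗ[F] A := GradedAlgebra.proj A.deg k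

/-- The grading involution, `x ↦ (-1) ^ k x` for `x` of degree `k`. -/
noncomputable def parity : A →ₗ[F] A :=
  DirectSum.toModule F ℤ A (fun k => ((-1 : F) ^ k) • (A.deg k).subtype) ∘ₗ
    (DirectSum.decomposeLinearEquiv A.deg).toLinearMap

section
variable {A}

lemma hom_induction {P : A → Prop} (h0 : P 0) (hom : ∀ k, ∀ x ∈ A.deg k, P x)
    (hadd : ∀ x y, P x → P y → P (x + y)) (x : A) : P x :=
  DirectSum.Decomposition.inductionOn A.deg h0 (fun {i} m => hom i m m.2) hadd x

lemma linear_ext {M : Type*} [AddCommGroup M] [Module F M] {f g : A →ₗ[F] M}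
    (h : ∀ k, ∀ x ∈ A.deg k, f x = g x) (x : A) : f x = g x := by
  refine hom_induction (P := fun x => f x = g x) (by simp) h ?_ x
  intro x y hx hy
  simp [hx, hy]

lemma proj_mem (k : ℤ) (x : A) : A.proj k x ∈ A.deg k := by
  simp only [proj, GradedAlgebra.proj_apply]
  exact (DirectSum.decompose A.deg x k).2

lemma proj_of_mem {k : ℤ} {x : A} (hx : x ∈ A.deg k) : A.proj k x = x := by
  simp only [proj, GradedAlgebra.proj_apply]
  exact DirectSum.decompose_of_mem_same _ hx

lemma proj_of_mem_ne {k l : ℤ} {x : A} (hx : x ∈ A.deg k) (h : k ≠ l) : A.proj l x = 0 := by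
  simp only [proj, GradedAlgebra.proj_apply]
  exact DirectSum.decompose_of_mem_ne _ hx h

lemma parity_of_mem {k : ℤ} {x : A} (hx : x ∈ A.deg k) : A.parity x = ((-1 : F) ^ k) • x := by
  rw [parity, LinearMap.comp_apply, LinearEquiv.coe_coe, DirectSum.decomposeLinearEquiv_apply,
    DirectSum.decompose_of_mem _ hx, ← DirectSum.lof_eq_of F, DirectSum.toModule_lof]
  rfl

lemma parity_parity (x : A) : A.parity (A.parity x) = x := by
  refine linear_ext (f := A.parity ∘ₗ A.parity) (g := LinearMap.id) ?_ x
  intro k x hx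
  simp only [LinearMap.comp_apply, parity_of_mem hx, map_smul, smul_smul, LinearMap.id_apply]
  rw [← mul_zpow]
  simp

lemma parity_d (x : A) : A.parity (A.d x) = - A.d (A.parity x) := by
  refine linear_ext (f := A.parity ∘ₗ A.d) (g := -(A.d ∘ₗ A.parity)) ?_ x
  intro k x hx
  simp only [LinearMap.comp_apply, LinearMap.neg_apply, parity_of_mem hx,
    parity_of_mem (A.d_mem k x hx), map_smul]
  rw [zpow_add₀ (by simp)]
  simp

lemma parity_mul (x y : A) : A.parity (x * y) = A.parity x * A.parity y := by
  refine linear_ext (f := A.parity ∘ₗ LinearMap.mulRight F y)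
    (g := LinearMap.mulRight F (A.parity y) ∘ₗ A.parity) ?_ x
  intro k x hx
  refine linear_ext (f := A.parity ∘ₗ LinearMap.mulLeft F x)
    (g := LinearMap.mulLeft F (A.parity x) ∘ₗ A.parity) ?_ y
  intro l y hy
  simp only [LinearMap.comp_apply, LinearMap.mulLeft_apply, parity_of_mem hx, parity_of_mem hy,
    parity_of_mem (SetLike.mul_mem_graded hx hy), smul_mul_assoc, mul_smul_comm, smul_smul]
  rw [zpow_add₀ (by simp), mul_comm]

lemma d_mul (x y : A) : A.d (x * y) = A.d x * y + A.parity x * A.d y := by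
  refine linear_ext (f := A.d ∘ₗ LinearMap.mulRight F y)
    (g := LinearMap.mulRight F y ∘ₗ A.d + LinearMap.mulRight F (A.d y) ∘ₗ A.parity) ?_ x
  intro k x hx
  simp [parity_of_mem hx, A.leibniz k x y hx]

lemma d_one : A.d 1 = 0 := by
  have h := A.leibniz 0 1 1 SetLike.GradedOne.one_mem
  simpa using h

lemma proj_d (k : ℤ) (x : A) : A.proj (k + 1) (A.d x) = A.d (A.proj k x) := by
  refine linear_ext (f := A.proj (k + 1) ∘ₗ A.d) (g := A.d ∘ₗ A.proj k) ?_ x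
  intro l x hx
  by_cases h : l = k
  · subst h
    simp [proj_of_mem hx, proj_of_mem (A.d_mem _ _ hx)]
  · have h' : l + 1 ≠ k + 1 := by omega
    simp [proj_of_mem_ne hx h, proj_of_mem_ne (A.d_mem _ _ hx) h']

end

/-- The subalgebra of cocycles `ker d`. -/
def cocycles : Subalgebra F A where
  carrier := {x | A.d x = 0}
  mul_mem' {x y} hx hy := by
    simp only [Set.mem_ofPred_eq] at *
    simp [d_mul, hx, hy]
  add_mem' {x y} hx hy := by
    simp only [Set.mem_ofPred_eq] at *
    simp [hx, hy]
  algebraMap_mem' c := by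
    simp [Algebra.algebraMap_eq_smul_one, d_one]

lemma mem_cocycles {A : DGCA F} {x : A} : x ∈ A.cocycles ↔ A.d x = 0 := Iff.rfl

/-- The ideal of coboundaries `im d` in the algebra of cocycles. -/
def coboundaries : Ideal A.cocycles where
  carrier := {z | ∃ w : A, A.d w = z}
  add_mem' := by
    rintro x y ⟨v, hv⟩ ⟨w, hw⟩
    exact ⟨v + w, by simp [hv, hw]⟩
  zero_mem' := ⟨0, by simp⟩
  smul_mem' := by
    rintro ⟨z, hz⟩ y ⟨w, hw⟩
    refine ⟨A.parity z * w, ?_⟩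
    have hz' : A.d (A.parity z) = 0 := by
      have := parity_d z
      rw [mem_cocycles.1 hz, map_zero] at this
      simpa using this.symm
    simp [d_mul, hz', parity_parity, hw]

lemma mem_coboundaries {A : DGCA F} {z : A.cocycles} :
    z ∈ A.coboundaries ↔ ∃ w : A, A.d w = z := Iff.rfl

instance : A.coboundaries.IsTwoSided where
  mul_mem_of_left := by
    rintro x ⟨y, hy⟩ ⟨w, hw⟩
    exact ⟨w * y, by simp [d_mul, mem_cocycles.1 hy, hw]⟩

/-- The cohomology algebra `H(A) = ker d / im d`. -/
def Cohomology : Type _ := A.cocycles ⧸ A.coboundaries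

noncomputable instance : Ring A.Cohomology := inferInstanceAs (Ring (A.cocycles ⧸ A.coboundaries))

noncomputable instance : Algebra F A.Cohomology :=
  inferInstanceAs (Algebra F (A.cocycles ⧸ A.coboundaries))

/-- The class of a cocycle. -/
noncomputable def cls : A.cocycles →ₐ[F] A.Cohomology := Ideal.Quotient.mkₐ F A.coboundaries

lemma cls_surjective : Function.Surjective A.cls := Ideal.Quotient.mkₐ_surjective F A.coboundaries

variable {A} in
lemma cls_eq_zero_iff {z : A.cocycles} : A.cls z = 0 ↔ ∃ w : A, A.d w = z :=
  (Ideal.Quotient.eq_zero_iff_mem (I := A.coboundaries)).trans mem_coboundaries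

/-- The linear map on cohomology induced by a linear map on cocycles that kills coboundaries. -/
noncomputable def liftCoh {M : Type*} [AddCommGroup M] [Module F M] (g : A.cocycles →ₗ[F] M)
    (hg : ∀ z ∈ A.coboundaries, g z = 0) : A.Cohomology →ₗ[F] M :=
  (Submodule.liftQ (A.coboundaries.restrictScalars F) g hg) ∘ₗ
    (Submodule.Quotient.restrictScalarsEquiv F A.coboundaries).symm.toLinearMap

lemma liftCoh_cls {M : Type*} [AddCommGroup M] [Module F M] (g : A.cocycles →ₗ[F] M)
    (hg : ∀ z ∈ A.coboundaries, g z = 0) (z : A.cocycles) : A.liftCoh g hg (A.cls z) = g z := rfl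

/-- The degree `k` part `H^k(A)` of the cohomology: the classes of cocycles of degree `k`. -/
noncomputable def cohDeg (k : ℤ) : Submodule F A.Cohomology :=
  ((A.deg k).comap A.cocycles.val.toLinearMap).map A.cls.toLinearMap

variable {A} in
lemma mem_cohDeg {k : ℤ} {α : A.Cohomology} :
    α ∈ A.cohDeg k ↔ ∃ z : A.cocycles, (z : A) ∈ A.deg k ∧ A.cls z = α := by
  simp [cohDeg]

/-- `A` is `m`-connected: `H^0(A)` is one-dimensional and `H^k(A) = 0` for `1 ≤ k ≤ m`. -/
def IsConnectedUpTo (m : ℕ) : Prop :=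
  Module.finrank F (A.cohDeg 0) = 1 ∧ ∀ k : ℤ, 1 ≤ k → k ≤ m → A.cohDeg k = ⊥

end DGCA

/-- A Poincaré DGCA of degree `n`: a DGCA concentrated in degrees `0, …, n`, with finite dimensional
cohomology, and with a linear functional `∫` on `H^n` (extended by zero to the other degrees) such
that the pairing `(α, β) ↦ ∫ α β` on the cohomology is non-degenerate. -/
structure PoincareDGCA.{u, v} (F : Type u) [Field F] (n : ℕ) extends DGCA.{u, v} F where
  deg_eq_bot : ∀ k : ℤ, (k < 0 ∨ (n : ℤ) < k) → deg k = ⊥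
  finite_coh : Module.Finite F toDGCA.Cohomology
  int : toDGCA.Cohomology →ₗ[F] F
  int_eq_zero : ∀ k : ℤ, k ≠ n → ∀ α ∈ toDGCA.cohDeg k, int α = 0
  nondegenerate : ∀ α : toDGCA.Cohomology, (∀ β, int (α * β) = 0) → α = 0

namespace PoincareDGCA

open DGCA

variable {F : Type*} [Field F] {n : ℕ} (A : PoincareDGCA F n)

lemma proj_top_mem (x : A.toDGCA) : A.proj n x ∈ A.cocycles := by
  have h := A.d_mem n _ (proj_mem (n : ℤ) x)
  rw [A.deg_eq_bot (n + 1) (Or.inr (by omega))] at h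
  exact (Submodule.mem_bot F).1 h

/-- The functional `x ↦ ∫ [x_n]` on `A`, where `x_n` is the component of `x` of top degree `n`
(which is closed). -/
noncomputable def topInt : A.toDGCA →ₗ[F] F :=
  A.int ∘ₗ A.cls.toLinearMap ∘ₗ
    (A.proj n).codRestrict (Subalgebra.toSubmodule A.cocycles) A.proj_top_mem

/-- The pairing `⟨x, y⟩ = ∫ [x y]` on `A`; it vanishes on elements of degrees `k`, `l` with
`k + l ≠ n`. -/
noncomputable def pairing (x y : A.toDGCA) : F := A.topInt (x * y)

/-- A Hodge type decomposition `A = dA ⊕ ℋ ⊕ ℬ` into graded subspaces: `ℋ` is a harmonic subspace,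
that is `ker d = dA ⊕ ℋ`, and `⟨ℋ ⊕ ℬ, ℬ⟩ = 0`. -/
structure HodgeDecomposition where
  harm : Submodule F A.toDGCA
  compl : Submodule F A.toDGCA
  harm_graded : ∀ (k : ℤ), ∀ x ∈ harm, A.proj k x ∈ harm
  compl_graded : ∀ (k : ℤ), ∀ x ∈ compl, A.proj k x ∈ compl
  range_inf_harm : LinearMap.range A.d ⊓ harm = ⊥
  range_sup_harm : LinearMap.range A.d ⊔ harm = LinearMap.ker A.d
  isCompl : IsCompl (LinearMap.range A.d ⊔ harm) compl
  pairing_eq_zero : ∀ x ∈ harm ⊔ compl, ∀ y ∈ compl, A.pairing x y = 0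

/-- A Poincaré DGCA is of Hodge type if it admits a Hodge type decomposition. -/
def IsHodgeType : Prop := Nonempty A.HodgeDecomposition

end PoincareDGCA

section Hochschild

variable {F : Type*} [Field F] {H : Type*} [Ring H] [Algebra F H]

/-- `(a₀, a₁, …) ↦ (a₀, …, a_{r-1}, a_r a_{r+1}, a_{r+2}, …)`. -/
def mulAt (a : ℕ → H) (r : ℕ) (i : ℕ) : H :=
  if i < r then a i else if i = r then a r * a (r + 1) else a (i + 1)

/-- The value on `(a₀, …, a_p)`, homogeneous of degrees `k₀, …, k_p`, of the Hochschild differential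
of the `p`-cochain `f` of internal degree `q`:
`(-1)^{q k₀} a₀ f(a₁, …, a_p) + ∑_{r<p} (-1)^{r+1} f(…, a_r a_{r+1}, …)
  + (-1)^{p+1} f(a₀, …, a_{p-1}) a_p`. -/
def hochD (p : ℕ) (q : ℤ) (f : MultilinearMap F (fun _ : Fin p => H) H) (k : ℕ → ℤ) (a : ℕ → H) :
    H :=
  ((-1 : F) ^ (q * k 0)) • (a 0 * f (fun i => a (i + 1)))
    + ∑ r ∈ Finset.range p, ((-1 : F) ^ (r + 1)) • f (fun i => mulAt a r i)
    + ((-1 : F) ^ (p + 1)) • (f (fun i => a i) * a p)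

/-- Hochschild cochains `C^{p,q}(H, H)`: the `p`-linear maps of degree `q`. -/
def hochCochains (ℋ : ℤ → Submodule F H) (p : ℕ) (q : ℤ) :
    Submodule F (MultilinearMap F (fun _ : Fin p => H) H) where
  carrier := {f | ∀ (k : Fin p → ℤ) (a : Fin p → H), (∀ i, a i ∈ ℋ (k i)) →
    f a ∈ ℋ ((∑ i, k i) + q)}
  add_mem' hf hg _ _ ha := add_mem (hf _ _ ha) (hg _ _ ha)
  zero_mem' _ _ _ := zero_mem _
  smul_mem' c _ hf _ _ ha := Submodule.smul_mem _ c (hf _ _ ha)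

/-- Hochschild cocycles in `C^{p,q}(H, H)`. -/
def hochCocycles (ℋ : ℤ → Submodule F H) (p : ℕ) (q : ℤ) :
    Submodule F (MultilinearMap F (fun _ : Fin p => H) H) where
  carrier := {f | f ∈ hochCochains ℋ p q ∧
    ∀ (k : ℕ → ℤ) (a : ℕ → H), (∀ i, a i ∈ ℋ (k i)) → hochD p q f k a = 0}
  add_mem' {f g} hf hg := by
    refine ⟨add_mem hf.1 hg.1, fun k a ha => ?_⟩
    have h : hochD p q (f + g) k a = hochD p q f k a + hochD p q g k a := by
      simp only [hochD, add_apply, mul_add, add_mul, smul_add,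
        Finset.sum_add_distrib]
      abel
    rw [h, hf.2 k a ha, hg.2 k a ha, add_zero]
  zero_mem' := ⟨zero_mem _, fun k a _ => by simp [hochD]⟩
  smul_mem' c f hf := by
    refine ⟨Submodule.smul_mem _ c hf.1, fun k a ha => ?_⟩
    have h : hochD p q (c • f) k a = c • hochD p q f k a := by
      simp only [hochD, smul_apply, mul_smul_comm, smul_mul_assoc, smul_add,
        Finset.smul_sum, smul_comm c]
    rw [h, hf.2 k a ha, smul_zero]

/-- Hochschild coboundaries in `C^{p,q}(H, H)`: the cochains of the form `δ g` with `g` in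
`C^{p-1,q}(H, H)`. -/
def hochCoboundaries (ℋ : ℤ → Submodule F H) : (p : ℕ) → (q : ℤ) →
    Submodule F (MultilinearMap F (fun _ : Fin p => H) H)
  | 0, _ => ⊥
  | p + 1, q =>
    { carrier := {f | f ∈ hochCochains ℋ (p + 1) q ∧ ∃ g ∈ hochCochains ℋ p q,
        ∀ (k : ℕ → ℤ) (a : ℕ → H), (∀ i, a i ∈ ℋ (k i)) → f (fun i => a i) = hochD p q g k a}
      add_mem' := by
        rintro f f' ⟨hf, g, hg, h⟩ ⟨hf', g', hg', h'⟩
        refine ⟨add_mem hf hf', g + g', add_mem hg hg', fun k a ha => ?_⟩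
        rw [add_apply, h k a ha, h' k a ha]
        simp only [hochD, add_apply, mul_add, add_mul, smul_add,
          Finset.sum_add_distrib]
        abel
      zero_mem' := ⟨zero_mem _, 0, zero_mem _, fun k a _ => by simp [hochD]⟩
      smul_mem' := by
        rintro c f ⟨hf, g, hg, h⟩
        refine ⟨Submodule.smul_mem _ c hf, c • g, Submodule.smul_mem _ c hg, fun k a ha => ?_⟩
        rw [smul_apply, h k a ha]
        simp only [hochD, smul_apply, mul_smul_comm, smul_mul_assoc, smul_add,
          Finset.smul_sum, smul_comm c] }

/-- The Hochschild cohomology `Hoch^{p,q}(H, H)`, cocycles modulo coboundaries, of the graded algebra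
`H = ⨁ ℋ k`; it is realized as the image of the cocycles in the quotient of the space of all `p`-linear
maps by the coboundaries. -/
def HochCohomology (ℋ : ℤ → Submodule F H) (p : ℕ) (q : ℤ) :
    Submodule F (MultilinearMap F (fun _ : Fin p => H) H ⧸ hochCoboundaries ℋ p q) :=
  (hochCocycles ℋ p q).map (hochCoboundaries ℋ p q).mkQ

/-- The Hochschild cohomology class of a cocycle. -/
def hochClass {ℋ : ℤ → Submodule F H} {p : ℕ} {q : ℤ} (f : hochCocycles ℋ p q) :
    HochCohomology ℋ p q :=
  ⟨(hochCoboundaries ℋ p q).mkQ f.1, Submodule.mem_map_of_mem f.2⟩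

lemma hochClass_eq_iff {ℋ : ℤ → Submodule F H} {p : ℕ} {q : ℤ} (f g : hochCocycles ℋ p q) :
    hochClass f = hochClass g ↔ f.1 - g.1 ∈ hochCoboundaries ℋ p q :=
  Subtype.ext_iff.trans (Submodule.Quotient.eq _)

variable {H' : Type*} [Ring H'] [Algebra F H']

/-- The map `f ↦ φ⁻¹ ∘ f ∘ (φ ⊗ ⋯ ⊗ φ)` on `p`-linear maps. -/
def multilinearPullback (φ : H ≃ₐ[F] H') (p : ℕ) :
    MultilinearMap F (fun _ : Fin p => H') H' →ₗ[F] MultilinearMap F (fun _ : Fin p => H) H where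
  toFun f := φ.symm.toLinearMap.compMultilinearMap
    (f.compLinearMap (fun _ => φ.toLinearMap))
  map_add' f g := by ext; simp
  map_smul' c f := by ext; simp

lemma multilinearPullback_apply (φ : H ≃ₐ[F] H') (p : ℕ)
    (f : MultilinearMap F (fun _ : Fin p => H') H') (a : Fin p → H) :
    multilinearPullback φ p f a = φ.symm (f (fun i => φ (a i))) := rfl

lemma hochD_pullback (φ : H ≃ₐ[F] H') (p : ℕ) (q : ℤ)
    (f : MultilinearMap F (fun _ : Fin p => H') H') (k : ℕ → ℤ) (a : ℕ → H) :
    hochD p q (multilinearPullback φ p f) k a = φ.symm (hochD p q f k (fun i => φ (a i))) := by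
  have h : ∀ r i, φ (mulAt a r i) = mulAt (fun i => φ (a i)) r i := by
    intro r i
    unfold mulAt
    split_ifs <;> simp
  simp [hochD, multilinearPullback_apply, h]

/-- An isomorphism of graded algebras. -/
structure GradedAlgIso (ℋ : ℤ → Submodule F H) (ℋ' : ℤ → Submodule F H') where
  toAlgEquiv : H ≃ₐ[F] H'
  mem_iff : ∀ (k : ℤ) (x : H), toAlgEquiv x ∈ ℋ' k ↔ x ∈ ℋ k

namespace GradedAlgIso

variable {ℋ : ℤ → Submodule F H} {ℋ' : ℤ → Submodule F H'}

lemma symm_mem (φ : GradedAlgIso ℋ ℋ') {k : ℤ} {y : H'} (hy : y ∈ ℋ' k) :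
    φ.toAlgEquiv.symm y ∈ ℋ k := by
  rw [← φ.mem_iff]
  simpa using hy

lemma pullback_cochain (φ : GradedAlgIso ℋ ℋ') (p : ℕ) (q : ℤ)
    {f : MultilinearMap F (fun _ : Fin p => H') H'} (hf : f ∈ hochCochains ℋ' p q) :
    multilinearPullback φ.toAlgEquiv p f ∈ hochCochains ℋ p q :=
  fun k _ ha => φ.symm_mem (hf k _ (fun i => (φ.mem_iff _ _).2 (ha i)))

lemma pullback_cocycle (φ : GradedAlgIso ℋ ℋ') (p : ℕ) (q : ℤ)
    {f : MultilinearMap F (fun _ : Fin p => H') H'} (hf : f ∈ hochCocycles ℋ' p q) :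
    multilinearPullback φ.toAlgEquiv p f ∈ hochCocycles ℋ p q := by
  refine ⟨φ.pullback_cochain p q hf.1, fun k a ha => ?_⟩
  rw [hochD_pullback, hf.2 k _ (fun i => (φ.mem_iff _ _).2 (ha i)), map_zero]

lemma pullback_coboundary (φ : GradedAlgIso ℋ ℋ') (p : ℕ) (q : ℤ)
    {f : MultilinearMap F (fun _ : Fin p => H') H'} (hf : f ∈ hochCoboundaries ℋ' p q) :
    multilinearPullback φ.toAlgEquiv p f ∈ hochCoboundaries ℋ p q := by
  cases p with
  | zero =>
    have hf0 : f = 0 := hf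
    rw [hf0, map_zero]
    exact zero_mem _
  | succ p =>
    obtain ⟨hf, g, hg, h⟩ := hf
    refine ⟨φ.pullback_cochain _ q hf, multilinearPullback φ.toAlgEquiv p g,
      φ.pullback_cochain p q hg, fun k a ha => ?_⟩
    rw [hochD_pullback, multilinearPullback_apply,
      ← h k _ (fun i => (φ.mem_iff _ _).2 (ha i))]

/-- The map `φ* : [f] ↦ [φ⁻¹ ∘ f ∘ (φ ⊗ ⋯ ⊗ φ)]` induced in Hochschild cohomology by an isomorphism
of graded algebras `φ : H → H'`. -/
def hochPullback (φ : GradedAlgIso ℋ ℋ') (p : ℕ) (q : ℤ) :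
    HochCohomology ℋ' p q →ₗ[F] HochCohomology ℋ p q :=
  (Submodule.mapQ (hochCoboundaries ℋ' p q) (hochCoboundaries ℋ p q)
    (multilinearPullback φ.toAlgEquiv p) (fun _ hf => φ.pullback_coboundary p q hf)).restrict (by
      rintro _ ⟨f, hf, rfl⟩
      exact ⟨_, φ.pullback_cocycle p q hf, rfl⟩)

lemma hochPullback_hochClass (φ : GradedAlgIso ℋ ℋ') (p : ℕ) (q : ℤ) (f : hochCocycles ℋ' p q) :
    φ.hochPullback p q (hochClass f) =
      hochClass ⟨multilinearPullback φ.toAlgEquiv p f.1, φ.pullback_cocycle p q f.2⟩ := rfl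

end GradedAlgIso

end Hochschild

namespace PoincareDGCA.HodgeDecomposition

open DGCA

variable {F : Type*} [Field F] {n : ℕ} {A : PoincareDGCA F n} (D : A.HodgeDecomposition)

lemma d_harm {x : A.toDGCA} (hx : x ∈ D.harm) : A.d x = 0 := by
  have : x ∈ LinearMap.ker A.d := D.range_sup_harm ▸ Submodule.mem_sup_right hx
  simpa using this

lemma isCompl_range : IsCompl (LinearMap.range A.d) (D.harm ⊔ D.compl) := by
  have h1 : Disjoint (LinearMap.range A.d) D.harm := disjoint_iff.2 D.range_inf_harm
  refine ⟨h1.disjoint_sup_right_of_disjoint_sup_left D.isCompl.disjoint, ?_⟩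
  rw [codisjoint_iff, ← sup_assoc]
  exact D.isCompl.sup_eq_top

lemma isCompl_harm : IsCompl D.harm (LinearMap.range A.d ⊔ D.compl) := by
  have h1 : Disjoint D.harm (LinearMap.range A.d) := (disjoint_iff.2 D.range_inf_harm).symm
  refine ⟨h1.disjoint_sup_right_of_disjoint_sup_left ?_, ?_⟩
  · rw [sup_comm]
    exact D.isCompl.disjoint
  · rw [codisjoint_iff, ← sup_assoc, sup_comm D.harm]
    exact D.isCompl.sup_eq_top

lemma d_restrict_bijective :
    Function.Bijective (A.d.rangeRestrict ∘ₗ D.compl.subtype) := by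
  constructor
  · rw [← LinearMap.ker_eq_bot, LinearMap.ker_eq_bot']
    rintro ⟨x, hx⟩ h
    have h0 : A.d x = 0 := congrArg Subtype.val h
    have hk : x ∈ LinearMap.range A.d ⊔ D.harm := by
      rw [D.range_sup_harm]
      exact h0
    exact Subtype.ext (Submodule.disjoint_def.1 D.isCompl.disjoint x hk hx)
  · rintro ⟨_, x, rfl⟩
    have hx : x ∈ (LinearMap.range A.d ⊔ D.harm) ⊔ D.compl := by
      rw [D.isCompl.sup_eq_top]
      trivial
    obtain ⟨y, hy, z, hz, rfl⟩ := Submodule.mem_sup.1 hx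
    rw [D.range_sup_harm] at hy
    have hy' : A.d y = 0 := hy
    exact ⟨⟨z, hz⟩, Subtype.ext (by simp [hy'])⟩

/-- The operator `d⁻ : A → A` of degree `-1`: zero on `ℋ ⊕ ℬ`, and on `dA` the inverse of the
bijection `d : ℬ → dA`. -/
noncomputable def dInv : A.toDGCA →ₗ[F] A.toDGCA :=
  D.compl.subtype ∘ₗ
    (LinearEquiv.ofBijective (A.d.rangeRestrict ∘ₗ D.compl.subtype)
      D.d_restrict_bijective).symm.toLinearMap ∘ₗ
    (LinearMap.range A.d).projectionOnto (D.harm ⊔ D.compl) D.isCompl_range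

/-- The projection `π_ℋ : A → A` onto `ℋ` along `dA ⊕ ℬ`. -/
noncomputable def harmProj : A.toDGCA →ₗ[F] A.toDGCA :=
  D.harm.projection (LinearMap.range A.d ⊔ D.compl) D.isCompl_harm

lemma dInv_mem (x : A.toDGCA) : D.dInv x ∈ D.compl := by
  simp [dInv]

lemma d_dInv (x : A.toDGCA) : A.d (D.dInv x) =
    (LinearMap.range A.d).projection (D.harm ⊔ D.compl) D.isCompl_range x := by
  have h := LinearEquiv.apply_symm_apply
    (LinearEquiv.ofBijective (A.d.rangeRestrict ∘ₗ D.compl.subtype) D.d_restrict_bijective)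
    ((LinearMap.range A.d).projectionOnto (D.harm ⊔ D.compl) D.isCompl_range x)
  exact congrArg Subtype.val h

lemma d_injOn {x y : A.toDGCA} (hx : x ∈ D.compl) (hy : y ∈ D.compl) (h : A.d x = A.d y) :
    x = y := by
  have := D.d_restrict_bijective.1 (a₁ := ⟨x, hx⟩) (a₂ := ⟨y, hy⟩) (Subtype.ext h)
  exact congrArg Subtype.val this

lemma harmProj_mem (x : A.toDGCA) : D.harmProj x ∈ D.harm := by
  simp [harmProj]

lemma harmProj_mem_cocycles (x : A.toDGCA) : D.harmProj x ∈ A.cocycles :=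
  D.d_harm (D.harmProj_mem x)

lemma harmProj_d (x : A.toDGCA) : D.harmProj (A.d x) = 0 := by
  rw [harmProj, Submodule.projection_apply_eq_zero_iff]
  exact Submodule.mem_sup_left ⟨x, rfl⟩

lemma d_dInv_d (x : A.toDGCA) : A.d (D.dInv (A.d x)) = A.d x := by
  rw [d_dInv]
  exact Submodule.projection_apply_of_mem_left _ ⟨x, rfl⟩

/-- On cocycles, `π_ℋ = 1 - d d⁻`. -/
lemma harmProj_of_closed {x : A.toDGCA} (hx : A.d x = 0) :
    D.harmProj x = x - A.d (D.dInv x) := by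
  have hx' : x ∈ LinearMap.range A.d ⊔ D.harm := by
    rw [D.range_sup_harm]
    exact hx
  obtain ⟨_, ⟨y, rfl⟩, z, hz, rfl⟩ := Submodule.mem_sup.1 hx'
  have h1 : D.harmProj z = z := Submodule.projection_apply_of_mem_left _ hz
  have h2 : A.d (D.dInv z) = 0 := by
    rw [d_dInv, Submodule.projection_apply_eq_zero_iff]
    exact Submodule.mem_sup_left hz
  simp [harmProj_d, h1, h2, d_dInv_d]

lemma harmProj_compl {x : A.toDGCA} (hx : x ∈ D.compl) : D.harmProj x = 0 := by
  rw [harmProj, Submodule.projection_apply_eq_zero_iff]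
  exact Submodule.mem_sup_right hx

/-- The splitting map `ι : H(A) → A` with image `ℋ`, sending a class to its harmonic
representative. -/
noncomputable def splitting : A.Cohomology →ₗ[F] A.toDGCA :=
  A.liftCoh (D.harmProj ∘ₗ A.cocycles.val.toLinearMap) (by
    rintro z ⟨w, hw⟩
    simp [← hw, harmProj_d])

lemma splitting_cls (z : A.cocycles) : D.splitting (A.cls z) = D.harmProj (z : A.toDGCA) := rfl

/-- The map `x ↦ [π_ℋ x]` from `A` to `H(A)`. -/
noncomputable def harmClass : A.toDGCA →ₗ[F] A.Cohomology :=
  A.cls.toLinearMap ∘ₗ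
    D.harmProj.codRestrict (Subalgebra.toSubmodule A.cocycles) D.harmProj_mem_cocycles

lemma harmClass_of_closed (z : A.cocycles) : D.harmClass (z : A.toDGCA) = A.cls z := by
  rw [← sub_eq_zero]
  change A.cls _ - A.cls z = 0
  rw [← map_sub, cls_eq_zero_iff]
  refine ⟨-D.dInv z, ?_⟩
  have h := D.harmProj_of_closed (x := (z : A.toDGCA)) z.2
  change _ = D.harmProj (z : A.toDGCA) - (z : A.toDGCA)
  rw [h, map_neg]
  abel

lemma d_splitting (α : A.Cohomology) : A.d (D.splitting α) = 0 := by
  obtain ⟨z, rfl⟩ := A.cls_surjective α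
  exact D.harmProj_mem_cocycles _

lemma harmClass_splitting (α : A.Cohomology) : D.harmClass (D.splitting α) = α := by
  obtain ⟨z, rfl⟩ := A.cls_surjective α
  rw [splitting_cls]
  rw [D.harmProj_of_closed z.2, map_sub, D.harmClass_of_closed]
  have : D.harmClass (A.d (D.dInv z)) = A.cls 0 := by
    have h : D.harmProj (A.d (D.dInv z)) = 0 := D.harmProj_d _
    change A.cls _ = A.cls 0
    congr 1
    exact Subtype.ext h
  rw [this, map_zero, sub_zero]

/-- The element `d⁻(x y) z - (-1)^{|x|} x d⁻(y z)` of `A`. -/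
noncomputable def tri (x y z : A.toDGCA) : A.toDGCA :=
  D.dInv (x * y) * z - A.parity x * D.dInv (y * z)

/-- The ternary multiplication `μ₃` on `H(A)`:
`μ₃(α, β, γ) = [π_ℋ (d⁻(ια ιβ) ιγ - (-1)^{|α|} ια d⁻(ιβ ιγ))]`. -/
noncomputable def mu3 : MultilinearMap F (fun _ : Fin 3 => A.Cohomology) A.Cohomology :=
  MultilinearMap.mk'
    (fun v => D.harmClass (D.tri (D.splitting (v 0)) (D.splitting (v 1)) (D.splitting (v 2))))
    (by
      intro v i x y
      fin_cases i <;> simp [tri, add_mul, mul_add] <;> abel)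
    (by
      intro v i c x
      fin_cases i <;> simp [tri, smul_sub])

lemma mu3_apply (v : Fin 3 → A.Cohomology) : D.mu3 v =
    D.harmClass (D.tri (D.splitting (v 0)) (D.splitting (v 1)) (D.splitting (v 2))) := rfl

lemma harmProj_mem_deg {k : ℤ} {x : A.toDGCA} (hx : x ∈ A.deg k) : D.harmProj x ∈ A.deg k := by
  have h1 : D.harmProj (x - D.harmProj x) = 0 := by
    rw [map_sub, sub_eq_zero]
    exact (Submodule.projection_apply_of_mem_left _ (D.harmProj_mem x)).symm
  rw [harmProj, Submodule.projection_apply_eq_zero_iff] at h1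
  obtain ⟨_, ⟨w, rfl⟩, z, hz, hwz⟩ := Submodule.mem_sup.1 h1
  have h2 : x = D.harmProj x + (A.d w + z) := by
    rw [hwz, harmProj]
    abel
  have h3 : x = A.proj k (D.harmProj x) + (A.d (A.proj (k - 1) w) + A.proj k z) := by
    have := congrArg (A.proj k) h2
    rw [proj_of_mem hx, map_add, map_add] at this
    rw [← proj_d, sub_add_cancel]
    exact this
  have h4 : D.harmProj x = A.proj k (D.harmProj x) := by
    conv_lhs => rw [h3]
    rw [map_add, map_add, harmProj_d, harmProj_compl D (D.compl_graded k z hz), add_zero, add_zero]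
    exact Submodule.projection_apply_of_mem_left _ (D.harm_graded k _ (D.harmProj_mem x))
  rw [h4]
  exact proj_mem _ _

lemma dInv_mem_deg {k : ℤ} {x : A.toDGCA} (hx : x ∈ A.deg k) : D.dInv x ∈ A.deg (k - 1) := by
  obtain ⟨y, hy, u, hu, hyu⟩ := Submodule.mem_sup.1
    (show x ∈ LinearMap.range A.d ⊔ (D.harm ⊔ D.compl) by
      rw [D.isCompl_range.sup_eq_top]
      trivial)
  obtain ⟨w, rfl⟩ := hy
  have hsum : ∀ j, A.proj j u ∈ D.harm ⊔ D.compl := by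
    intro j
    obtain ⟨b, hb, c, hc, rfl⟩ := Submodule.mem_sup.1 hu
    rw [map_add]
    exact Submodule.add_mem_sup (D.harm_graded j b hb) (D.compl_graded j c hc)
  have key : ∀ v, v ∈ D.harm ⊔ D.compl → D.dInv v = 0 := by
    intro v hv
    have h : (LinearMap.range A.d).projectionOnto (D.harm ⊔ D.compl) D.isCompl_range v = 0 :=
      (Submodule.projectionOnto_apply_eq_zero_iff _).2 hv
    simp [dInv, h]
  have h3 : x = A.d (A.proj (k - 1) w) + A.proj k u := by
    have := congrArg (A.proj k) hyu
    rw [proj_of_mem hx, map_add] at this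
    rw [← proj_d, sub_add_cancel]
    exact this.symm
  have h4 : D.dInv x = D.dInv (A.d (A.proj (k - 1) w)) := by
    conv_lhs => rw [h3]
    rw [map_add, key _ (hsum k), add_zero]
  have h5 : D.dInv x = A.proj (k - 1) (D.dInv x) := by
    refine D.d_injOn (D.dInv_mem _) (D.compl_graded _ _ (D.dInv_mem _)) ?_
    rw [← proj_d, sub_add_cancel, h4, d_dInv_d]
    exact (proj_of_mem (by simpa using A.d_mem _ _ (proj_mem (k - 1) w))).symm
  rw [h5]
  exact proj_mem _ _

lemma splitting_mem_deg {k : ℤ} {α : A.Cohomology} (hα : α ∈ A.cohDeg k) :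
    D.splitting α ∈ A.deg k := by
  obtain ⟨z, hz, rfl⟩ := mem_cohDeg.1 hα
  exact D.harmProj_mem_deg hz

lemma harmClass_mem_deg {k : ℤ} {x : A.toDGCA} (hx : x ∈ A.deg k) :
    D.harmClass x ∈ A.cohDeg k :=
  mem_cohDeg.2 ⟨⟨D.harmProj x, D.harmProj_mem_cocycles x⟩, D.harmProj_mem_deg hx, rfl⟩

lemma mu3_mem_cochains : D.mu3 ∈ hochCochains A.cohDeg 3 (-1) := by
  intro k v hv
  rw [mu3_apply]
  apply D.harmClass_mem_deg
  have h0 := D.splitting_mem_deg (hv 0)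
  have h1 := D.splitting_mem_deg (hv 1)
  have h2 := D.splitting_mem_deg (hv 2)
  have e : (∑ i, k i) + (-1) = k 0 + k 1 + k 2 - 1 := by
    rw [Fin.sum_univ_three]
    ring
  rw [e]
  refine sub_mem ?_ ?_
  · have := SetLike.mul_mem_graded (D.dInv_mem_deg (SetLike.mul_mem_graded h0 h1)) h2
    rwa [show k 0 + k 1 - 1 + k 2 = k 0 + k 1 + k 2 - 1 by ring] at this
  · rw [parity_of_mem h0, smul_mul_assoc]
    have := SetLike.mul_mem_graded h0 (D.dInv_mem_deg (SetLike.mul_mem_graded h1 h2))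
    rw [show k 0 + (k 1 + k 2 - 1) = k 0 + k 1 + k 2 - 1 by ring] at this
    exact Submodule.smul_mem _ _ this

lemma harmClass_d (x : A.toDGCA) : D.harmClass (A.d x) = 0 := by
  have h := D.harmClass_of_closed ⟨A.d x, A.d_d x⟩
  rw [h, cls_eq_zero_iff]
  exact ⟨x, rfl⟩

lemma harmClass_dInv (x : A.toDGCA) : D.harmClass (D.dInv x) = 0 := by
  have h : D.harmProj (D.dInv x) = 0 := D.harmProj_compl (D.dInv_mem x)
  have : D.harmClass (D.dInv x) = A.cls 0 := by
    change A.cls _ = A.cls 0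
    congr 1
    exact Subtype.ext h
  rw [this, map_zero]

lemma harmClass_mul {x y : A.toDGCA} (hx : A.d x = 0) (hy : A.d y = 0) :
    D.harmClass (x * y) = D.harmClass x * D.harmClass y := by
  have h := D.harmClass_of_closed (⟨x, hx⟩ * ⟨y, hy⟩)
  have h1 := D.harmClass_of_closed ⟨x, hx⟩
  have h2 := D.harmClass_of_closed ⟨y, hy⟩
  rw [h1, h2, ← map_mul]
  exact h

lemma splitting_mul (α β : A.Cohomology) :
    D.splitting (α * β) =
      D.splitting α * D.splitting β - A.d (D.dInv (D.splitting α * D.splitting β)) := by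
  have hα := D.d_splitting α
  have hβ := D.d_splitting β
  have hc : A.d (D.splitting α * D.splitting β) = 0 := by simp [d_mul, hα, hβ]
  rw [← D.harmProj_of_closed hc]
  have h := D.harmClass_of_closed ⟨_, hc⟩
  have h2 := D.harmClass_mul hα hβ
  rw [D.harmClass_splitting, D.harmClass_splitting] at h2
  rw [← h2, h, splitting_cls]

lemma parity_closed {x : A.toDGCA} (hx : A.d x = 0) : A.d (A.parity x) = 0 := by
  have := parity_d x
  rw [hx, map_zero] at this
  simpa using this.symm

/-- `x - d⁻ d x` is a cocycle representing `[π_ℋ x]`. -/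
lemma harmClass_eq_corrected (x : A.toDGCA) :
    D.harmClass x = D.harmClass (x - D.dInv (A.d x)) := by
  rw [map_sub, harmClass_dInv, sub_zero]

lemma d_corrected (x : A.toDGCA) : A.d (x - D.dInv (A.d x)) = 0 := by
  rw [map_sub, d_dInv_d, sub_self]

lemma mu3_cocycle (α β γ δ : A.Cohomology) :
    D.harmClass (A.parity (D.splitting α)) *
        D.harmClass (D.tri (D.splitting β) (D.splitting γ) (D.splitting δ))
      - D.harmClass (D.tri (D.splitting (α * β)) (D.splitting γ) (D.splitting δ))
      + D.harmClass (D.tri (D.splitting α) (D.splitting (β * γ)) (D.splitting δ))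
      - D.harmClass (D.tri (D.splitting α) (D.splitting β) (D.splitting (γ * δ)))
      + D.harmClass (D.tri (D.splitting α) (D.splitting β) (D.splitting γ)) * δ = 0 := by
  rw [D.splitting_mul α β, D.splitting_mul β γ, D.splitting_mul γ δ]
  conv_lhs =>
    enter [2, 2]
    rw [← D.harmClass_splitting δ]
  have ha := D.d_splitting α
  have hb := D.d_splitting β
  have hc := D.d_splitting γ
  have he := D.d_splitting δ
  generalize D.splitting α = a at *
  generalize D.splitting β = b at *
  generalize D.splitting γ = c at *
  generalize D.splitting δ = e at *
  rw [D.harmClass_eq_corrected (D.tri b c e), D.harmClass_eq_corrected (D.tri a b c),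
    ← D.harmClass_mul (parity_closed ha) (D.d_corrected _), ← D.harmClass_mul (D.d_corrected _) he,
    ← map_sub, ← map_add, ← map_sub, ← map_add]
  have hY : A.d (D.tri b c e) =
      b * (c * e - A.d (D.dInv (c * e))) - (b * c - A.d (D.dInv (b * c))) * e := by
    simp only [tri, map_sub, d_mul, parity_parity, parity_closed hb, he]
    noncomm_ring
  have hX : A.d (D.tri a b c) =
      a * (b * c - A.d (D.dInv (b * c))) - (a * b - A.d (D.dInv (a * b))) * c := by
    simp only [tri, map_sub, d_mul, parity_parity, parity_closed ha, hc]
    noncomm_ring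
  rw [hX, hY]
  convert D.harmClass_d (A.parity (D.dInv (a * b)) * D.dInv (c * e)) using 2
  simp only [tri, map_sub, d_mul, parity_parity, parity_d, parity_mul, mul_assoc, sub_mul, mul_sub]
  noncomm_ring

lemma harmClass_parity_splitting {k : ℤ} {α : A.Cohomology} (hα : α ∈ A.cohDeg k) :
    D.harmClass (A.parity (D.splitting α)) = ((-1 : F) ^ k) • α := by
  rw [parity_of_mem (D.splitting_mem_deg hα), map_smul, harmClass_splitting]

/-- `μ₃` is a Hochschild cocycle of `H(A)`. -/
lemma mu3_mem_cocycles : D.mu3 ∈ hochCocycles A.cohDeg 3 (-1) := by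
  refine ⟨D.mu3_mem_cochains, fun k a ha => ?_⟩
  have h := D.mu3_cocycle (a 0) (a 1) (a 2) (a 3)
  rw [D.harmClass_parity_splitting (ha 0)] at h
  rw [← h]
  have hk : (-1 : F) ^ (-1 * k 0) = (-1 : F) ^ k 0 := by
    rw [neg_one_mul, zpow_neg, ← inv_zpow]
    norm_num
  have h3 : (-1 : F) ^ 3 = -1 := by norm_num
  have h4 : (-1 : F) ^ 4 = 1 := by norm_num
  simp only [hochD, hk, mu3_apply, Finset.sum_range_succ, Finset.sum_range_zero, mulAt]
  simp [h3, h4]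
  abel

/-- The class `[μ₃] ∈ Hoch^{3,-1}(H(A), H(A))`. -/
noncomputable def mu3Class : HochCohomology A.cohDeg 3 (-1) :=
  hochClass ⟨D.mu3, D.mu3_mem_cocycles⟩

end PoincareDGCA.HodgeDecomposition

/-- An `A_∞`-morphism `f = (f₁, f₂, …) : A → B` of DG algebras, regarded as `A_∞`-algebras with
`m₁ = d`, `m₂ =` the product and `m_s = 0` for `s ≥ 3`. The map `map N` is `f_N`, for `N ≥ 1`
(`map 0` plays no role), which is `N`-linear of degree `1 - N`. The equations are
`∑_{r+s+t=N} (-1)^{r+st} f_{r+1+t}(1^{⊗r} ⊗ m_s ⊗ 1^{⊗t})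
  = ∑_{i₁+⋯+i_j=N} (-1)^u m_j(f_{i₁} ⊗ ⋯ ⊗ f_{i_j})` with `u = ∑_{l<j} (j-l)(i_l-1)`,
evaluated with the Koszul sign rule on homogeneous elements `a₀, …, a_{N-1}` of degrees
`k₀, …, k_{N-1}`; as `m_s = 0` for `s ≥ 3`, only `s = 1, 2` and `j = 1, 2` contribute. -/
structure AInftyHom {F : Type*} [Field F] (A B : DGCA F) where
  map : ∀ N : ℕ, MultilinearMap F (fun _ : Fin N => A) B
  map_mem : ∀ N : ℕ, 1 ≤ N → ∀ (k : Fin N → ℤ) (a : Fin N → A), (∀ i, a i ∈ A.deg (k i)) →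
    map N a ∈ B.deg ((∑ i, k i) + (1 - N))
  relation : ∀ N : ℕ, 1 ≤ N → ∀ (k : ℕ → ℤ) (a : ℕ → A), (∀ i, a i ∈ A.deg (k i)) →
    (∑ r ∈ Finset.range N, ((-1 : F) ^ ((N : ℤ) - 1 + ∑ l ∈ Finset.range r, k l)) •
        map N (fun i => Function.update a r (A.d (a r)) i))
      + ∑ r ∈ Finset.range (N - 1), ((-1 : F) ^ r) • map (N - 1) (fun i => mulAt a r i)
    = B.d (map N (fun i => a i))
      + ∑ i ∈ Finset.Ico 1 N,
          ((-1 : F) ^ (((i : ℤ) - 1) + ((N : ℤ) - i - 1) * ∑ l ∈ Finset.range i, k l)) •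
            (map i (fun l => a l) * map (N - i) (fun l => a (i + l)))

namespace AInftyHom

open DGCA

variable {F : Type*} [Field F] {A B : DGCA F} (f : AInftyHom A B)

/-- The linear component `f₁`. -/
def linearPart : A →ₗ[F] B where
  toFun x := f.map 1 (fun _ => x)
  map_add' x y := by
    have h := (f.map 1).map_update_add (fun _ => 0) 0 x y
    simp only [Function.update_eq_const_of_subsingleton] at h
    exact h
  map_smul' c x := by
    have h := (f.map 1).map_update_smul (fun _ => 0) 0 c x
    simp only [Function.update_eq_const_of_subsingleton] at h
    exact h

lemma linearPart_d (x : A) : f.linearPart (A.d x) = B.d (f.linearPart x) := by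
  refine linear_ext (f := f.linearPart ∘ₗ A.d) (g := B.d ∘ₗ f.linearPart) ?_ x
  intro k x hx
  have h := f.relation 1 le_rfl (fun i => if i = 0 then k else 0) (fun i => if i = 0 then x else 0)
    (by
      intro i
      by_cases hi : i = 0
      · simpa [hi] using hx
      · simp [hi])
  have e1 : (fun i : Fin 1 => if (i : ℕ) = 0 then x else 0) = fun _ => x := by
    ext i
    simp
  have e2 : (fun i : Fin 1 => Function.update (fun i : ℕ => if i = 0 then x else 0) 0 (A.d x) i) =
      fun _ => A.d x := by
    ext i
    simp [Subsingleton.elim i 0]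
  have h' : f.map 1 (fun _ => A.d x) = B.d (f.map 1 (fun _ => x)) := by
    simpa [e1, e2] using h
  exact h'

/-- The map `H(A) → H(B)` induced by `f₁`. -/
noncomputable def cohMap : A.Cohomology →ₗ[F] B.Cohomology :=
  A.liftCoh
    (B.cls.toLinearMap ∘ₗ
      (f.linearPart ∘ₗ A.cocycles.val.toLinearMap).codRestrict (Subalgebra.toSubmodule B.cocycles)
        (by
          intro z
          have hz : A.d (z : A) = 0 := z.2
          change B.d (f.linearPart (z : A)) = 0
          rw [← linearPart_d, hz, map_zero]))
    (by
      rintro z ⟨w, hw⟩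
      refine cls_eq_zero_iff.2 ⟨f.linearPart w, ?_⟩
      rw [← linearPart_d, hw]
      rfl)

/-- `f` is an `A_∞`-quasi-isomorphism if `f₁` induces an isomorphism in cohomology. -/
def IsQuasiIso : Prop := Function.Bijective f.cohMap

end AInftyHom

/-- `A` and `B` are `A_∞`-quasi-isomorphic: there is an `A_∞`-quasi-isomorphism `A → B`. -/
def AInftyQuasiIsomorphic {F : Type*} [Field F] (A B : DGCA F) : Prop :=
  ∃ f : AInftyHom A B, f.IsQuasiIso

/-! An `A_∞`-morphism is handled as one function `U` on lists of elements of `A₁` with values in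
`A₂`, that is, a map from the bar construction, homogeneous of degree zero after suspension. Its
equations become one Maurer–Cartan type equation `dU - U b₁ = quad U`, where `quad U = U b₂ - Ū ∪
U`, with `b₁`, `b₂` the suspended differential and product of `A₁` and `Ū` the composite of `U` with
the grading involution.

Necessity and independence. If `j : H → C` chooses cocycles multiplicatively up to a homotopy `k`,
then `k(α,β) jγ ∓ jα k(β,γ) + k(αβ,γ) - k(α,βγ)` is an associativity defect, and changing `(j, k)`
by a homotopy changes its class by a Hochschild coboundary (`assocDefect_sub`). Both `μ₃` of the
target and the image of `μ₃` of the source under the first two components of an `A_∞`-morphism are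
such defects, the third component making a certain cocycle exact. Hence `exists_hochDiff_eq`;
applied to the identity it shows that the class does not depend on the decomposition.

Sufficiency. Let `φ` match the classes. The Hodge homotopies of source and target give a homotopy on
functions on the bar construction, and, as in Kuranishi theory, every harmonic part `σ` extends to a
fixed point `extension D D' σ` of an iteration. By the Bianchi identity `d_quad` and induction on
the length, the fixed point solves the equation as soon as the harmonic part of `quad` vanishes on
harmonic lists (`extension_equation`). This obstruction vanishes in arity 2 since `φ` is
multiplicative, and in arity 3 since the bilinear part of `σ` bounds the difference of the `μ₃`. In
arity at least 4 it has degree at least `2 + 4(r - 1) = 4r - 2`. As `n ≤ 5r - 3`, duality and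
connectedness leave only the top degree `n`. Units would spoil this count, so everything is kept
normalized.

The top degree component dies for a metric reason (`int_quad_eq_zero`): the orthogonality in the
Hodge decomposition reduces its integral to expressions in `σ` alone, and these vanish if `σ` is an
isometry up to the scalar by which `φ` rescales the integral. Such a `σ` is `φ` composed with the
exponential of a coderivation `w` that is an infinitesimal isometry, which uses characteristic zero.
For this the cochain bounding the difference of the `μ₃` must be normalized, cyclic and of integral
zero. `exists_cyclic_cochain` arranges it, using that `μ₃` is antisymmetric under reversal because
the algebras are graded commutative. -/

namespace DGCA

variable {F : Type*} [Field F] (A : DGCA F)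

/-! ### The grading involution and the grading of the cohomology. -/

section
variable {A}

lemma parity_one : A.parity 1 = 1 := by
  rw [parity_of_mem (k := 0) SetLike.GradedOne.one_mem]
  simp

lemma parity_mem_deg {k : ℤ} {x : A} (hx : x ∈ A.deg k) : A.parity x ∈ A.deg k := by
  rw [parity_of_mem hx]
  exact Submodule.smul_mem _ _ hx

lemma exists_sum_proj (x : A) : ∃ s : Finset ℤ, ∑ k ∈ s, A.proj k x = x := by
  classical
  exact ⟨(DirectSum.decompose A.deg x).support, DirectSum.sum_support_decompose A.deg x⟩

/-- A linear subspace stable under the projections onto the components is stable under the grading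
involution. -/
lemma parity_mem_of_graded {S : Submodule F A} (hS : ∀ k, ∀ x ∈ S, A.proj k x ∈ S) {x : A}
    (hx : x ∈ S) : A.parity x ∈ S := by
  obtain ⟨s, hs⟩ := exists_sum_proj x
  rw [← hs, map_sum]
  refine Submodule.sum_mem _ fun k _ => ?_
  rw [parity_of_mem (proj_mem k x)]
  exact Submodule.smul_mem _ _ (hS k x hx)

lemma d_parity (x : A) : A.d (A.parity x) = -A.parity (A.d x) := by
  rw [parity_d, neg_neg]

end

/-- The grading involution of the cohomology. -/
noncomputable def cohParity : A.Cohomology →ₗ[F] A.Cohomology :=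
  A.liftCoh
    (A.cls.toLinearMap ∘ₗ
      (A.parity ∘ₗ A.cocycles.val.toLinearMap).codRestrict (Subalgebra.toSubmodule A.cocycles)
        (by
          intro z
          have hz : A.d (z : A) = 0 := z.2
          change A.d (A.parity (z : A)) = 0
          rw [d_parity, hz, map_zero, neg_zero]))
    (by
      rintro z ⟨w, hw⟩
      refine cls_eq_zero_iff.2 ⟨-A.parity w, ?_⟩
      rw [map_neg, d_parity, hw, neg_neg]
      rfl)

section
variable {A}

lemma cohParity_cls (z : A.cocycles) (h : A.parity z ∈ A.cocycles) :
    A.cohParity (A.cls z) = A.cls ⟨A.parity z, h⟩ := rfl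

lemma cls_mem_cohDeg {k : ℤ} {z : A.cocycles} (hz : (z : A) ∈ A.deg k) : A.cls z ∈ A.cohDeg k :=
  mem_cohDeg.2 ⟨z, hz, rfl⟩

lemma cohParity_of_mem {k : ℤ} {α : A.Cohomology} (h : α ∈ A.cohDeg k) :
    A.cohParity α = ((-1 : F) ^ k) • α := by
  obtain ⟨z, hz, rfl⟩ := mem_cohDeg.1 h
  rw [← map_smul, cohParity_cls _ (by rw [parity_of_mem hz]; exact (((-1 : F) ^ k) • z).2)]
  congr 1
  exact Subtype.ext (parity_of_mem hz)

/-- Every cohomology class is a sum of homogeneous ones. -/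
lemma coh_induction {P : A.Cohomology → Prop} (h0 : P 0) (hom : ∀ k, ∀ α ∈ A.cohDeg k, P α)
    (hadd : ∀ α β, P α → P β → P (α + β)) (α : A.Cohomology) : P α := by
  obtain ⟨z, rfl⟩ := A.cls_surjective α
  have hc : ∀ k, A.proj k (z : A) ∈ A.cocycles := fun k => by
    rw [mem_cocycles, ← proj_d, mem_cocycles.1 z.2, map_zero]
  obtain ⟨s, hs⟩ := exists_sum_proj (z : A)
  have hz : z = ∑ k ∈ s, ⟨A.proj k z, hc k⟩ := by
    apply Subtype.ext
    rw [AddSubmonoidClass.coe_finsetSum]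
    exact hs.symm
  rw [hz, map_sum]
  exact Finset.sum_induction _ P hadd h0 fun k _ => hom k _ (cls_mem_cohDeg (proj_mem _ _))

lemma coh_linear_ext {M : Type*} [AddCommGroup M] [Module F M] {f g : A.Cohomology →ₗ[F] M}
    (h : ∀ k, ∀ α ∈ A.cohDeg k, f α = g α) (α : A.Cohomology) : f α = g α := by
  refine coh_induction (P := fun α => f α = g α) (by simp) h ?_ α
  intro α β hα hβ
  simp [hα, hβ]

lemma one_mem_cohDeg : (1 : A.Cohomology) ∈ A.cohDeg 0 := by
  rw [← map_one A.cls]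
  exact cls_mem_cohDeg (z := 1) SetLike.GradedOne.one_mem

lemma mul_mem_cohDeg {k l : ℤ} {α β : A.Cohomology} (hα : α ∈ A.cohDeg k) (hβ : β ∈ A.cohDeg l) :
    α * β ∈ A.cohDeg (k + l) := by
  obtain ⟨x, hx, rfl⟩ := mem_cohDeg.1 hα
  obtain ⟨y, hy, rfl⟩ := mem_cohDeg.1 hβ
  rw [← map_mul]
  exact cls_mem_cohDeg (z := x * y) (SetLike.mul_mem_graded hx hy)

lemma coh_graded_comm {k l : ℤ} {α β : A.Cohomology} (hα : α ∈ A.cohDeg k)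
    (hβ : β ∈ A.cohDeg l) : α * β = ((-1 : F) ^ (k * l)) • (β * α) := by
  obtain ⟨x, hx, rfl⟩ := mem_cohDeg.1 hα
  obtain ⟨y, hy, rfl⟩ := mem_cohDeg.1 hβ
  rw [← map_mul, ← map_mul, ← map_smul]
  congr 1
  exact Subtype.ext (A.graded_comm k l x y hx hy)

lemma cohParity_mem {k : ℤ} {α : A.Cohomology} (h : α ∈ A.cohDeg k) :
    A.cohParity α ∈ A.cohDeg k := by
  rw [cohParity_of_mem h]
  exact Submodule.smul_mem _ _ h

lemma cohParity_cohParity (α : A.Cohomology) : A.cohParity (A.cohParity α) = α := by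
  refine coh_linear_ext (f := A.cohParity ∘ₗ A.cohParity) (g := LinearMap.id) ?_ α
  intro k α hα
  simp only [LinearMap.comp_apply, cohParity_of_mem hα, map_smul, smul_smul, LinearMap.id_apply]
  rw [← mul_zpow]
  simp

lemma cohParity_one : A.cohParity 1 = 1 := by
  rw [cohParity_of_mem one_mem_cohDeg]
  simp

lemma cohParity_mul (α β : A.Cohomology) :
    A.cohParity (α * β) = A.cohParity α * A.cohParity β := by
  refine coh_linear_ext (f := A.cohParity ∘ₗ LinearMap.mulRight F β)
    (g := LinearMap.mulRight F (A.cohParity β) ∘ₗ A.cohParity) ?_ α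
  intro k α hα
  refine coh_linear_ext (f := A.cohParity ∘ₗ LinearMap.mulLeft F α)
    (g := LinearMap.mulLeft F (A.cohParity α) ∘ₗ A.cohParity) ?_ β
  intro l β hβ
  simp only [LinearMap.comp_apply, LinearMap.mulLeft_apply, cohParity_of_mem hα,
    cohParity_of_mem hβ, cohParity_of_mem (mul_mem_cohDeg hα hβ), smul_mul_assoc, mul_smul_comm,
    smul_smul]
  rw [zpow_add₀ (by simp), mul_comm]

end

end DGCA

/-! ### Poincaré duality and the Hodge homotopy. -/

namespace PoincareDGCA

open DGCA

variable {F : Type*} [Field F] {n : ℕ} {A : PoincareDGCA F n}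

lemma cohDeg_eq_bot {k : ℤ} (h : k < 0 ∨ (n : ℤ) < k) : A.cohDeg k = ⊥ := by
  rw [eq_bot_iff]
  intro α hα
  obtain ⟨z, hz, rfl⟩ := mem_cohDeg.1 hα
  rw [A.deg_eq_bot k h, Submodule.mem_bot] at hz
  have : z = 0 := Subtype.ext hz
  simp [this]

/-- A class is zero if it pairs to zero with all homogeneous classes. -/
lemma eq_zero_of_hom {α : A.Cohomology} (h : ∀ k, ∀ β ∈ A.cohDeg k, A.int (α * β) = 0) : α = 0 := by
  refine A.nondegenerate α fun β => ?_
  refine coh_linear_ext (f := A.int ∘ₗ LinearMap.mulLeft F α) (g := 0) ?_ β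
  intro k β hβ
  simpa using h k β hβ

/-- Poincaré duality: `H^k = 0` if `H^{n-k} = 0`. -/
lemma cohDeg_eq_bot_of_dual {k : ℤ} (h : A.cohDeg (n - k) = ⊥) : A.cohDeg k = ⊥ := by
  rw [eq_bot_iff]
  intro α hα
  rw [Submodule.mem_bot]
  refine eq_zero_of_hom fun l β hβ => ?_
  by_cases hl : l = n - k
  · subst hl
    rw [h, Submodule.mem_bot] at hβ
    simp [hβ]
  · exact A.int_eq_zero (k + l) (by omega) _ (mul_mem_cohDeg hα hβ)

lemma one_ne_zero_coh {m : ℕ} (hA : A.IsConnectedUpTo m) : (1 : A.Cohomology) ≠ 0 := by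
  intro h
  have : A.cohDeg 0 = ⊥ := by
    rw [eq_bot_iff]
    intro x _
    rw [Submodule.mem_bot, ← one_mul x, h, zero_mul]
  have h0 := hA.1
  rw [this, finrank_bot] at h0
  exact absurd h0 (by norm_num)

lemma cohDeg_zero {m : ℕ} (hA : A.IsConnectedUpTo m) {α : A.Cohomology} (hα : α ∈ A.cohDeg 0) :
    ∃ c : F, α = c • 1 := by
  have h1 := one_ne_zero_coh hA
  obtain ⟨c, hc⟩ := (finrank_eq_one_iff_of_nonzero' (⟨1, one_mem_cohDeg⟩ : A.cohDeg 0)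
    (fun h => h1 (congrArg Subtype.val h))).1 hA.1 ⟨α, hα⟩
  exact ⟨c, (congrArg Subtype.val hc).symm⟩

/-- For `n - m ≤ k < n` the dual degree `n - k` lies between 1 and `m`. This gap below the top
degree is what confines the higher obstructions to degree `n`. -/
lemma cohDeg_eq_bot_of_gap {m : ℕ} (hA : A.IsConnectedUpTo m) {k : ℤ} (h1 : (n : ℤ) - m ≤ k)
    (h2 : k ≠ n) : A.cohDeg k = ⊥ := by
  rcases lt_or_gt_of_ne h2 with h | h
  · exact cohDeg_eq_bot_of_dual (hA.2 _ (by omega) (by omega))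
  · exact cohDeg_eq_bot (Or.inr h)

/-- For degree reasons a top class can pair nontrivially only with `H⁰`, which consists of multiples
of `1`. -/
lemma eq_zero_of_int {m : ℕ} (hA : A.IsConnectedUpTo m) {α : A.Cohomology} (hα : α ∈ A.cohDeg n)
    (h : A.int α = 0) : α = 0 := by
  refine eq_zero_of_hom fun k β hβ => ?_
  by_cases hk : k = 0
  · subst hk
    obtain ⟨c, rfl⟩ := cohDeg_zero hA hβ
    simp [h]
  · exact A.int_eq_zero _ (by omega) _ (mul_mem_cohDeg hα hβ)

lemma exists_int_eq_one {m : ℕ} (hA : A.IsConnectedUpTo m) : ∃ ω ∈ A.cohDeg n, A.int ω = 1 := by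
  have h1 : ∃ β, A.int β ≠ 0 := by
    by_contra! h
    exact one_ne_zero_coh hA (A.nondegenerate 1 fun β => h _)
  obtain ⟨β, hβ⟩ := h1
  have h2 : ∃ ω ∈ A.cohDeg n, A.int ω ≠ 0 := by
    by_contra! h
    refine hβ (coh_linear_ext (f := A.int) (g := 0) ?_ β)
    intro k α hα
    by_cases hk : k = n
    · subst hk
      exact h α hα
    · exact A.int_eq_zero k hk α hα
  obtain ⟨ω, hω, h⟩ := h2
  exact ⟨(A.int ω)⁻¹ • ω, Submodule.smul_mem _ _ hω, by simp [h]⟩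

/-- A functional that vanishes outside the top degree is a multiple of the integral. -/
lemma eq_smul_int {m : ℕ} (hA : A.IsConnectedUpTo m) {J : A.Cohomology →ₗ[F] F}
    (hJ : ∀ k : ℤ, k ≠ n → ∀ α ∈ A.cohDeg k, J α = 0) : ∃ c : F, ∀ α, J α = c * A.int α := by
  obtain ⟨ω, hω, h1⟩ := exists_int_eq_one hA
  refine ⟨J ω, coh_linear_ext (f := J) (g := J ω • A.int) ?_⟩
  intro k α hα
  by_cases hk : k = n
  · subst hk
    have h := eq_zero_of_int hA (α := α - A.int α • ω)
      (sub_mem hα (Submodule.smul_mem _ _ hω)) (by simp [h1])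
    rw [sub_eq_zero] at h
    rw [h]
    simp [h1, mul_comm]
  · simp [hJ k hk α hα, A.int_eq_zero k hk α hα]

namespace HodgeDecomposition

variable (D : A.HodgeDecomposition)

lemma splitting_mem (α : A.Cohomology) : D.splitting α ∈ D.harm := by
  obtain ⟨z, rfl⟩ := A.cls_surjective α
  exact D.harmProj_mem _

lemma dInv_eq_zero {x : A.toDGCA} (hx : x ∈ D.harm ⊔ D.compl) : D.dInv x = 0 := by
  have h : (LinearMap.range A.d).projectionOnto (D.harm ⊔ D.compl) D.isCompl_range x = 0 :=
    (Submodule.projectionOnto_apply_eq_zero_iff _).2 hx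
  simp [dInv, h]

lemma harmProj_harmProj (x : A.toDGCA) : D.harmProj (D.harmProj x) = D.harmProj x :=
  Submodule.projection_apply_of_mem_left _ (D.harmProj_mem x)

lemma splitting_harmClass (x : A.toDGCA) : D.splitting (D.harmClass x) = D.harmProj x :=
  D.harmProj_harmProj x

lemma splitting_harmClass_of_mem {x : A.toDGCA} (hx : x ∈ D.harm) :
    D.splitting (D.harmClass x) = x := by
  rw [splitting_harmClass]
  exact Submodule.projection_apply_of_mem_left _ hx

lemma harmClass_compl {x : A.toDGCA} (hx : x ∈ D.compl) : D.harmClass x = 0 := by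
  rw [← D.harmClass_splitting (D.harmClass x), splitting_harmClass, harmProj_compl D hx, map_zero]

lemma dInv_splitting (α : A.Cohomology) : D.dInv (D.splitting α) = 0 :=
  D.dInv_eq_zero (Submodule.mem_sup_left (D.splitting_mem α))

lemma dInv_d_of_mem {x : A.toDGCA} (hx : x ∈ D.compl) : D.dInv (A.d x) = x :=
  D.d_injOn (D.dInv_mem _) hx (D.d_dInv_d x)

/-- `d d⁻ + d⁻ d = 1 - ι π`. -/
lemma homotopy (x : A.toDGCA) :
    A.d (D.dInv x) + D.dInv (A.d x) = x - D.splitting (D.harmClass x) := by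
  obtain ⟨y, hy, z, hz, rfl⟩ := Submodule.mem_sup.1
    (show x ∈ (LinearMap.range A.d ⊔ D.harm) ⊔ D.compl by
      rw [D.isCompl.sup_eq_top]
      trivial)
  rw [D.range_sup_harm] at hy
  have hy' : A.d y = 0 := hy
  simp only [map_add, hy', map_zero, zero_add, D.dInv_d_of_mem hz, D.harmClass_compl hz,
    D.dInv_eq_zero (Submodule.mem_sup_right hz), splitting_harmClass, D.harmProj_of_closed hy']
  abel

/-- There is nothing in degree `-1`, so `d⁻ 1 = 0` and the unit is harmonic for every decomposition.
-/
lemma splitting_one : D.splitting 1 = 1 := by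
  have h := D.dInv_mem_deg (k := 0) (x := 1) SetLike.GradedOne.one_mem
  rw [A.deg_eq_bot (0 - 1) (Or.inl (by norm_num)), Submodule.mem_bot] at h
  rw [← map_one A.cls, splitting_cls, D.harmProj_of_closed (by simp [d_one])]
  simp [h]

lemma harmClass_one : D.harmClass 1 = 1 := by
  rw [← D.splitting_one, harmClass_splitting]

lemma dInv_parity (x : A.toDGCA) : D.dInv (A.parity x) = -A.parity (D.dInv x) := by
  refine linear_ext (f := D.dInv ∘ₗ A.parity) (g := -(A.parity ∘ₗ D.dInv)) ?_ x
  intro k x hx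
  simp only [LinearMap.comp_apply, LinearMap.neg_apply, parity_of_mem hx, map_smul,
    parity_of_mem (D.dInv_mem_deg hx)]
  rw [zpow_sub₀ (by simp)]
  simp [div_neg]

lemma harmClass_parity (x : A.toDGCA) : D.harmClass (A.parity x) = A.cohParity (D.harmClass x) := by
  refine linear_ext (f := D.harmClass ∘ₗ A.parity) (g := A.cohParity ∘ₗ D.harmClass) ?_ x
  intro k x hx
  simp only [LinearMap.comp_apply, parity_of_mem hx, map_smul,
    cohParity_of_mem (D.harmClass_mem_deg hx)]

lemma splitting_cohParity (α : A.Cohomology) :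
    D.splitting (A.cohParity α) = A.parity (D.splitting α) := by
  refine coh_linear_ext (f := D.splitting ∘ₗ A.cohParity) (g := A.parity ∘ₗ D.splitting) ?_ α
  intro k α hα
  simp only [LinearMap.comp_apply, cohParity_of_mem hα, map_smul,
    parity_of_mem (D.splitting_mem_deg hα)]

lemma harmClass_splitting_mul (α β : A.Cohomology) :
    D.harmClass (D.splitting α * D.splitting β) = α * β := by
  rw [D.harmClass_mul (D.d_splitting α) (D.d_splitting β), harmClass_splitting,
    harmClass_splitting]

/-- Orthogonality in a Hodge decomposition is a statement about the pairing on `A`, whereas the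
obstructions live in cohomology; this identity carries the one to the other. -/
lemma topInt_eq (x : A.toDGCA) : A.topInt x = A.int (D.harmClass x) := by
  refine linear_ext (f := A.topInt) (g := A.int ∘ₗ D.harmClass) ?_ x
  intro k x hx
  by_cases h : k = n
  · subst h
    have hc : A.d x = 0 := by
      have := A.proj_top_mem x
      rwa [proj_of_mem hx] at this
    have h1 := D.harmClass_of_closed ⟨x, hc⟩
    rw [LinearMap.comp_apply, h1]
    change A.int (A.cls _) = _
    congr 2
    exact Subtype.ext (proj_of_mem hx)
  · rw [LinearMap.comp_apply, A.int_eq_zero k h _ (D.harmClass_mem_deg hx)]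
    change A.int (A.cls _) = _
    rw [show (A.proj n).codRestrict (Subalgebra.toSubmodule A.cocycles) A.proj_top_mem x = 0 from
      Subtype.ext (proj_of_mem_ne hx h)]
    exact (congrArg A.int (map_zero A.cls)).trans (map_zero A.int)

lemma int_harmClass_mul {x y : A.toDGCA} (hx : x ∈ D.harm ⊔ D.compl) (hy : y ∈ D.compl) :
    A.int (D.harmClass (x * y)) = 0 := by
  rw [← topInt_eq]
  exact D.pairing_eq_zero x hx y hy

lemma sup_graded (k : ℤ) (x : A.toDGCA) (hx : x ∈ D.harm ⊔ D.compl) :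
    A.proj k x ∈ D.harm ⊔ D.compl := by
  obtain ⟨b, hb, c, hc, rfl⟩ := Submodule.mem_sup.1 hx
  rw [map_add]
  exact Submodule.add_mem_sup (D.harm_graded k b hb) (D.compl_graded k c hc)

/-- Graded commutativity of the homogeneous components exchanges the two factors, since `ℋ` and `ℬ`
are graded. -/
lemma int_harmClass_mul' {x y : A.toDGCA} (hx : x ∈ D.compl) (hy : y ∈ D.harm ⊔ D.compl) :
    A.int (D.harmClass (x * y)) = 0 := by
  obtain ⟨s, hs⟩ := exists_sum_proj x
  obtain ⟨t, ht⟩ := exists_sum_proj y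
  rw [← hs, ← ht, Finset.sum_mul_sum, map_sum, map_sum]
  refine Finset.sum_eq_zero fun k _ => ?_
  rw [map_sum, map_sum]
  refine Finset.sum_eq_zero fun l _ => ?_
  rw [A.graded_comm k l _ _ (proj_mem _ _) (proj_mem _ _), map_smul, map_smul,
    D.int_harmClass_mul (D.sup_graded l y hy) (D.compl_graded k x hx), smul_zero]

lemma parity_mem_compl {x : A.toDGCA} (hx : x ∈ D.compl) : A.parity x ∈ D.compl :=
  parity_mem_of_graded D.compl_graded hx

lemma parity_mem_harm {x : A.toDGCA} (hx : x ∈ D.harm) : A.parity x ∈ D.harm :=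
  parity_mem_of_graded D.harm_graded hx

end HodgeDecomposition

end PoincareDGCA

/-! ### Multilinear functions on lists, with insertions and cup products. -/

/-- A function on lists that is linear in each entry; its restriction to the lists of length `N` is
an `N`-linear map. -/
def IsMl (F : Type*) [Field F] {α M : Type*} [AddCommGroup α] [Module F α] [AddCommGroup M]
    [Module F M] (U : List α → M) : Prop :=
  ∀ l₁ l₂ : List α, IsLinearMap F (fun x => U (l₁ ++ x :: l₂))

namespace ListCochain

section Linear

variable {F : Type*} [Field F] {α β M M' : Type*} [AddCommGroup α] [Module F α] [AddCommGroup β]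
  [Module F β] [AddCommGroup M] [Module F M] [AddCommGroup M'] [Module F M']

/-- `ins u v (a₀, a₁, …) U = ∑ U (v a₀, …, v a_{r-1}, u a_r, a_{r+1}, …)`. -/
def ins (u v : α →ₗ[F] α) : List α → (List α → M) →ₗ[F] M
  | [] => 0
  | a :: l => LinearMap.proj (u a :: l) + ins u v l ∘ₗ LinearMap.funLeft F M (List.cons (v a))

/-- `(a, c :: l) ↦ U (w a c :: l)`. -/
def mulHead (w : α →ₗ[F] α →ₗ[F] α) (a : α) : List α → (List α → M) →ₗ[F] M
  | [] => 0
  | c :: l => LinearMap.proj (w a c :: l)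

/-- `mulIns w v (a₀, a₁, …) U = ∑ U (v a₀, …, v a_{r-1}, w a_r a_{r+1}, a_{r+2}, …)`. -/
def mulIns (w : α →ₗ[F] α →ₗ[F] α) (v : α →ₗ[F] α) : List α → (List α → M) →ₗ[F] M
  | [] => 0
  | a :: l => mulHead w a l + mulIns w v l ∘ₗ LinearMap.funLeft F M (List.cons (v a))

section
variable (u v : α →ₗ[F] α) (w : α →ₗ[F] α →ₗ[F] α) (U V : List α → M) (a c : α) (l : List α)

@[simp] lemma ins_nil : ins u v [] U = 0 := rfl

@[simp] lemma ins_cons :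
    ins u v (a :: l) U = U (u a :: l) + ins u v l (fun m => U (v a :: m)) := rfl

@[simp] lemma mulHead_nil : mulHead w a [] U = 0 := rfl

@[simp] lemma mulHead_cons : mulHead w a (c :: l) U = U (w a c :: l) := rfl

@[simp] lemma mulIns_nil : mulIns w v [] U = 0 := rfl

@[simp] lemma mulIns_cons :
    mulIns w v (a :: l) U = mulHead w a l U + mulIns w v l (fun m => U (v a :: m)) := rfl

lemma ins_fun_add (l : List α) :
    ins u v l (fun m => U m + V m) = ins u v l U + ins u v l V := map_add (ins u v l) U V

lemma mulIns_fun_add (l : List α) :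
    mulIns w v l (fun m => U m + V m) = mulIns w v l U + mulIns w v l V :=
  map_add (mulIns w v l) U V

lemma ins_fun_sub (l : List α) :
    ins u v l (fun m => U m - V m) = ins u v l U - ins u v l V := map_sub (ins u v l) U V

lemma mulIns_fun_sub (l : List α) :
    mulIns w v l (fun m => U m - V m) = mulIns w v l U - mulIns w v l V :=
  map_sub (mulIns w v l) U V

lemma ins_fun_neg (l : List α) : ins u v l (fun m => -U m) = -ins u v l U :=
  map_neg (ins u v l) U

lemma mulIns_fun_neg (l : List α) : mulIns w v l (fun m => -U m) = -mulIns w v l U :=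
  map_neg (mulIns w v l) U

lemma ins_fun_zero (l : List α) : ins u v l (fun _ => (0 : M)) = 0 := map_zero (ins u v l)

lemma mulIns_fun_zero (l : List α) : mulIns w v l (fun _ => (0 : M)) = 0 := map_zero (mulIns w v l)

lemma ins_comp (q : M →ₗ[F] M') (l : List α) (U : List α → M) :
    ins u v l (fun m => q (U m)) = q (ins u v l U) := by
  induction l generalizing U with
  | nil => simp
  | cons a l ih => simp only [ins_cons, map_add, ih (fun m => U (v a :: m))]

lemma mulIns_comp (q : M →ₗ[F] M') (l : List α) (U : List α → M) :
    mulIns w v l (fun m => q (U m)) = q (mulIns w v l U) := by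
  induction l generalizing U with
  | nil => simp
  | cons a l ih =>
    simp only [mulIns_cons, map_add, ih (fun m => U (v a :: m))]
    cases l <;> simp

lemma ins_eq_zero {l : List α} {U : List α → M} (h : ∀ m, m.length = l.length → U m = 0) :
    ins u v l U = 0 := by
  induction l generalizing U with
  | nil => simp
  | cons a l ih =>
    rw [ins_cons, h _ (by simp), ih (fun m hm => h _ (by simp [hm])), add_zero]

lemma mulIns_eq_zero {l : List α} {U : List α → M} (h : ∀ m, m.length + 1 = l.length → U m = 0) :
    mulIns w v l U = 0 := by
  induction l generalizing U with
  | nil => simp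
  | cons a l ih =>
    rw [mulIns_cons, ih (fun m hm => h _ (by simp [hm])), add_zero]
    cases l with
    | nil => simp
    | cons c l => exact h _ (by simp)

lemma mulIns_congr {l : List α} {U V : List α → M} (h : ∀ m, m.length + 1 = l.length → U m = V m) :
    mulIns w v l U = mulIns w v l V := by
  rw [← sub_eq_zero, ← map_sub]
  exact mulIns_eq_zero _ _ fun m hm => by simp [h m hm]

end

end Linear

section Cup

variable {α β R R' : Type*} [Ring R] [Ring R']

/-- The cup product `∑ U (a₀, …, a_{i-1}) V (a_i, …)`. -/
def cup (U V : List α → R) (l : List α) : R :=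
  ∑ i ∈ Finset.range (l.length + 1), U (l.take i) * V (l.drop i)

variable (U U' V V' W : List α → R) (a : α) (l : List α)

@[simp] lemma cup_nil : cup U V [] = U [] * V [] := by simp [cup]

@[simp] lemma cup_cons :
    cup U V (a :: l) = U [] * V (a :: l) + cup (fun m => U (a :: m)) V l := by
  rw [cup, List.length_cons, Finset.sum_range_succ', add_comm]
  simp [cup]

lemma cup_add_left (l : List α) : cup (fun m => U m + U' m) V l = cup U V l + cup U' V l := by
  simp [cup, add_mul, Finset.sum_add_distrib]

lemma cup_sub_left (l : List α) : cup (fun m => U m - U' m) V l = cup U V l - cup U' V l := by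
  simp [cup, sub_mul, Finset.sum_sub_distrib]

lemma cup_sub_right (l : List α) : cup U (fun m => V m - V' m) l = cup U V l - cup U V' l := by
  simp [cup, mul_sub, Finset.sum_sub_distrib]

lemma cup_neg_left (l : List α) : cup (fun m => -U m) V l = -cup U V l := by
  simp [cup]

lemma cup_const_mul_left (r : R) (l : List α) :
    cup (fun m => r * U m) V l = r * cup U V l := by
  simp [cup, mul_assoc, Finset.mul_sum]

lemma cup_assoc (l : List α) : cup (cup U V) W l = cup U (cup V W) l := by
  induction l generalizing U with
  | nil => simp [mul_assoc]
  | cons a l ih =>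
    simp only [cup_cons, cup_nil, cup_add_left, cup_const_mul_left, ih, mul_add, mul_assoc,
      add_assoc]

/-- Comparison of cup products term by term. -/
lemma cup_congr {G : Type*} [AddCommGroup G] {q : R →+ G} {q' : R' →+ G} {U V : List α → R}
    {U' V' : List β → R'} {l : List α} {l' : List β} (hl : l.length = l'.length)
    (h : ∀ i ≤ l.length, q (U (l.take i) * V (l.drop i)) = q' (U' (l'.take i) * V' (l'.drop i))) :
    q (cup U V l) = q' (cup U' V' l') := by
  rw [cup, cup, map_sum, map_sum, hl]
  exact Finset.sum_congr rfl fun i hi => h i (by rw [Finset.mem_range] at hi; omega)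

/-- The only term in which `U` sees the whole list is multiplied by `V []`. -/
lemma cup_eq_zero_left {U V : List α → R} {l : List α} (hV : V [] = 0)
    (hU : ∀ m, m.length < l.length → U m = 0) : cup U V l = 0 := by
  refine Finset.sum_eq_zero fun i hi => ?_
  rw [Finset.mem_range] at hi
  by_cases h : i < l.length
  · rw [hU _ (by simp [h]), zero_mul]
  · rw [List.drop_eq_nil_of_le (by omega), hV, mul_zero]

lemma cup_eq_zero_right {U V : List α → R} {l : List α} (hU : U [] = 0)
    (hV : ∀ m, m.length < l.length → V m = 0) : cup U V l = 0 := by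
  refine Finset.sum_eq_zero fun i hi => ?_
  rw [Finset.mem_range] at hi
  by_cases h : 0 < i
  · rw [hV _ (by simp; omega), mul_zero]
  · rw [show i = 0 by omega, List.take_zero, hU, zero_mul]

lemma cup_ringHom (q : R →+* R') (l : List α) :
    cup (fun m => q (U m)) (fun m => q (V m)) l = q (cup U V l) := by
  simp [cup]

end Cup

section Identities

variable {F : Type*} [Field F] {α M : Type*} [AddCommGroup α] [Module F α] [AddCommGroup M]
  [Module F M] {R : Type*} [Ring R] [Algebra F R]

/-- Coderivations act on cup products by the Leibniz rule. -/
lemma ins_cup (u v : α →ₗ[F] α) (U V : List α → R) (l : List α) :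
    ins u v l (cup U V) = cup (fun m => ins u v m U) V l
      + cup (fun m => U (m.map v)) (fun m => ins u v m V) l := by
  induction l generalizing U with
  | nil => simp
  | cons a l ih =>
    have h := ins_comp u v (LinearMap.mulLeft F (U [])) l (fun m => V (v a :: m))
    simp only [LinearMap.mulLeft_apply] at h
    simp only [ins_cons, cup_cons, ins_fun_add, h, ih, ins_nil, zero_mul, zero_add, cup_add_left,
      List.map_nil, List.map_cons, mul_add]
    abel

lemma mulIns_cup (w : α →ₗ[F] α →ₗ[F] α) (v : α →ₗ[F] α) (U V : List α → R) (l : List α) :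
    mulIns w v l (cup U V) = cup (fun m => mulIns w v m U) V l
      + cup (fun m => U (m.map v)) (fun m => mulIns w v m V) l := by
  induction l generalizing U with
  | nil => simp
  | cons a l ih =>
    have h := mulIns_comp v w (LinearMap.mulLeft F (U [])) l (fun m => V (v a :: m))
    simp only [LinearMap.mulLeft_apply] at h
    have h2 : mulHead w a l (cup U V) =
        U [] * mulHead w a l V + cup (fun m => mulHead w a m U) V l := by
      cases l <;> simp
    simp only [mulIns_cons, cup_cons, mulIns_fun_add, h, h2, ih, mulIns_nil, zero_mul, zero_add,
      cup_add_left, List.map_nil, List.map_cons, mul_add]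
    abel

end Identities

end ListCochain

namespace IsMl

open ListCochain

variable {F : Type*} [Field F] {α β M M' : Type*} [AddCommGroup α] [Module F α] [AddCommGroup β]
  [Module F β] [AddCommGroup M] [Module F M] [AddCommGroup M'] [Module F M']
  {U V : List α → M}

lemma tail (hU : IsMl F U) (a : α) : IsMl F (fun m => U (a :: m)) := fun l₁ l₂ => hU (a :: l₁) l₂

lemma head (hU : IsMl F U) (l : List α) : IsLinearMap F (fun x => U (x :: l)) := hU [] l

lemma cons_add (hU : IsMl F U) (x y : α) (l : List α) : U ((x + y) :: l) = U (x :: l) + U (y :: l) :=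
  (hU.head l).map_add x y

lemma cons_smul (hU : IsMl F U) (c : F) (x : α) (l : List α) : U ((c • x) :: l) = c • U (x :: l) :=
  (hU.head l).map_smul c x

lemma cons_neg (hU : IsMl F U) (x : α) (l : List α) : U ((-x) :: l) = -U (x :: l) :=
  (hU.head l).map_neg x

lemma cons_sub (hU : IsMl F U) (x y : α) (l : List α) : U ((x - y) :: l) = U (x :: l) - U (y :: l) :=
  (hU.head l).map_sub x y

lemma cons_zero (hU : IsMl F U) (l : List α) : U (0 :: l) = 0 :=
  (hU.head l).map_zero

lemma of_cons (h : ∀ l, IsLinearMap F (fun x => U (x :: l))) (h' : ∀ a, IsMl F (fun m => U (a :: m))) :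
    IsMl F U := by
  rintro (_ | ⟨a, l₁⟩) l₂
  · exact h l₂
  · exact h' a l₁ l₂

lemma add (hU : IsMl F U) (hV : IsMl F V) : IsMl F (fun l => U l + V l) := fun l₁ l₂ =>
  ⟨fun x y => by beta_reduce; rw [(hU l₁ l₂).map_add, (hV l₁ l₂).map_add]; abel,
    fun c x => by beta_reduce; rw [(hU l₁ l₂).map_smul, (hV l₁ l₂).map_smul, smul_add]⟩

lemma comp (hU : IsMl F U) (q : M →ₗ[F] M') : IsMl F (fun l => q (U l)) := fun l₁ l₂ =>
  ⟨fun x y => by beta_reduce; rw [(hU l₁ l₂).map_add, map_add],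
    fun c x => by beta_reduce; rw [(hU l₁ l₂).map_smul, map_smul]⟩

lemma neg (hU : IsMl F U) : IsMl F (fun l => -U l) := hU.comp (-LinearMap.id)

lemma sub (hU : IsMl F U) (hV : IsMl F V) : IsMl F (fun l => U l - V l) := by
  simpa only [sub_eq_add_neg] using hU.add hV.neg

lemma map (hU : IsMl F U) (q : β →ₗ[F] α) : IsMl F (fun l => U (l.map q)) := fun l₁ l₂ => by
  have h := hU (l₁.map q) (l₂.map q)
  refine ⟨fun x y => ?_, fun c x => ?_⟩
  · simpa using h.map_add (q x) (q y)
  · simpa using h.map_smul c (q x)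

lemma ins (hU : IsMl F U) (u v : α →ₗ[F] α) : IsMl F (fun l => ListCochain.ins u v l U) := by
  intro l₁
  induction l₁ generalizing U with
  | nil =>
    intro l₂
    refine ⟨fun x y => ?_, fun c x => ?_⟩
    · simp only [List.nil_append, ins_cons, map_add, hU.cons_add, ins_fun_add]
      abel
    · have h : ListCochain.ins u v l₂ (fun m => c • U (v x :: m)) =
          c • ListCochain.ins u v l₂ (fun m => U (v x :: m)) := map_smul (ListCochain.ins u v l₂) c _
      simp only [List.nil_append, ins_cons, map_smul, hU.cons_smul, h, smul_add]
  | cons a l₁ ih =>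
    intro l₂
    have h1 := hU (u a :: l₁) l₂
    have h2 := ih (hU.tail (v a)) l₂
    refine ⟨fun x y => ?_, fun c x => ?_⟩
    · have := h1.map_add x y
      have := h2.map_add x y
      simp_all only [List.cons_append, ins_cons]
      abel
    · have := h1.map_smul c x
      have := h2.map_smul c x
      simp_all only [List.cons_append, ins_cons, smul_add]

lemma mulIns (hU : IsMl F U) (w : α →ₗ[F] α →ₗ[F] α) (v : α →ₗ[F] α) :
    IsMl F (fun l => ListCochain.mulIns w v l U) := by
  intro l₁
  induction l₁ generalizing U with
  | nil =>
    intro l₂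
    refine ⟨fun x y => ?_, fun c x => ?_⟩
    · cases l₂ with
      | nil => simp
      | cons e l₂ =>
        simp only [List.nil_append, mulIns_cons, mulHead_cons, map_add, LinearMap.add_apply,
          hU.cons_add, mulIns_fun_add]
        abel
    · cases l₂ with
      | nil => simp
      | cons e l₂ =>
        have h : ListCochain.mulIns w v (e :: l₂) (fun m => c • U (v x :: m)) =
            c • ListCochain.mulIns w v (e :: l₂) (fun m => U (v x :: m)) :=
          map_smul (ListCochain.mulIns w v (e :: l₂)) c _
        beta_reduce
        rw [List.nil_append, mulIns_cons]
        simp only [mulHead_cons, map_smul, LinearMap.smul_apply, hU.cons_smul, h, List.nil_append,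
          mulIns_cons v w U x, smul_add]
  | cons a l₁ ih =>
    intro l₂
    have h1 : IsLinearMap F (fun x => mulHead w a (l₁ ++ x :: l₂) U) := by
      cases l₁ with
      | nil =>
        exact ⟨fun x y => by simp [hU.cons_add], fun c x => by simp [hU.cons_smul]⟩
      | cons b l₁ => exact hU (w a b :: l₁) l₂
    have h2 := ih (hU.tail (v a)) l₂
    refine ⟨fun x y => ?_, fun c x => ?_⟩
    · have := h1.map_add x y
      have := h2.map_add x y
      simp_all only [List.cons_append, mulIns_cons]
      abel
    · have := h1.map_smul c x
      have := h2.map_smul c x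
      simp_all only [List.cons_append, mulIns_cons, smul_add]

lemma cup {R : Type*} [Ring R] [Algebra F R] {U V : List α → R} (hU : IsMl F U) (hV : IsMl F V) :
    IsMl F (ListCochain.cup U V) := by
  intro l₁
  induction l₁ generalizing U with
  | nil =>
    intro l₂
    refine ⟨fun x y => ?_, fun c x => ?_⟩
    · simp only [List.nil_append, cup_cons, hU.cons_add, hV.cons_add, cup_add_left, mul_add]
      abel
    · rw [List.nil_append, cup_cons, List.nil_append, cup_cons, smul_add, hV.cons_smul, mul_smul_comm]
      simp only [hU.cons_smul, ListCochain.cup, smul_mul_assoc, Finset.smul_sum]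
  | cons a l₁ ih =>
    intro l₂
    have h1 := hV (a :: l₁) l₂
    have h2 := ih (hU.tail a) l₂
    refine ⟨fun x y => ?_, fun c x => ?_⟩
    · have := h1.map_add x y
      have := h2.map_add x y
      simp_all only [List.cons_append, cup_cons, mul_add]
      abel
    · have := h1.map_smul c x
      have := h2.map_smul c x
      simp_all only [List.cons_append, cup_cons, smul_add, mul_smul_comm]

/-- A multilinear function is determined by its values on lists with entries in a spanning set. -/
lemma eq_zero_of_span (hU : IsMl F U) (S : Set α) (h : ∀ l, (∀ x ∈ l, x ∈ S) → U l = 0) (l : List α)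
    (hl : ∀ x ∈ l, x ∈ Submodule.span F S) : U l = 0 := by
  induction l generalizing U with
  | nil => exact h [] (by simp)
  | cons a l ih =>
    have ha := hl a (by simp)
    have hl' : ∀ x ∈ l, x ∈ Submodule.span F S := fun x hx => hl x (by simp [hx])
    induction ha using Submodule.span_induction with
    | mem x hx =>
      refine ih (hU.tail x) (fun m hm => h _ ?_) hl'
      rintro y hy
      rcases List.mem_cons.1 hy with rfl | hy
      · exact hx
      · exact hm y hy
    | zero => exact hU.cons_zero l
    | add x y hx hy ihx ihy =>
      rw [hU.cons_add, ihx (by simpa using ⟨hx, hl'⟩), ihy (by simpa using ⟨hy, hl'⟩), add_zero]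
    | smul c x hx ihx => rw [hU.cons_smul, ihx (by simpa using ⟨hx, hl'⟩), smul_zero]

end IsMl

namespace ListCochain

section Relations

variable {F : Type*} [Field F] {α M : Type*} [AddCommGroup α] [Module F α] [AddCommGroup M]
  [Module F M] {U : List α → M}

/-- The tensor trick: `∑ (p t)^{⊗r} ⊗ h ⊗ 1` is a homotopy from `1` to `p^{⊗}`. -/
lemma ins_homotopy {d t h p : α →ₗ[F] α} (hh : ∀ x, d (h x) + h (d x) = x - p x)
    (hpd : ∀ x, p (t (d x)) = 0) (hdp : ∀ x, d (p (t x)) = 0) (hth : ∀ x, t (h x) = -h (t x))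
    (hptt : ∀ x, p (t (t x)) = p x) (htpt : ∀ x, t (p (t x)) = p x) (hU : IsMl F U) (l : List α) :
    ins d t l (fun m => ins h (p ∘ₗ t) m U) + ins h (p ∘ₗ t) l (fun m => ins d t m U)
      = U l - U (l.map p) := by
  induction l generalizing U with
  | nil => simp
  | cons a l ih =>
    have h1 := ih (hU.tail (p a))
    -- With both operators at the head this is the homotopy formula. The terms with `h` at the head
    -- and `d` further right cancel because `t` anticommutes with `h`, and those with `d` at the
    -- head and `h` further right vanish by `p t d = 0` and `d p t = 0`. What is left telescopes
    -- from `a` to `p a` to the tail.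
    have h2 : h (d a) = a - p a - d (h a) := by rw [← hh]; abel
    simp only [ins_cons, LinearMap.comp_apply, ins_fun_add, hpd, hdp, hth, hptt, htpt, h2,
      hU.cons_zero, hU.cons_sub, hU.cons_neg, ins_fun_neg, ins_fun_zero, List.map_cons] at h1 ⊢
    rw [← sub_eq_zero] at h1 ⊢
    refine Eq.trans ?_ h1
    abel

/-- This is the anticommutation of the coderivations given by the differential and by the suspended
product: neighbouring positions give the Leibniz rule, distant ones cancel by the signs of `t`. -/
lemma ins_mulIns {d t : α →ₗ[F] α} {w : α →ₗ[F] α →ₗ[F] α} (htt : ∀ x, t (t x) = x)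
    (htd : ∀ x, t (d x) = -d (t x)) (hw : ∀ x y, w (t x) (t y) = -t (w x y))
    (hd : ∀ x y, d (w x y) = -w (d x) y - w (t x) (d y)) (hU : IsMl F U) (l : List α) :
    ins d t l (fun m => mulIns w t m U) + mulIns w t l (fun m => ins d t m U) = 0 := by
  induction l generalizing U with
  | nil => simp
  | cons a l ih =>
    have h1 := ih (hU.tail a)
    have h2 : mulHead w (d a) l U + ins d t l (fun m => mulHead w (t a) m U)
        + mulHead w a l (fun m => ins d t m U) = 0 := by
      cases l with
      | nil => simp
      | cons c l =>
        simp only [mulHead_cons, ins_cons, hw, hd, hU.cons_neg, hU.cons_sub, ins_fun_neg]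
        abel
    simp only [ins_cons, mulIns_cons, ins_fun_add, mulIns_fun_add, htt, htd, hU.cons_neg,
      mulIns_fun_neg]
    refine Eq.trans ?_ ((congrArg₂ (· + ·) h1 h2).trans (add_zero 0))
    abel

/-- The coderivation given by the suspended product has square zero: overlapping products cancel by
associativity, disjoint ones by the signs of `t`. -/
lemma mulIns_mulIns {t : α →ₗ[F] α} {w : α →ₗ[F] α →ₗ[F] α} (htt : ∀ x, t (t x) = x)
    (hw : ∀ x y, w (t x) (t y) = -t (w x y)) (hww : ∀ x y z, w (w x y) z = -w (t x) (w y z))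
    (hU : IsMl F U) (l : List α) : mulIns w t l (fun m => mulIns w t m U) = 0 := by
  induction l generalizing U with
  | nil => simp
  | cons a l ih =>
    have h1 := ih (hU.tail a)
    have h2 : mulHead w a l (fun m => mulIns w t m U)
        + mulIns w t l (fun m => mulHead w (t a) m U) = 0 := by
      cases l with
      | nil => simp
      | cons c l =>
        cases l with
        | nil => simp
        | cons e l =>
          simp only [mulHead_cons, mulIns_cons, hw, hww, hU.cons_neg, mulIns_fun_neg]
          abel
    simp only [mulIns_cons, mulIns_fun_add, htt] at h2 ⊢
    rw [h1, add_zero, h2]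

end Relations

/-! ### Homogeneity with respect to the suspended grading. -/

section Degree

variable {F : Type*} [Field F] {α β M M' : Type*} [AddCommGroup α] [Module F α] [AddCommGroup β]
  [Module F β] [AddCommGroup M] [Module F M] [AddCommGroup M'] [Module F M']

/-- The function `U` maps lists of homogeneous elements of degrees `k₁, k₂, …` to homogeneous
elements of degree `e + ∑ (kᵢ - 1)`. -/
def HasDeg (𝒜 : ℤ → Submodule F α) (ℳ : ℤ → Submodule F M) (U : List α → M) (e : ℤ) : Prop :=
  ∀ (l : List α) (k : List ℤ), List.Forall₂ (fun a i => a ∈ 𝒜 i) l k →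
    U l ∈ ℳ (e + (k.map (fun i => i - 1)).sum)

variable {𝒜 : ℤ → Submodule F α} {ℬ : ℤ → Submodule F β} {ℳ : ℤ → Submodule F M}
  {𝒩 : ℤ → Submodule F M'} {U V : List α → M} {e e' : ℤ}

namespace HasDeg

lemma nil (hU : HasDeg 𝒜 ℳ U e) : U [] ∈ ℳ e := by
  simpa using hU [] [] .nil

lemma tail (hU : HasDeg 𝒜 ℳ U e) {a : α} {k : ℤ} (ha : a ∈ 𝒜 k) :
    HasDeg 𝒜 ℳ (fun m => U (a :: m)) (e + (k - 1)) := fun l ks h => by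
  simpa [add_assoc] using hU (a :: l) (k :: ks) (.cons ha h)

lemma add (hU : HasDeg 𝒜 ℳ U e) (hV : HasDeg 𝒜 ℳ V e) : HasDeg 𝒜 ℳ (fun l => U l + V l) e :=
  fun l ks h => add_mem (hU l ks h) (hV l ks h)

lemma sub (hU : HasDeg 𝒜 ℳ U e) (hV : HasDeg 𝒜 ℳ V e) : HasDeg 𝒜 ℳ (fun l => U l - V l) e :=
  fun l ks h => sub_mem (hU l ks h) (hV l ks h)

lemma comp (hU : HasDeg 𝒜 ℳ U e) {q : M → M'} {δ : ℤ} (hq : ∀ k, ∀ x ∈ ℳ k, q x ∈ 𝒩 (k + δ)) :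
    HasDeg 𝒜 𝒩 (fun l => q (U l)) (e + δ) := fun l ks h => by
  have := hq _ _ (hU l ks h)
  rwa [add_right_comm] at this

lemma map (hU : HasDeg 𝒜 ℳ U e) {q : β → α} (hq : ∀ k, ∀ x ∈ ℬ k, q x ∈ 𝒜 k) :
    HasDeg ℬ ℳ (fun l => U (l.map q)) e := fun l ks h => by
  refine hU _ ks ?_
  rw [List.forall₂_map_left_iff]
  exact h.imp fun a k => hq k a

lemma ins (hU : HasDeg 𝒜 ℳ U e) {u v : α →ₗ[F] α} {δ : ℤ} (hu : ∀ k, ∀ x ∈ 𝒜 k, u x ∈ 𝒜 (k + δ))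
    (hv : ∀ k, ∀ x ∈ 𝒜 k, v x ∈ 𝒜 k) : HasDeg 𝒜 ℳ (fun l => ins u v l U) (e + δ) := by
  intro l ks h
  induction h generalizing U e with
  | nil => simp
  | @cons a k l ks ha h ih =>
    beta_reduce
    rw [ins_cons]
    refine add_mem ?_ ?_
    · have := hU _ _ (.cons (hu k a ha) h)
      simp only [List.map_cons, List.sum_cons] at this ⊢
      rwa [show e + δ + (k - 1 + (ks.map fun i => i - 1).sum) =
        e + (k + δ - 1 + (ks.map fun i => i - 1).sum) by ring]
    · have := ih (hU.tail (hv k a ha))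
      simp only [List.map_cons, List.sum_cons] at this ⊢
      rwa [show e + δ + (k - 1 + (ks.map fun i => i - 1).sum) =
        e + (k - 1) + δ + (ks.map fun i => i - 1).sum by ring]

lemma mulIns (hU : HasDeg 𝒜 ℳ U e) {w : α →ₗ[F] α →ₗ[F] α} {v : α →ₗ[F] α} {δ : ℤ}
    (hw : ∀ k l, ∀ x ∈ 𝒜 k, ∀ y ∈ 𝒜 l, w x y ∈ 𝒜 (k + l + δ))
    (hv : ∀ k, ∀ x ∈ 𝒜 k, v x ∈ 𝒜 k) : HasDeg 𝒜 ℳ (fun l => mulIns w v l U) (e + (1 + δ)) := by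
  intro l ks h
  induction h generalizing U e with
  | nil => simp
  | @cons a k l ks ha h ih =>
    beta_reduce
    rw [mulIns_cons]
    refine add_mem ?_ ?_
    · cases h with
      | nil => simp
      | @cons c j l ks hc h =>
        have := hU _ _ (.cons (hw k j a ha c hc) h)
        simp only [List.map_cons, List.sum_cons, mulHead_cons] at this ⊢
        rwa [show e + (1 + δ) + (k - 1 + (j - 1 + (ks.map fun i => i - 1).sum)) =
          e + (k + j + δ - 1 + (ks.map fun i => i - 1).sum) by ring]
    · have := ih (hU.tail (hv k a ha))
      simp only [List.map_cons, List.sum_cons] at this ⊢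
      rwa [show e + (1 + δ) + (k - 1 + (ks.map fun i => i - 1).sum) =
        e + (k - 1) + (1 + δ) + (ks.map fun i => i - 1).sum by ring]

lemma cup {R : Type*} [Ring R] [Algebra F R] {ℛ : ℤ → Submodule F R}
    (hR : ∀ k l, ∀ x ∈ ℛ k, ∀ y ∈ ℛ l, x * y ∈ ℛ (k + l)) {U V : List α → R}
    (hU : HasDeg 𝒜 ℛ U e) (hV : HasDeg 𝒜 ℛ V e') : HasDeg 𝒜 ℛ (cup U V) (e + e') := by
  intro l ks h
  induction h generalizing U e with
  | nil => simpa using hR _ _ _ hU.nil _ hV.nil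
  | @cons a k l ks ha h ih =>
    rw [cup_cons]
    refine add_mem ?_ ?_
    · have := hR _ _ _ hU.nil _ (hV _ _ (.cons ha h))
      rwa [← add_assoc] at this
    · have := ih (hU.tail ha)
      simp only [List.map_cons, List.sum_cons] at this ⊢
      rwa [show e + e' + (k - 1 + (ks.map fun i => i - 1).sum) =
        e + (k - 1) + e' + (ks.map fun i => i - 1).sum by ring]

end HasDeg

/-- A homogeneous multilinear function commutes with the grading involutions, up to sign. -/
lemma HasDeg.map_involution {t : α →ₗ[F] α} {τ : M →ₗ[F] M}
    (ht : ∀ k, ∀ x ∈ 𝒜 k, t x = -(((-1 : F) ^ k) • x))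
    (hτ : ∀ k, ∀ x ∈ ℳ k, τ x = ((-1 : F) ^ k) • x)
    (hspan : ∀ x, x ∈ Submodule.span F {x | ∃ k, x ∈ 𝒜 k})
    (hM : IsMl F U) (hU : HasDeg 𝒜 ℳ U e) (l : List α) :
    U (l.map t) = ((-1 : F) ^ e) • τ (U l) := by
  induction l generalizing U e with
  | nil =>
    rw [List.map_nil, hτ _ _ hU.nil, smul_smul, ← mul_zpow]
    simp
  | cons a l ih =>
    rw [List.map_cons]
    induction hspan a using Submodule.span_induction with
    | mem x hx =>
      obtain ⟨k, hx⟩ := hx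
      rw [ht k x hx, hM.cons_neg, hM.cons_smul, ih (hM.tail x) (hU.tail hx), smul_smul, ← neg_smul]
      congr 1
      rw [zpow_add₀ (by simp), zpow_sub₀ (by simp), zpow_one, div_neg, div_one, mul_neg, mul_neg,
        neg_neg, mul_left_comm, ← mul_zpow]
      simp
    | zero => rw [map_zero, hM.cons_zero, hM.cons_zero, map_zero, smul_zero]
    | add x y _ _ hx hy => rw [map_add, hM.cons_add, hM.cons_add, map_add, smul_add, hx, hy]
    | smul c x _ hx => rw [map_smul, hM.cons_smul, hM.cons_smul, map_smul, hx, smul_comm]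

end Degree

end ListCochain

open ListCochain DGCA

/-! ### The unit, and the suspension of a DGCA. -/

namespace ListCochain

section Unit

variable {F : Type*} [Field F] {α M : Type*} [AddCommGroup α] [Module F α] [AddCommGroup M]
  [Module F M]

lemma ins_map_eq_zero {β : Type*} [AddCommGroup β] [Module F β] {V : List β → M} (hV : IsMl F V)
    {u v : α →ₗ[F] α} {q : α →ₗ[F] β} (h : ∀ x, q (u x) = 0) (l : List α) :
    ins u v l (fun m => V (m.map q)) = 0 := by
  induction l generalizing V with
  | nil => simp
  | cons a l ih => simp [h, hV.cons_zero, ih (hV.tail _)]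

lemma ins_eq_zero_of_mem {U : List α → M} (hU : IsMl F U) {u v : α →ₗ[F] α} {e : α} {c : F}
    (hu : u e = 0) (hv : v e = c • e) (h : ∀ m, e ∈ m → U m = 0) {l : List α} (hl : e ∈ l) :
    ins u v l U = 0 := by
  induction l generalizing U with
  | nil => simp at hl
  | cons a l ih =>
    by_cases hel : e ∈ l
    · rw [ins_cons, h _ (by simp [hel]), ih (hU.tail _) (fun m hm => h _ (by simp [hm])) hel, add_zero]
    · obtain rfl : e = a := by simpa [hel] using hl
      have h0 : (fun m => U (v e :: m)) = fun _ => 0 := by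
        ext m
        rw [hv, hU.cons_smul, h _ (by simp), smul_zero]
      rw [ins_cons, hu, hU.cons_zero, h0, ins_fun_zero, add_zero]

/-- A normalized function vanishes on all lists containing the unit except in arity one; removing
that arity leaves a multilinear function that vanishes on all of them. -/
lemma isMl_of_length {U : List α → M} (hU : IsMl F U) :
    IsMl F (fun l => if l.length = 1 then 0 else U l) := by
  intro l₁ l₂
  by_cases h : (l₁ ++ 0 :: l₂).length = 1
  · have h' : ∀ x, (l₁ ++ x :: l₂).length = 1 := fun x => by simpa using h
    refine ⟨fun x y => ?_, fun c x => ?_⟩ <;> simp only [h', if_true] <;> simp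
  · have h' : ∀ x, ¬ (l₁ ++ x :: l₂).length = 1 := fun x => by simpa using h
    simp only [h', if_false]
    exact hU l₁ l₂

end Unit

end ListCochain

namespace DGCA

variable {F : Type*} [Field F] (A : DGCA F)

/-- The grading involution of the suspension of `A`. -/
noncomputable def twist : A →ₗ[F] A := -A.parity

/-- The product of the suspension of `A`. -/
noncomputable def barMul : A →ₗ[F] A →ₗ[F] A := LinearMap.mul F A ∘ₗ A.parity

variable {A}

@[simp] lemma twist_apply (x : A) : A.twist x = -A.parity x := rfl

@[simp] lemma barMul_apply (x y : A) : A.barMul x y = A.parity x * y := rfl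

lemma twist_twist (x : A) : A.twist (A.twist x) = x := by simp [parity_parity]

lemma twist_d (x : A) : A.twist (A.d x) = -A.d (A.twist x) := by simp [parity_d]

lemma barMul_twist (x y : A) : A.barMul (A.twist x) (A.twist y) = -A.twist (A.barMul x y) := by
  simp [parity_parity, parity_mul]

lemma d_barMul (x y : A) :
    A.d (A.barMul x y) = -A.barMul (A.d x) y - A.barMul (A.twist x) (A.d y) := by
  simp [d_mul, parity_parity, parity_d]

lemma barMul_assoc (x y z : A) :
    A.barMul (A.barMul x y) z = -A.barMul (A.twist x) (A.barMul y z) := by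
  simp [parity_parity, parity_mul, mul_assoc]

lemma twist_mem_deg {k : ℤ} {x : A} (hx : x ∈ A.deg k) : A.twist x ∈ A.deg k :=
  neg_mem (parity_mem_deg hx)

lemma barMul_mem_deg (k l : ℤ) (x : A) (hx : x ∈ A.deg k) (y : A) (hy : y ∈ A.deg l) :
    A.barMul x y ∈ A.deg (k + l + 0) := by
  rw [add_zero]
  exact SetLike.mul_mem_graded (parity_mem_deg hx) hy

lemma mem_span_deg (x : A) : x ∈ Submodule.span F {x : A | ∃ k, x ∈ A.deg k} :=
  hom_induction (P := fun x => x ∈ Submodule.span F {x : A | ∃ k, x ∈ A.deg k}) (zero_mem _)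
    (fun k _ hx => Submodule.subset_span ⟨k, hx⟩) (fun _ _ => add_mem) x

end DGCA

/-! ### The quadratic part of the equation and the Bianchi identity. -/

section Quad

variable {F : Type*} [Field F] {A B : DGCA F}

/-- The quadratic part of the equation of `A_∞`-morphisms. -/
noncomputable def quad (U : List A → B) (l : List A) : B :=
  mulIns A.barMul A.twist l U - cup (fun m => B.parity (U m)) U l

/-- Multilinear functions of degree zero on the bar construction, normalized with respect to the
unit. -/
structure IsNormalized (U : List A → B) : Prop where
  ml : IsMl F U
  deg : HasDeg A.deg B.deg U 1
  nil : U [] = 0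
  one : U [1] = 1
  unit : ∀ l : List A, 2 ≤ l.length → 1 ∈ l → U l = 0

@[simp] lemma quad_nil {U : List A → B} (h : U [] = 0) : quad U [] = 0 := by
  simp [quad, h]

lemma quad_single {U : List A → B} (h : U [] = 0) (a : A) : quad U [a] = 0 := by
  simp [quad, h]

lemma quad_pair {U : List A → B} (h : U [] = 0) (a b : A) :
    quad U [a, b] = U [A.parity a * b] - B.parity (U [a]) * U [b] := by
  simp [quad, h]

lemma quad_triple {U : List A → B} (h : U [] = 0) (hU : IsMl F U) (a b c : A) :
    quad U [a, b, c] = U [A.parity a * b, c] - U [A.parity a, A.parity b * c]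
      - B.parity (U [a]) * U [b, c] - B.parity (U [a, b]) * U [c] := by
  simp [quad, h, hU.cons_neg]
  abel

/-- Products shorten the list, and in the cup product a factor that sees the whole list meets the
value of the other one on `[]`, which is zero. This strict dependence on shorter lists makes the
iteration below stabilize. -/
lemma quad_congr {U V : List A → B} (hU : U [] = 0) (hV : V [] = 0) {l : List A}
    (h : ∀ m, m.length < l.length → U m = V m) : quad U l = quad V l := by
  rw [quad, quad, mulIns_congr _ _ fun m hm => h m (by omega)]
  congr 1
  rw [← sub_eq_zero]
  have e : cup (fun m => B.parity (U m)) U l - cup (fun m => B.parity (V m)) V l =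
      cup (fun m => B.parity (U m) - B.parity (V m)) U l
        + cup (fun m => B.parity (V m)) (fun m => U m - V m) l := by
    rw [cup_sub_left, cup_sub_right]
    abel
  rw [e, cup_eq_zero_left hU (fun m hm => by rw [h m hm, sub_self]),
    cup_eq_zero_right (by simp [hV]) (fun m hm => by rw [h m hm, sub_self]), add_zero]

lemma IsMl.quad {U : List A → B} (hU : IsMl F U) : IsMl F (quad U) :=
  (hU.mulIns _ _).sub ((hU.comp B.parity).cup hU)

lemma ListCochain.HasDeg.quad {U : List A → B} (hU : HasDeg A.deg B.deg U 1) :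
    HasDeg A.deg B.deg (quad U) 2 := by
  have h1 := hU.mulIns (barMul_mem_deg (A := A)) (v := A.twist) (fun k x hx => twist_mem_deg hx)
  have h2 := hU.comp (q := B.parity) (𝒩 := B.deg) (δ := 0)
    (fun k x hx => by rw [add_zero]; exact parity_mem_deg hx)
  rw [add_zero] at h2
  exact h1.sub (h2.cup (fun k l x hx y hy => SetLike.mul_mem_graded hx hy) hU)

/-- A multilinear function of degree zero on the bar construction commutes with the grading
involutions. -/
lemma map_twist {U : List A → B} (hM : IsMl F U) (hU : HasDeg A.deg B.deg U 1) (l : List A) :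
    U (l.map A.twist) = -B.parity (U l) := by
  rw [hU.map_involution (τ := B.parity) (fun k x hx => by rw [twist_apply, parity_of_mem hx])
    (fun k x hx => parity_of_mem hx) mem_span_deg hM]
  simp

lemma mulIns_one_cons {U : List A → B} (hM : IsMl F U) (hU : ∀ m, (1 : A) ∈ m → U m = 0)
    {l : List A} (hl : l ≠ []) : mulIns A.barMul A.twist (1 :: l) U = U l := by
  obtain ⟨c, l, rfl⟩ := List.exists_cons_of_ne_nil hl
  have h0 : (fun m => U (A.twist 1 :: m)) = fun _ => 0 := by
    ext m
    rw [twist_apply, parity_one, hM.cons_neg, hU _ (by simp), neg_zero]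
  rw [mulIns_cons, h0, mulIns_fun_zero, mulHead_cons, barMul_apply, parity_one, one_mul, add_zero]

/-- Multiplying the unit into its left or its right neighbour gives the same list with opposite
signs; all other products leave the unit in the list. -/
lemma mulIns_one_middle {U : List A → B} (hM : IsMl F U) (hU : ∀ m, (1 : A) ∈ m → U m = 0)
    {l₁ l₂ : List A} (h1 : l₁ ≠ []) (h2 : l₂ ≠ []) :
    mulIns A.barMul A.twist (l₁ ++ 1 :: l₂) U = 0 := by
  induction l₁ generalizing U with
  | nil => exact absurd rfl h1
  | cons a l₁ ih =>
    have hU' : ∀ m, (1 : A) ∈ m → U (A.twist a :: m) = 0 := fun m hm => hU _ (by simp [hm])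
    cases l₁ with
    | nil =>
      rw [List.cons_append, List.nil_append, mulIns_cons, mulIns_one_cons (hM.tail _) hU' h2]
      simp [hM.cons_neg]
    | cons b l₁ =>
      rw [List.cons_append, mulIns_cons, ih (hM.tail _) hU' (by simp), List.cons_append,
        mulHead_cons, hU _ (by simp), add_zero]

/-- Only the product of the last entry before the unit with the unit survives. The entries to its
left are twisted by the coderivation, and `barMul a 1 = -twist a` supplies the overall sign. -/
lemma mulIns_one_last {U : List A → B} (hM : IsMl F U) (hU : ∀ m, (1 : A) ∈ m → U m = 0)
    {l : List A} (h1 : l ≠ []) :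
    mulIns A.barMul A.twist (l ++ [1]) U = -U (l.map A.twist) := by
  induction l generalizing U with
  | nil => exact absurd rfl h1
  | cons a l ih =>
    have hU' : ∀ m, (1 : A) ∈ m → U (A.twist a :: m) = 0 := fun m hm => hU _ (by simp [hm])
    cases l with
    | nil => simp [hM.cons_neg]
    | cons b l =>
      rw [List.cons_append, mulIns_cons, ih (hM.tail _) hU' (by simp), List.cons_append,
        mulHead_cons, hU _ (by simp), zero_add]
      simp only [List.map_cons]

/-- With the unit at one end, the product term and the one cup product term containing `U [1] = 1`
cancel; with the unit in the interior, both parts vanish separately. -/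
lemma IsNormalized.quad_unit {U : List A → B} (hU : IsNormalized U) {l : List A} (hl : 1 ∈ l) :
    quad U l = 0 := by
  obtain ⟨l₁, l₂, rfl⟩ := List.append_of_mem hl
  -- Since `U [1] = 1`, the lemmas on `mulIns` do not apply to `U` itself. On lists of length at
  -- least 3 the product term only involves `U` in arity at least 2, where `V` agrees with it.
  set V : List A → B := fun l => if l.length = 1 then 0 else U l with hV
  have hVM : IsMl F V := isMl_of_length hU.ml
  have hV1 : ∀ m, (1 : A) ∈ m → V m = 0 := by
    intro m hm
    simp only [hV]
    split_ifs with h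
    · rfl
    · refine hU.unit m ?_ hm
      have := List.length_pos_of_mem hm
      omega
  have hUV : ∀ m, 2 ≤ m.length → V m = U m := fun m hm => by
    simp only [hV]
    rw [if_neg (by omega)]
  have hlong : 3 ≤ (l₁ ++ (1 : A) :: l₂).length →
      mulIns A.barMul A.twist (l₁ ++ 1 :: l₂) U = mulIns A.barMul A.twist (l₁ ++ 1 :: l₂) V :=
    fun h => mulIns_congr _ _ fun m hm => (hUV m (by omega)).symm
  have htw := map_twist hU.ml hU.deg
  rcases eq_or_ne l₁ [] with rfl | h1
  · rcases eq_or_ne l₂ [] with rfl | h2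
    · exact quad_single hU.nil 1
    · obtain ⟨c, l, rfl⟩ := List.exists_cons_of_ne_nil h2
      rcases eq_or_ne l [] with rfl | h3
      · rw [List.nil_append, quad_pair hU.nil, hU.one, parity_one, parity_one, one_mul, one_mul,
          sub_self]
      · have h4 := List.length_pos_iff.2 h3
        rw [quad, hlong (by simp; omega), List.nil_append, mulIns_one_cons hVM hV1 h2,
          hUV _ (by simp; omega), sub_eq_zero, cup, Finset.sum_eq_single 1]
        · simp [hU.one, parity_one]
        · intro i hi h
          rcases Nat.lt_or_ge i 1 with h' | h'
          · obtain rfl : i = 0 := by omega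
            simp [hU.nil]
          · rw [hU.unit (List.take i _), map_zero, zero_mul]
            · rw [Finset.mem_range] at hi
              rw [List.length_take]
              simp only [List.length_cons] at hi ⊢
              omega
            · obtain ⟨j, rfl⟩ := Nat.exists_eq_add_of_le' h'
              simp
        · intro h
          simp at h
  · have h1' := List.length_pos_iff.2 h1
    rcases eq_or_ne l₂ [] with rfl | h2
    · rcases Nat.lt_or_ge l₁.length 2 with h3 | h3
      · obtain ⟨a, rfl⟩ := List.length_eq_one_iff.1 (show l₁.length = 1 by omega)
        have := htw [a]
        simp only [List.map_cons, List.map_nil, twist_apply, hU.ml.cons_neg, neg_inj] at this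
        rw [List.singleton_append, quad_pair hU.nil, hU.one, mul_one, mul_one, this, sub_self]
      · rw [quad, hlong (by simp; omega), mulIns_one_last hVM hV1 h1, hUV _ (by simpa using h3), htw,
          neg_neg, sub_eq_zero, cup, Finset.sum_eq_single l₁.length]
        · simp [hU.one]
        · intro i hi h
          rw [Finset.mem_range, List.length_append, List.length_singleton] at hi
          rcases Nat.lt_or_ge i l₁.length with h' | h'
          · rw [hU.unit (List.drop i _), mul_zero]
            · simp
              omega
            · rw [List.drop_append_of_le_length h'.le]
              simp
          · rw [List.drop_eq_nil_of_le (by simp; omega), hU.nil, mul_zero]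
        · intro h
          simp at h
    · have h2' := List.length_pos_iff.2 h2
      rw [quad, hlong (by simp; omega), mulIns_one_middle hVM hV1 h1 h2, zero_sub, neg_eq_zero]
      refine Finset.sum_eq_zero fun i hi => ?_
      rw [Finset.mem_range] at hi
      beta_reduce
      rcases Nat.lt_or_ge l₁.length i with h' | h'
      · rw [hU.unit (List.take i _), map_zero, zero_mul]
        · rw [List.length_take]
          simp only [List.length_append, List.length_cons] at hi ⊢
          omega
        · rw [List.take_append, List.mem_append]
          right
          obtain ⟨j, hj⟩ := Nat.exists_eq_add_of_lt h'
          rw [show i - l₁.length = j + 1 by omega]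
          simp
      · rw [hU.unit (List.drop i _), mul_zero]
        · simp
          omega
        · rw [List.drop_append_of_le_length h']
          simp

/-- The Bianchi identity. -/
lemma d_quad {U : List A → B} (hM : IsMl F U) (hU : HasDeg A.deg B.deg U 1) (l : List A) :
    B.d (quad U l) + ins A.d A.twist l (quad U) =
      mulIns A.barMul A.twist l (fun m => B.d (U m) - ins A.d A.twist m U - quad U m)
      + cup (fun m => B.parity (B.d (U m) - ins A.d A.twist m U - quad U m)) U l
      - cup U (fun m => B.d (U m) - ins A.d A.twist m U - quad U m) l := by
  have htw := map_twist hM hU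
  have e1 : B.d (cup (fun m => B.parity (U m)) U l) =
      cup (fun m => B.d (B.parity (U m))) U l + cup U (fun m => B.d (U m)) l := by
    simp only [cup, map_sum, d_mul, parity_parity, Finset.sum_add_distrib]
  have e2 := ins_cup A.d A.twist (fun m => B.parity (U m)) U l
  have e3 := mulIns_cup A.barMul A.twist (fun m => B.parity (U m)) U l
  -- The terms not involving the equation cancel for structural reasons: `e4` is the Leibniz rule
  -- and `e5` associativity in the source, while `e7` identifies the two cubic cup terms.
  have e4 := ins_mulIns (twist_twist (A := A)) twist_d barMul_twist d_barMul hM l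
  have e5 := mulIns_mulIns (twist_twist (A := A)) barMul_twist barMul_assoc hM l
  have e6 := mulIns_comp A.twist A.barMul B.d l U
  have e7 : cup (fun m => B.parity (cup (fun m => B.parity (U m)) U m)) U l =
      cup U (cup (fun m => B.parity (U m)) U) l := by
    rw [← cup_assoc]
    congr 1
    ext m
    simp only [cup, map_sum, parity_mul, parity_parity]
  simp only [htw, map_neg, parity_parity, ins_comp, mulIns_comp] at e2 e3
  have q : quad U = fun l => mulIns A.barMul A.twist l U - cup (fun m => B.parity (U m)) U l := rfl
  simp only [q, map_sub, ins_fun_sub, mulIns_fun_sub, e1, cup_sub_left, cup_sub_right, e5, e6, e7,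
    d_parity, cup_neg_left]
  rw [e2, e3, eq_neg_of_add_eq_zero_left e4]
  simp only [cup_neg_left]
  abel

end Quad

/-! ### The fixed point with prescribed harmonic part. -/

namespace PoincareDGCA.HodgeDecomposition

variable {F : Type*} [Field F] {n n' : ℕ} {A : PoincareDGCA F n} {B : PoincareDGCA F n'}
  (D : A.HodgeDecomposition) (D' : B.HodgeDecomposition)

/-- The projection `ι π` onto the harmonic subspace. -/
noncomputable def harmEnd : A.toDGCA →ₗ[F] A.toDGCA := D.splitting ∘ₗ D.harmClass

@[simp] lemma harmEnd_apply (x : A.toDGCA) : D.harmEnd x = D.splitting (D.harmClass x) := rfl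

/-- The homotopy `∑ (ιπ)^{⊗ r} ⊗ d⁻ ⊗ 1` on the bar construction, acting on functions. -/
noncomputable def trick {M : Type*} [AddCommGroup M] [Module F M] (l : List A.toDGCA) :
    (List A.toDGCA → M) →ₗ[F] M :=
  ins D.dInv (D.harmEnd ∘ₗ A.twist) l

lemma trick_homotopy {M : Type*} [AddCommGroup M] [Module F M] {U : List A.toDGCA → M}
    (hU : IsMl F U) (l : List A.toDGCA) :
    ins A.d A.twist l (fun m => D.trick m U) + D.trick l (fun m => ins A.d A.twist m U)
      = U l - U (l.map D.harmEnd) :=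
  ins_homotopy D.homotopy (fun x => by simp [parity_d, harmClass_d])
    (fun x => by simp [d_splitting]) (fun x => by simp [dInv_parity])
    (fun x => by simp [parity_parity])
    (fun x => by simp [parity_parity, harmClass_parity, splitting_cohParity]) hU l

/-- The data that determine an `A_∞`-morphism: a normalized multilinear function `σ` on the
cohomology. -/
structure IsModel (σ : List A.Cohomology → B.Cohomology) : Prop where
  ml : IsMl F σ
  deg : HasDeg A.cohDeg B.cohDeg σ 1
  nil : σ [] = 0
  one : σ [1] = 1
  unit : ∀ l : List A.Cohomology, 2 ≤ l.length → 1 ∈ l → σ l = 0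

variable (σ : List A.Cohomology → B.Cohomology)

/-- The iteration step in the construction of the `A_∞`-morphism with harmonic part `σ`. -/
noncomputable def step (U : List A.toDGCA → B.toDGCA) (l : List A.toDGCA) : B.toDGCA :=
  D'.splitting (σ (l.map D.harmClass)) + D'.dInv (quad U l)
    - D'.splitting (D'.harmClass (D.trick l (quad U)))

variable {σ}

lemma step_nil {U : List A.toDGCA → B.toDGCA} (hσ : σ [] = 0) (hU : U [] = 0) :
    step D D' σ U [] = 0 := by
  simp [step, hσ, hU, trick]

lemma step_single {U : List A.toDGCA → B.toDGCA} (hU : U [] = 0) (a : A.toDGCA) :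
    step D D' σ U [a] = D'.splitting (σ [D.harmClass a]) := by
  simp [step, hU, trick, quad_single]

/-- The homotopy `trick` preserves the length and `quad` only sees shorter lists, so each step fixes
the values in one more arity. -/
lemma step_congr {U V : List A.toDGCA → B.toDGCA} (hU : U [] = 0) (hV : V [] = 0)
    {l : List A.toDGCA} (h : ∀ m, m.length < l.length → U m = V m) :
    step D D' σ U l = step D D' σ V l := by
  rw [step, step, quad_congr hU hV h]
  congr 3
  rw [← sub_eq_zero, ← map_sub]
  refine ins_eq_zero _ _ fun m hm => ?_
  rw [Pi.sub_apply, quad_congr hU hV (fun m' hm' => h m' (by omega)), sub_self]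

lemma harmEnd_twist_one : (D.harmEnd ∘ₗ A.twist) 1 = (-1 : F) • (1 : A.toDGCA) := by
  simp [parity_one, harmClass_one, splitting_one]

lemma dInv_one : D.dInv 1 = 0 := by
  rw [← D.splitting_one, dInv_splitting]

lemma hasDeg_trick {M : Type*} [AddCommGroup M] [Module F M] {ℳ : ℤ → Submodule F M}
    {U : List A.toDGCA → M} {e : ℤ} (hU : HasDeg A.deg ℳ U e) :
    HasDeg A.deg ℳ (fun l => D.trick l U) (e + -1) :=
  hU.ins (fun _ _ hx => D.dInv_mem_deg hx)
    (fun _ _ hx => D.splitting_mem_deg (D.harmClass_mem_deg (twist_mem_deg hx)))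

lemma isNormalized_base (hσ : IsModel σ) :
    IsNormalized (A := A.toDGCA) (B := B.toDGCA)
      (fun l => D'.splitting (σ (l.map D.harmClass))) where
  ml := (hσ.ml.map _).comp _
  deg := by
    have := (hσ.deg.map (ℬ := A.deg) (q := D.harmClass) (fun k x hx => D.harmClass_mem_deg hx)).comp
      (q := D'.splitting) (𝒩 := B.deg) (δ := 0)
      (fun k x hx => by rw [add_zero]; exact D'.splitting_mem_deg hx)
    simpa using this
  nil := by simp [hσ.nil]
  one := by simp [harmClass_one, hσ.one, splitting_one]
  unit l h1 h2 := by
    rw [hσ.unit _ (by simpa using h1), map_zero]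
    rw [← D.harmClass_one]
    exact List.mem_map_of_mem h2

lemma isNormalized_step (hσ : IsModel σ) {U : List A.toDGCA → B.toDGCA} (hU : IsNormalized U) :
    IsNormalized (A := A.toDGCA) (B := B.toDGCA) (step D D' σ U) where
  ml := ((isNormalized_base D D' hσ).ml.add (hU.ml.quad.comp D'.dInv)).sub
    ((hU.ml.quad.ins _ _).comp (D'.splitting ∘ₗ D'.harmClass))
  deg := by
    have h1 := hU.deg.quad.comp (q := D'.dInv) (𝒩 := B.deg) (δ := -1)
      (fun k x hx => D'.dInv_mem_deg hx)
    have h2 := (D.hasDeg_trick hU.deg.quad).comp (q := D'.harmEnd) (𝒩 := B.deg) (δ := 0)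
      (fun k x hx => by rw [add_zero]; exact D'.splitting_mem_deg (D'.harmClass_mem_deg hx))
    exact ((isNormalized_base D D' hσ).deg.add h1).sub h2
  nil := step_nil D D' hσ.nil hU.nil
  one := by rw [step_single D D' hU.nil, D.harmClass_one, hσ.one, splitting_one]
  unit l h1 h2 := by
    have h : D'.splitting (σ (l.map D.harmClass)) = 0 := (isNormalized_base D D' hσ).unit l h1 h2
    rw [step, h, hU.quad_unit h2, trick, ins_eq_zero_of_mem hU.ml.quad D.dInv_one
      D.harmEnd_twist_one (fun m hm => hU.quad_unit hm) h2]
    simp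

variable (σ) in
/-- The iterates of `step`. -/
noncomputable def stepIter : ℕ → List A.toDGCA → B.toDGCA
  | 0 => fun l => D'.splitting (σ (l.map D.harmClass))
  | k + 1 => step D D' σ (stepIter k)

variable (σ) in
/-- The limit of the iterates of `step`. -/
noncomputable def extension (l : List A.toDGCA) : B.toDGCA := stepIter D D' σ l.length l

lemma isNormalized_stepIter (hσ : IsModel σ) (k : ℕ) :
    IsNormalized (A := A.toDGCA) (B := B.toDGCA) (stepIter D D' σ k) := by
  induction k with
  | zero => exact isNormalized_base D D' hσ
  | succ k ih => exact isNormalized_step D D' hσ ih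

lemma stepIter_succ (hσ : IsModel σ) {k : ℕ} {l : List A.toDGCA} (h : l.length ≤ k) :
    stepIter D D' σ (k + 1) l = stepIter D D' σ k l := by
  induction k generalizing l with
  | zero =>
    obtain rfl := List.length_eq_zero_iff.1 (Nat.le_zero.1 h)
    rw [(isNormalized_stepIter D D' hσ _).nil, (isNormalized_stepIter D D' hσ _).nil]
  | succ k ih =>
    exact step_congr D D' (isNormalized_stepIter D D' hσ _).nil
      (isNormalized_stepIter D D' hσ _).nil fun m hm => ih (by omega)

lemma extension_eq (hσ : IsModel σ) {k : ℕ} {l : List A.toDGCA} (h : l.length ≤ k) :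
    extension D D' σ l = stepIter D D' σ k l := by
  induction k, h using Nat.le_induction with
  | base => rfl
  | succ k hk ih => rw [ih, stepIter_succ D D' hσ hk]

lemma isNormalized_extension (hσ : IsModel σ) :
    IsNormalized (A := A.toDGCA) (B := B.toDGCA) (extension D D' σ) where
  ml l₁ l₂ := by
    have e : ∀ x, extension D D' σ (l₁ ++ x :: l₂) =
        stepIter D D' σ (l₁.length + l₂.length + 1) (l₁ ++ x :: l₂) :=
      fun x => extension_eq D D' hσ (by simp; omega)
    simp only [e]
    exact (isNormalized_stepIter D D' hσ _).ml l₁ l₂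
  deg l := (isNormalized_stepIter D D' hσ l.length).deg l
  nil := (isNormalized_stepIter D D' hσ _).nil
  one := (isNormalized_stepIter D D' hσ _).one
  unit l := (isNormalized_stepIter D D' hσ l.length).unit l

lemma extension_fixed (hσ : IsModel σ) (l : List A.toDGCA) :
    extension D D' σ l = step D D' σ (extension D D' σ) l := by
  rw [extension_eq D D' hσ (Nat.le_succ _)]
  exact step_congr D D' (isNormalized_stepIter D D' hσ _).nil (isNormalized_extension D D' hσ).nil
    fun m hm => (extension_eq D D' hσ hm.le).symm

lemma extension_single (hσ : IsModel σ) (a : A.toDGCA) :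
    extension D D' σ [a] = D'.splitting (σ [D.harmClass a]) := by
  rw [extension_fixed D D' hσ, step_single D D' (isNormalized_extension D D' hσ).nil]

/-- If the obstructions vanish, then the fixed point of `step` solves the equation of
`A_∞`-morphisms. -/
theorem extension_equation (hσ : IsModel σ)
    (hobs : ∀ l : List A.Cohomology,
      D'.harmClass (quad (extension D D' σ) (l.map D.splitting)) = 0) (l : List A.toDGCA) :
    B.d (extension D D' σ l) - ins A.d A.twist l (extension D D' σ)
      - quad (extension D D' σ) l = 0 := by
  have hN := isNormalized_extension D D' hσ
  set U := extension D D' σ with hUdef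
  set R : List A.toDGCA → B.toDGCA := fun m => B.d (U m) - ins A.d A.twist m U - quad U m with hR
  have hobs' : ∀ m : List A.toDGCA, D'.harmClass (quad U (m.map D.harmEnd)) = 0 := by
    intro m
    have := hobs (m.map D.harmClass)
    rwa [List.map_map] at this
  have hfix : ∀ m, U m = D'.splitting (σ (m.map D.harmClass)) + D'.dInv (quad U m)
      - D'.harmEnd (D.trick m (quad U)) := extension_fixed D D' hσ
  -- The homotopy formulas of target and source are applied to `quad U`. Their harmonic
  -- contributions combine to the obstruction, which is zero by `hobs'`; the error is then the
  -- homotopy applied to `d quad U + (quad U) b₁`.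
  have hK : ∀ m, R m = -(D'.dInv (B.d (quad U m) + ins A.d A.twist m (quad U))
      + D'.harmEnd (D.trick m (fun m => B.d (quad U m) + ins A.d A.twist m (quad U)))) := by
    intro m
    have e1 : ins A.d A.twist m U = D'.dInv (ins A.d A.twist m (quad U))
        - D'.harmEnd (ins A.d A.twist m (fun m => D.trick m (quad U))) := by
      have : U = fun m => D'.splitting (σ (m.map D.harmClass)) + D'.dInv (quad U m)
        - D'.harmEnd (D.trick m (quad U)) := funext hfix
      conv_lhs => rw [this]
      rw [ins_fun_sub, ins_fun_add, ins_comp, ins_comp, ins_comp _ _ D'.harmEnd,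
        ins_map_eq_zero hσ.ml D.harmClass_d, map_zero, zero_add]
    have e2 : B.d (U m) = B.d (D'.dInv (quad U m)) := by
      conv_lhs => rw [hfix]
      simp [d_splitting]
    have e3 := D'.homotopy (quad U m)
    have e4 := D.trick_homotopy hN.ml.quad m
    have e5 : D'.harmEnd (D.trick m (fun m => B.d (quad U m))) = 0 := by
      rw [trick, ins_comp]
      simp [harmClass_d]
    have e6 : D'.harmEnd (D.trick m fun m => B.d (quad U m) + ins A.d A.twist m (quad U)) =
        D'.harmEnd (D.trick m fun m => ins A.d A.twist m (quad U)) := by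
      rw [trick, ins_fun_add, map_add]
      rw [trick] at e5
      rw [e5, zero_add]
    have e7 := congrArg D'.harmEnd e4
    rw [map_add, map_sub, harmEnd_apply D' (quad U (m.map D.harmEnd)), hobs', map_zero, sub_zero] at e7
    rw [← harmEnd_apply] at e3
    rw [e6, hR]
    beta_reduce
    rw [e1, e2, map_add, eq_sub_of_add_eq e3, eq_sub_of_add_eq e7]
    abel
  change R l = 0
  induction hl : l.length using Nat.strong_induction_on generalizing l with
  | _ N ih =>
    -- By the Bianchi identity this expression is linear in the error on strictly shorter lists,
    -- where the error vanishes by induction.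
    have hB : ∀ m : List A.toDGCA, m.length = N →
        B.d (quad U m) + ins A.d A.twist m (quad U) = 0 := by
      intro m hm
      rw [d_quad hN.ml hN.deg,
        mulIns_eq_zero _ _ (fun m' hm' => ih _ (by omega) m' rfl),
        cup_eq_zero_left hN.nil (fun m' hm' => by
          have := ih _ (by omega) m' rfl
          rw [hR] at this
          beta_reduce at this
          rw [this, map_zero]),
        cup_eq_zero_right hN.nil (fun m' hm' => ih _ (by omega) m' rfl)]
      simp
    rw [hK, hB l hl, trick, ins_eq_zero _ _ (fun m hm => hB m (by omega))]
    simp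

end PoincareDGCA.HodgeDecomposition

/-! ### Vanishing of the obstructions. -/

namespace ListCochain

variable {F : Type*} [Field F] {α M : Type*} [AddCommGroup α] [Module F α] [AddCommGroup M]
  [Module F M]

lemma ins_eq_zero_of_forall {U : List α → M} (hU : IsMl F U) {u v : α →ₗ[F] α} {l : List α}
    (h : ∀ x ∈ l, u x = 0) : ins u v l U = 0 := by
  induction l generalizing U with
  | nil => simp
  | cons a l ih =>
    rw [ins_cons, h a (by simp), hU.cons_zero, ih (hU.tail _) (fun x hx => h x (by simp [hx])),
      add_zero]

end ListCochain

namespace PoincareDGCA.HodgeDecomposition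

variable {F : Type*} [Field F] {n n' : ℕ} {A : PoincareDGCA F n} {B : PoincareDGCA F n'}
  (D : A.HodgeDecomposition) (D' : B.HodgeDecomposition)

/-- The set `ℋ ∪ ℬ`. -/
def orthSet : Set A.toDGCA := {x | x ∈ D.harm ∨ x ∈ D.compl}

variable {D} in
lemma dInv_of_mem_orthSet {x : A.toDGCA} (hx : x ∈ D.orthSet) : D.dInv x = 0 :=
  D.dInv_eq_zero (hx.elim Submodule.mem_sup_left Submodule.mem_sup_right)

lemma trick_eq_zero {M : Type*} [AddCommGroup M] [Module F M] {U : List A.toDGCA → M}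
    (hU : IsMl F U) {l : List A.toDGCA} (hl : ∀ x ∈ l, x ∈ D.orthSet) : D.trick l U = 0 :=
  ins_eq_zero_of_forall hU fun x hx => dInv_of_mem_orthSet (hl x hx)

/-- As `d⁻` kills `ℋ ∪ ℬ`, the homotopy can only act on the newly formed product. It turns this
product into an element of `ℬ`, entries to its left become harmonic, and the resulting list again
has entries in `ℋ ∪ ℬ`. -/
lemma mulIns_trick_eq_zero {M : Type*} [AddCommGroup M] [Module F M] {U : List A.toDGCA → M}
    (hU : IsMl F U) {l : List A.toDGCA} (hl : ∀ x ∈ l, x ∈ D.orthSet)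
    (h : ∀ m : List A.toDGCA, m.length + 1 = l.length → (∀ x ∈ m, x ∈ D.orthSet) → U m = 0) :
    mulIns A.barMul A.twist l (fun m => D.trick m U) = 0 := by
  induction l generalizing U with
  | nil => simp
  | cons a l ih =>
    have hl' : ∀ x ∈ l, x ∈ D.orthSet := fun x hx => hl x (by simp [hx])
    have h1 : (fun m => D.trick (A.twist a :: m) U) =
        fun m => D.trick m (fun m => U (D.harmEnd a :: m)) := by
      ext m
      have : D.dInv a = 0 := dInv_of_mem_orthSet (hl a (by simp))
      rw [trick, ins_cons, LinearMap.comp_apply, twist_twist, twist_apply, map_neg, dInv_parity, this,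
        map_zero, neg_zero, neg_zero, hU.cons_zero, zero_add]
      rfl
    rw [mulIns_cons, h1, ih (hU.tail _) hl' (fun m hm hx => h _ (by simp [hm]) (by
      intro x hx'
      rcases List.mem_cons.1 hx' with rfl | hx'
      · exact Or.inl (D.splitting_mem (D.harmClass a))
      · exact hx x hx')), add_zero]
    cases l with
    | nil => simp
    | cons c l =>
      have hl2 : ∀ x ∈ l, x ∈ D.orthSet := fun x hx => hl' x (by simp [hx])
      rw [mulHead_cons, trick, ins_cons, h _ (by simp) (by
        intro x hx'
        rcases List.mem_cons.1 hx' with rfl | hx'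
        · exact Or.inr (D.dInv_mem _)
        · exact hl2 x hx'), zero_add]
      exact D.trick_eq_zero (hU.tail _) hl2

/-- All terms with a factor in `ℬ` vanish because `ℬ` is orthogonal to `ℋ ⊕ ℬ`. -/
lemma int_orth_mul (α β : A.Cohomology) (x y : A.toDGCA) :
    A.int (D.harmClass (A.parity (D.splitting α + D.dInv x) * (D.splitting β + D.dInv y))) =
      A.int (A.cohParity α * β) := by
  have h1 := D.int_harmClass_mul (x := D.splitting (A.cohParity α) + A.parity (D.dInv x))
    (Submodule.add_mem_sup (D.splitting_mem _) (D.parity_mem_compl (D.dInv_mem x))) (D.dInv_mem y)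
  have h2 := D.int_harmClass_mul' (D.parity_mem_compl (D.dInv_mem x))
    (Submodule.mem_sup_left (D.splitting_mem β))
  rw [map_add, ← splitting_cohParity, mul_add, map_add, map_add, h1, add_zero, add_mul, map_add,
    map_add, h2, add_zero, harmClass_splitting_mul]

section obstruction

variable {σ : List A.Cohomology → B.Cohomology}

/-- On such lists the source homotopy has nothing to act on, so the values lie in `ℋ ⊕ ℬ` of the
target with harmonic part given by `σ`. -/
lemma extension_of_orth (hσ : IsModel σ) {l : List A.toDGCA} (hl : ∀ x ∈ l, x ∈ D.orthSet) :
    extension D D' σ l = D'.splitting (σ (l.map D.harmClass))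
      + D'.dInv (quad (extension D D' σ) l) := by
  rw [extension_fixed D D' hσ, step, trick_eq_zero D (isNormalized_extension D D' hσ).ml.quad hl]
  simp

/-- The obstructions have no component in the top degree. -/
lemma int_quad_eq_zero (hσ : IsModel σ) {φ : A.Cohomology ≃ₐ[F] B.Cohomology}
    (hφ : ∀ α, σ [α] = φ α) (hφp : ∀ α, φ (A.cohParity α) = B.cohParity (φ α))
    (hint : ∃ c : F, ∀ α, B.int (φ α) = c * A.int α)
    (h2 : ∀ l : List A.Cohomology, 2 ≤ l.length → B.int (σ l) = 0)
    (h3 : ∀ l : List A.Cohomology, 3 ≤ l.length →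
      B.int (cup (fun m => B.cohParity (σ m)) σ l) = 0)
    (l : List A.toDGCA) (hlen : 2 ≤ l.length) (hl : ∀ x ∈ l, x ∈ D.orthSet) :
    B.int (D'.harmClass (quad (extension D D' σ) l)) = 0 := by
  have hN := isNormalized_extension D D' hσ
  set U := extension D D' σ with hU
  set t : B.toDGCA →ₗ[F] F := B.int ∘ₗ D'.harmClass with ht
  change t (quad U l) = 0
  induction hlk : l.length generalizing l with
  | zero => omega
  | succ k ih =>
    by_cases hk : l.length = 2
    · obtain ⟨a, b, rfl⟩ := List.length_eq_two.1 hk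
      have ha := hl a (by simp)
      have hb := hl b (by simp)
      -- Up to the factor `c` the claim is `∫ āb = ∫ ā_ℋ b_ℋ`, which is orthogonality of the
      -- decomposition of the source.
      obtain ⟨c, hc⟩ := hint
      rw [quad_pair hN.nil, hU, extension_single D D' hσ, extension_single D D' hσ,
        extension_single D D' hσ, hφ, hφ, hφ, ht, LinearMap.comp_apply, map_sub, map_sub,
        harmClass_splitting, ← splitting_cohParity, harmClass_splitting_mul, ← hφp, ← map_mul, hc, hc]
      rcases ha with ha | ha
      · rcases hb with hb | hb
        · rw [← D.splitting_harmClass_of_mem ha, ← D.splitting_harmClass_of_mem hb,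
            ← splitting_cohParity, harmClass_splitting_mul, harmClass_splitting,
            harmClass_splitting, sub_self]
        · rw [D.int_harmClass_mul (Submodule.mem_sup_left (D.parity_mem_harm ha)) hb,
            D.harmClass_compl hb]
          simp
      · rw [D.int_harmClass_mul' (D.parity_mem_compl ha)
          (hb.elim Submodule.mem_sup_left Submodule.mem_sup_right), D.harmClass_compl ha]
        simp
    · have h3' : 3 ≤ l.length := by omega
      have hI : IsMl F (fun m => t (quad U m)) := hN.ml.quad.comp t
      -- The lists in the product term have length at least 2, where the harmonic part of `U` has
      -- integral zero by `h2` and the `d⁻` part has no harmonic class. What remains is the homotopy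
      -- applied to the integral of `quad U`, covered by induction.
      have e1 : t (mulIns A.barMul A.twist l U) = 0 := by
        rw [← mulIns_comp, mulIns_congr (V := fun m => -D.trick m (fun m => t (quad U m))),
          mulIns_fun_neg, D.mulIns_trick_eq_zero hI hl
            (fun m hm hx => ih m (by omega) hx (by omega)), neg_zero]
        intro m hm
        rw [trick, ins_comp]
        conv_lhs => rw [hU, extension_fixed D D' hσ]
        rw [ht, step, LinearMap.comp_apply, map_sub, map_sub, map_add, map_add, harmClass_splitting,
          h2 _ (by simp; omega), harmClass_dInv, map_zero, zero_add, zero_sub,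
          harmClass_splitting]
        rfl
      -- Both factors lie in `ℋ ⊕ ℬ`, so only their harmonic parts contribute; `h3` then gives zero.
      have e2 : t (cup (fun m => B.parity (U m)) U l) =
          B.int (cup (fun m => B.cohParity (σ m)) σ (l.map D.harmClass)) := by
        refine cup_congr (q := t.toAddMonoidHom) (q' := B.int.toAddMonoidHom) (by simp)
          fun i _ => ?_
        have h1 := extension_of_orth D D' hσ (l := l.take i)
          fun x hx => hl x (List.mem_of_mem_take hx)
        have h2 := extension_of_orth D D' hσ (l := l.drop i)
          fun x hx => hl x (List.mem_of_mem_drop hx)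
        rw [hU, h1, h2, ← List.map_take, ← List.map_drop]
        exact D'.int_orth_mul _ _ _ _
      rw [quad, map_sub, e1, e2, h3 _ (by simpa using h3'), sub_zero]

lemma harmClass_quad_pair (hσ : IsModel σ) {φ : A.Cohomology ≃ₐ[F] B.Cohomology}
    (hφ : ∀ α, σ [α] = φ α) (a b : A.toDGCA) :
    D'.harmClass (quad (extension D D' σ) [a, b]) =
      φ (D.harmClass (A.parity a * b))
        - B.cohParity (φ (D.harmClass a)) * φ (D.harmClass b) := by
  rw [quad_pair (isNormalized_extension D D' hσ).nil, extension_single D D' hσ,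
    extension_single D D' hσ, extension_single D D' hσ, hφ, hφ, hφ, map_sub, harmClass_splitting,
    ← splitting_cohParity, harmClass_splitting_mul]

lemma harmClass_extension_pair (hσ : IsModel σ) {φ : A.Cohomology ≃ₐ[F] B.Cohomology}
    (hφ : ∀ α, σ [α] = φ α) (a b : A.toDGCA) :
    D'.harmClass (extension D D' σ [a, b]) = σ [D.harmClass a, D.harmClass b]
      - φ (D.harmClass (A.parity (D.dInv a) * b))
      + φ (D.harmClass (D.splitting (D.harmClass a) * D.dInv b)) := by
  rw [extension_fixed D D' hσ, step, map_sub, map_add, harmClass_splitting, harmClass_dInv,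
    harmClass_splitting, trick, ins_cons, ins_cons, ins_nil, add_zero, add_zero,
    map_add, harmClass_quad_pair D D' hσ hφ, harmClass_quad_pair D D' hσ hφ]
  simp [harmClass_dInv, parity_parity, harmClass_parity, splitting_cohParity]
  abel

/-- The first obstruction that is not automatic: a Hochschild coboundary of the bilinear part of
`σ`, written with suspension signs, plus the difference of the two `μ₃`. The latter arises from the
homotopies in the values of `U` on pairs. -/
lemma harmClass_quad_triple (hσ : IsModel σ) {φ : A.Cohomology ≃ₐ[F] B.Cohomology}
    (hφ : ∀ α, σ [α] = φ α) (hφp : ∀ α, φ (A.cohParity α) = B.cohParity (φ α))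
    (α β γ : A.Cohomology) :
    D'.harmClass (quad (extension D D' σ) [D.splitting α, D.splitting β, D.splitting γ]) =
      σ [A.cohParity α * β, γ] - σ [A.cohParity α, A.cohParity β * γ]
        - φ (A.cohParity α) * σ [β, γ] - B.cohParity (σ [α, β]) * φ γ
        + φ (D.mu3 ![α, A.cohParity β, γ])
        - D'.mu3 ![φ α, φ (A.cohParity β), φ γ] := by
  have hN := isNormalized_extension D D' hσ
  have hpair : ∀ α β : A.Cohomology, extension D D' σ [D.splitting α, D.splitting β] =
      D'.splitting (σ [α, β]) - D'.dInv (D'.splitting (B.cohParity (φ α)) * D'.splitting (φ β)) := by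
    intro α β
    rw [extension_of_orth D D' hσ (by simp [orthSet, splitting_mem]), quad_pair hN.nil,
      extension_single D D' hσ, extension_single D D' hσ, extension_single D D' hσ, hφ, hφ, hφ,
      map_sub, dInv_splitting, harmClass_splitting, harmClass_splitting, ← splitting_cohParity]
    simp [harmClass_splitting, sub_eq_add_neg]
  rw [quad_triple hN.nil hN.ml, hpair, hpair, extension_single D D' hσ, extension_single D D' hσ,
    hφ, hφ, map_sub, map_sub, map_sub, harmClass_extension_pair D D' hσ hφ,
    harmClass_extension_pair D D' hσ hφ, map_sub, sub_mul, mul_sub, map_sub, map_sub]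
  simp only [mu3_apply, tri, harmClass_splitting, ← splitting_cohParity, harmClass_splitting_mul,
    map_sub, dInv_splitting, map_zero, mul_zero, zero_mul, ← hφp]
  have e1 : A.parity (D.dInv (D.splitting (A.cohParity α) * D.splitting β)) =
      -D.dInv (D.splitting α * D.splitting (A.cohParity β)) := by
    rw [← neg_eq_iff_eq_neg, ← dInv_parity, parity_mul, ← splitting_cohParity,
      ← splitting_cohParity, cohParity_cohParity]
  have e2 : B.parity (D'.dInv (D'.splitting (φ (A.cohParity α)) * D'.splitting (φ β))) =
      -D'.dInv (D'.splitting (φ α) * D'.splitting (φ (A.cohParity β))) := by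
    rw [← neg_eq_iff_eq_neg, ← dInv_parity, parity_mul, ← splitting_cohParity,
      ← splitting_cohParity, ← hφp, ← hφp, cohParity_cohParity]
  rw [e1, e2]
  simp [← hφp]
  abel

/-- The obstructions vanish. -/
theorem harmClass_quad_eq_zero (hσ : IsModel σ) {φ : A.Cohomology ≃ₐ[F] B.Cohomology} {r : ℕ}
    (hr : 1 < r) (hn' : n' + 3 ≤ 5 * r) (connA : A.IsConnectedUpTo (r - 1))
    (connB : B.IsConnectedUpTo (r - 1))
    (hφ : ∀ α, σ [α] = φ α) (hφp : ∀ α, φ (A.cohParity α) = B.cohParity (φ α))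
    (hint : ∃ c : F, ∀ α, B.int (φ α) = c * A.int α)
    (h2 : ∀ l : List A.Cohomology, 2 ≤ l.length → B.int (σ l) = 0)
    (h3 : ∀ l : List A.Cohomology, 3 ≤ l.length →
      B.int (cup (fun m => B.cohParity (σ m)) σ l) = 0)
    (hμ : ∀ α β γ : A.Cohomology,
      σ [A.cohParity α * β, γ] - σ [A.cohParity α, A.cohParity β * γ]
        - φ (A.cohParity α) * σ [β, γ] - B.cohParity (σ [α, β]) * φ γ
        + φ (D.mu3 ![α, A.cohParity β, γ])
        - D'.mu3 ![φ α, φ (A.cohParity β), φ γ] = 0)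
    (l : List A.Cohomology) :
    D'.harmClass (quad (extension D D' σ) (l.map D.splitting)) = 0 := by
  have hN := isNormalized_extension D D' hσ
  have hV : IsMl F (fun l : List A.Cohomology =>
      D'.harmClass (quad (extension D D' σ) (l.map D.splitting))) :=
    (hN.ml.quad.map D.splitting).comp D'.harmClass
  have hVdeg : HasDeg A.cohDeg B.cohDeg (fun l : List A.Cohomology =>
      D'.harmClass (quad (extension D D' σ) (l.map D.splitting))) (2 + 0) :=
    (hN.deg.quad.map (q := D.splitting) (fun k x hx => D.splitting_mem_deg hx)).comp
      (fun k x hx => by rw [add_zero]; exact D'.harmClass_mem_deg hx)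
  -- Connectedness makes `1` and the classes of degree at least `r` span the cohomology;
  -- normalization disposes of lists containing `1`.
  refine hV.eq_zero_of_span ({1} ∪ {α | ∃ k : ℤ, r ≤ k ∧ α ∈ A.cohDeg k}) ?_ l ?_
  · clear l
    intro l hl
    by_cases h1 : (1 : A.Cohomology) ∈ l
    · rw [hN.quad_unit (by rw [← D.splitting_one]; exact List.mem_map_of_mem h1), map_zero]
    · have hl' : ∀ x ∈ l, ∃ k : ℤ, r ≤ k ∧ x ∈ A.cohDeg k := by
        intro x hx
        rcases hl x hx with rfl | h
        · exact absurd hx h1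
        · exact h
      match l, hl' with
      | [], _ => rw [List.map_nil, quad_nil hN.nil, map_zero]
      | [α], _ => rw [List.map_singleton, quad_single hN.nil, map_zero]
      | [α, β], _ =>
        rw [List.map_cons, List.map_singleton, harmClass_quad_pair D D' hσ hφ,
          ← splitting_cohParity, harmClass_splitting_mul, harmClass_splitting,
          harmClass_splitting, ← hφp, map_mul, sub_self]
      | [α, β, γ], _ =>
        exact (harmClass_quad_triple D D' hσ hφ hφp α β γ).trans (hμ α β γ)
      | α :: β :: γ :: δ :: l, hl' =>
        have hk : ∃ k : List ℤ, List.Forall₂ (fun a i => a ∈ A.cohDeg i) (α :: β :: γ :: δ :: l) k ∧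
            (r - 1 : ℤ) * (α :: β :: γ :: δ :: l).length ≤ (k.map (fun i => i - 1)).sum := by
          generalize α :: β :: γ :: δ :: l = m at hl'
          induction m with
          | nil => exact ⟨[], .nil, by simp⟩
          | cons a m ih =>
            obtain ⟨k, hk, hs⟩ := ih fun x hx => hl' x (by simp [hx])
            obtain ⟨i, hi, ha⟩ := hl' a (by simp)
            refine ⟨i :: k, .cons ha hk, ?_⟩
            simp only [List.map_cons, List.sum_cons, List.length_cons]
            push_cast
            linarith
        obtain ⟨k, hk, hs⟩ := hk
        have hmem := hVdeg _ _ hk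
        -- Each of the at least four entries contributes at least `r - 1` to the suspended degree,
        -- and `quad` has degree 2.
        have hm : (2 : ℤ) + 4 * (r - 1) ≤ 2 + 0 + (k.map (fun i => i - 1)).sum := by
          have : (4 : ℤ) ≤ (α :: β :: γ :: δ :: l).length := by
            simp only [List.length_cons]
            push_cast
            linarith [Int.natCast_nonneg l.length]
          nlinarith
        generalize 2 + 0 + (k.map (fun i => i - 1)).sum = j at hmem hm
        -- Since `n' ≤ 5r - 3`, the bound `4r - 2` is at least `n' - (r - 1)`, the beginning of the
        -- gap below the top degree.
        by_cases hj : j = n'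
        · subst hj
          refine eq_zero_of_int connB hmem ?_
          refine int_quad_eq_zero D D' hσ hφ hφp hint h2 h3 _ (by simp) fun x hx => ?_
          obtain ⟨y, _, rfl⟩ := List.mem_map.1 hx
          exact Or.inl (D.splitting_mem y)
        · rwa [cohDeg_eq_bot_of_gap connB (by omega) hj, Submodule.mem_bot] at hmem
  · intro x _
    refine coh_induction (P := fun x => x ∈ Submodule.span F _) (zero_mem _) (fun k α hα => ?_)
      (fun _ _ => add_mem) x
    rcases lt_trichotomy k 0 with h | rfl | h
    · rw [cohDeg_eq_bot (Or.inl h), Submodule.mem_bot] at hα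
      rw [hα]
      exact zero_mem _
    · obtain ⟨c, rfl⟩ := cohDeg_zero connA hα
      exact Submodule.smul_mem _ _ (Submodule.subset_span (Or.inl rfl))
    · by_cases hkr : (r : ℤ) ≤ k
      · exact Submodule.subset_span (Or.inr ⟨k, hkr, hα⟩)
      · rw [connA.2 k (by omega) (by omega), Submodule.mem_bot] at hα
        rw [hα]
        exact zero_mem _

end obstruction

end PoincareDGCA.HodgeDecomposition

/-! ### From functions on lists to `A_∞`-morphisms: signs. -/

namespace ListCochain

/-- The list `(c 0, …, c (N - 1))`. -/
def initial {α : Type*} (c : ℕ → α) (N : ℕ) : List α := List.ofFn (fun i : Fin N => c i)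

lemma initial_zero {α : Type*} (c : ℕ → α) : initial c 0 = [] := rfl

lemma initial_succ {α : Type*} (c : ℕ → α) (N : ℕ) :
    initial c (N + 1) = c 0 :: initial (fun i => c (i + 1)) N := by
  simp [initial, List.ofFn_succ]

lemma initial_congr {α : Type*} {c c' : ℕ → α} {N : ℕ} (h : ∀ i < N, c i = c' i) :
    initial c N = initial c' N := by
  unfold initial
  congr 1
  ext i
  exact h i i.2

lemma cup_initial {α R : Type*} [Ring R] (c : ℕ → α) (N : ℕ) (U V : List α → R) :
    cup U V (initial c N) = ∑ i ∈ Finset.range (N + 1),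
      U (initial c i) * V (initial (fun l => c (i + l)) (N - i)) := by
  induction N generalizing c U with
  | zero => simp [initial_zero]
  | succ N ih =>
    rw [initial_succ, cup_cons, ih, Finset.sum_range_succ' _ (N + 1), add_comm]
    congr 1
    · refine Finset.sum_congr rfl fun i _ => ?_
      simp [initial_succ, add_right_comm]
    · simp [initial_succ, initial_zero]

section

variable {F : Type*} [Field F] {α M : Type*} [AddCommGroup α] [Module F α] [AddCommGroup M]
  [Module F M]

lemma ins_initial (u v : α →ₗ[F] α) (c : ℕ → α) (N : ℕ) (U : List α → M) :
    ins u v (initial c N) U = ∑ r ∈ Finset.range N,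
      U (initial (fun i => if i < r then v (c i) else if i = r then u (c i) else c i) N) := by
  induction N generalizing c U with
  | zero => simp [initial_zero]
  | succ N ih =>
    rw [initial_succ, ins_cons, ih, Finset.sum_range_succ', add_comm]
    congr 1
    · refine Finset.sum_congr rfl fun r _ => ?_
      simp [initial_succ]
    · simp [initial_succ]

lemma mulIns_initial (w : α →ₗ[F] α →ₗ[F] α) (v : α →ₗ[F] α) (c : ℕ → α) (N : ℕ)
    (U : List α → M) :
    mulIns w v (initial c (N + 1)) U = ∑ r ∈ Finset.range N,
      U (initial (fun i => if i < r then v (c i) else if i = r then w (c i) (c (i + 1))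
        else c (i + 1)) N) := by
  induction N generalizing c U with
  | zero => simp [initial_zero, initial_succ]
  | succ N ih =>
    rw [initial_succ, mulIns_cons, ih, Finset.sum_range_succ', add_comm]
    congr 1
    · refine Finset.sum_congr rfl fun r _ => ?_
      simp [initial_succ]
    · simp [initial_succ]

lemma _root_.IsMl.initial_smul {U : List α → M} (hU : IsMl F U) (ε : ℕ → F) (x : ℕ → α) (N : ℕ) :
    U (initial (fun i => ε i • x i) N) = (∏ i ∈ Finset.range N, ε i) • U (initial x N) := by
  induction N generalizing ε x U with
  | zero => simp [initial_zero]
  | succ N ih =>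
    rw [initial_succ, hU.cons_smul, ih (hU.tail _), Finset.prod_range_succ', smul_smul,
      initial_succ, mul_comm]

/-- The multilinear maps given by a multilinear function on lists. -/
lemma _root_.IsMl.ofFn_update_isLinearMap {U : List α → M} (hU : IsMl F U) {N : ℕ} (v : Fin N → α)
    (i : Fin N) : IsLinearMap F (fun x => U (List.ofFn (Function.update v i x))) := by
  induction N generalizing U with
  | zero => exact i.elim0
  | succ N ih =>
    cases i using Fin.cases with
    | zero =>
      have h : ∀ x, List.ofFn (Function.update v 0 x) = x :: List.ofFn (fun i => v i.succ) := by
        intro x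
        simp [List.ofFn_succ]
      simp only [h]
      exact hU.head _
    | succ i =>
      have h : ∀ x, List.ofFn (Function.update v i.succ x) =
          v 0 :: List.ofFn (Function.update (fun i => v i.succ) i x) := by
        intro x
        rw [List.ofFn_succ]
        congr 1
        congr 1
        ext j
        by_cases hj : j = i
        · subst hj
          simp
        · rw [Function.update_of_ne hj, Function.update_of_ne (by simpa using hj)]
      simp only [h]
      exact ih (hU.tail _) _ _

/-- The `N`-linear map given by a multilinear function on lists. -/
def _root_.IsMl.toMultilinearMap {U : List α → M} (hU : IsMl F U) (N : ℕ) :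
    MultilinearMap F (fun _ : Fin N => α) M :=
  MultilinearMap.mk' (fun v => U (List.ofFn v))
    (fun v i x y => (hU.ofFn_update_isLinearMap v i).map_add x y)
    (fun v i c x => (hU.ofFn_update_isLinearMap v i).map_smul c x)

end

lemma prod_range_ite {F : Type*} [CommRing F] (x : ℕ → F) (s : F) {r N : ℕ} (h : r < N) :
    ∏ i ∈ Finset.range N, (if i < r then x i else if i = r then s else 1) =
      (∏ i ∈ Finset.range r, x i) * s := by
  obtain ⟨j, rfl⟩ := Nat.exists_eq_add_of_lt h
  rw [add_assoc, Finset.prod_range_add, Finset.prod_range_succ']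
  congr 1
  · refine Finset.prod_congr rfl fun i hi => ?_
    rw [if_pos (Finset.mem_range.1 hi)]
  · simp

end ListCochain

lemma neg_one_zpow_congr {F : Type*} [Field F] {a b : ℤ} (h : Even (a - b)) :
    (-1 : F) ^ a = (-1 : F) ^ b := by
  rw [← sub_add_cancel a b, zpow_add₀ (by simp), h.neg_one_zpow, one_mul]

lemma prod_neg_one_zpow {F : Type*} [Field F] (k : ℕ → ℤ) (N : ℕ) :
    ∏ i ∈ Finset.range N, (-1 : F) ^ k i = (-1 : F) ^ (∑ i ∈ Finset.range N, k i) := by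
  induction N with
  | zero => simp
  | succ N ih => rw [Finset.prod_range_succ, ih, Finset.sum_range_succ, zpow_add₀ (by simp)]

namespace DGCA

variable {F : Type*} [Field F] {A B : DGCA F}

lemma parity_pow_mem {k : ℤ} {x : A} (hx : x ∈ A.deg k) (j : ℕ) : (A.parity ^ j) x ∈ A.deg k := by
  induction j with
  | zero => simpa using hx
  | succ j ih =>
    rw [pow_succ', Module.End.mul_apply]
    exact parity_mem_deg ih

lemma parity_pow_of_mem {k : ℤ} {x : A} (hx : x ∈ A.deg k) (j : ℕ) :
    (A.parity ^ j) x = ((-1 : F) ^ (k * j)) • x := by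
  induction j with
  | zero => simp
  | succ j ih =>
    rw [pow_succ', Module.End.mul_apply, ih, map_smul, parity_of_mem hx, smul_smul,
      ← zpow_add₀ (by simp)]
    push_cast
    ring_nf

lemma parity_pow_add_two (j : ℕ) (x : A) : (A.parity ^ (j + 2)) x = (A.parity ^ j) x := by
  rw [pow_add, Module.End.mul_apply]
  congr 1
  exact parity_parity x

lemma parity_pow_mul (j : ℕ) (x y : A) :
    (A.parity ^ j) (x * y) = (A.parity ^ j) x * (A.parity ^ j) y := by
  induction j with
  | zero => simp
  | succ j ih => simp only [pow_succ', Module.End.mul_apply, ih, parity_mul]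

lemma d_parity_pow (j : ℕ) (x : A) :
    A.d ((A.parity ^ j) x) = ((-1 : F) ^ j) • (A.parity ^ j) (A.d x) := by
  induction j with
  | zero => simp
  | succ j ih =>
    simp only [pow_succ', Module.End.mul_apply, d_parity, ih, map_smul, neg_mul, one_mul, neg_smul]

end DGCA

namespace AInftyHom

variable {F : Type*} [Field F] {A B : DGCA F}

/-- The component `f_N` determined by a multilinear function on the bar construction. -/
noncomputable def componentOfList {U : List A → B} (hU : IsMl F U) (N : ℕ) :
    MultilinearMap F (fun _ : Fin N => A) B :=
  -- These powers of the involution are the signs `(-1)^{∑ (N-1-i) kᵢ}` of the suspension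
  -- isomorphism.
  (hU.toMultilinearMap N).compLinearMap (fun i => A.parity ^ (N - 1 - (i : ℕ)))

lemma componentOfList_apply {U : List A → B} (hU : IsMl F U) (N : ℕ) (a : ℕ → A) :
    componentOfList hU N (fun i => a i) =
      U (initial (fun i => (A.parity ^ (N - 1 - i)) (a i)) N) := rfl

lemma componentOfList_mem {U : List A → B} (hU : IsMl F U) (hdeg : HasDeg A.deg B.deg U 1) (N : ℕ)
    (k : Fin N → ℤ) (a : Fin N → A) (ha : ∀ i, a i ∈ A.deg (k i)) :
    componentOfList hU N a ∈ B.deg ((∑ i, k i) + (1 - N)) := by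
  have h := hdeg (List.ofFn (fun i : Fin N => (A.parity ^ (N - 1 - (i : ℕ))) (a i))) (List.ofFn k) (by
    rw [List.forall₂_iff_get]
    refine ⟨by simp, fun i h1 h2 => ?_⟩
    simp only [List.get_ofFn]
    exact parity_pow_mem (ha _) _)
  rw [List.map_ofFn, List.sum_ofFn] at h
  simp only [Function.comp_apply, Finset.sum_sub_distrib, Finset.sum_const, Finset.card_univ,
    Fintype.card_fin, nsmul_eq_mul, mul_one] at h
  rwa [show (1 : ℤ) + (∑ i, k i - N) = ∑ i, k i + (1 - N) by ring] at h

/-- The `A_∞`-morphism determined by a multilinear function on the bar construction that is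
homogeneous and satisfies the equation of `A_∞`-morphisms. -/
noncomputable def ofList {U : List A → B} (hU : IsMl F U) (hdeg : HasDeg A.deg B.deg U 1)
    (hnil : U [] = 0)
    (heq : ∀ l, B.d (U l) - ins A.d A.twist l U - quad U l = 0) : AInftyHom A B where
  map := componentOfList hU
  map_mem N _ k a ha := componentOfList_mem hU hdeg N k a ha
  relation := by
    intro N hN k a ha
    obtain ⟨M, rfl⟩ := Nat.exists_eq_add_of_le' hN
    set c : ℕ → A := fun i => (A.parity ^ (M - i)) (a i) with hc
    have hck : ∀ i, c i ∈ A.deg (k i) := fun i => parity_pow_mem (ha i) _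
    have h := heq (initial c (M + 1))
    have hcup : cup (fun m => B.parity (U m)) U (initial c (M + 1)) = ∑ i ∈ Finset.range M,
        B.parity (U (initial c (i + 1))) *
          U (initial (fun l => c (i + 1 + l)) (M + 1 - (i + 1))) := by
      rw [cup_initial, Finset.sum_range_succ', Finset.sum_range_succ, Nat.sub_self, initial_zero,
        initial_zero, hnil, map_zero, zero_mul, mul_zero, add_zero, add_zero]
    rw [quad, ins_initial, mulIns_initial, hcup] at h
    have e0 : componentOfList hU (M + 1) (fun i => a i) = U (initial c (M + 1)) :=
      componentOfList_apply hU (M + 1) a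
    have e1 : ∀ r ∈ Finset.range (M + 1),
        ((-1 : F) ^ (((M + 1 : ℕ) : ℤ) - 1 + ∑ l ∈ Finset.range r, k l)) •
          componentOfList hU (M + 1) (fun i => Function.update a r (A.d (a r)) i) =
        U (initial (fun i => if i < r then A.twist (c i) else if i = r then A.d (c i) else c i)
          (M + 1)) := by
      intro r hr
      rw [Finset.mem_range] at hr
      rw [componentOfList_apply]
      have e : initial (fun i => if i < r then A.twist (c i) else if i = r then A.d (c i) else c i)
          (M + 1) = initial (fun i => (if i < r then -(-1 : F) ^ k i else if i = r then
            (-1 : F) ^ (M - r) else 1) • (A.parity ^ (M + 1 - 1 - i))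
              (Function.update a r (A.d (a r)) i)) (M + 1) := by
        refine initial_congr fun i _ => ?_
        by_cases h1 : i < r
        · rw [if_pos h1, if_pos h1, Function.update_of_ne h1.ne, twist_apply,
            parity_of_mem (hck i), neg_smul]
          rfl
        · rw [if_neg h1, if_neg h1]
          by_cases h2 : i = r
          · subst h2
            rw [if_pos rfl, if_pos rfl, Function.update_self, hc]
            exact d_parity_pow _ _
          · rw [if_neg h2, if_neg h2, Function.update_of_ne h2, one_smul]
            rfl
      rw [e, hU.initial_smul, prod_range_ite _ _ hr]
      congr 1
      -- The twists of the first `r` entries contribute `(-1)^r` besides the Koszul sign. Together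
      -- with `(-1)^(M-r)` from moving `d` past the involutions this is `(-1)^M`, where `M = N - 1`.
      have e' : ∏ i ∈ Finset.range r, -(-1 : F) ^ k i =
          (-1) ^ r * (-1) ^ (∑ i ∈ Finset.range r, k i) := by
        rw [← prod_neg_one_zpow, Finset.prod_neg, Finset.card_range]
      rw [e', mul_right_comm, ← pow_add, zpow_add₀ (by simp), show r + (M - r) = M by omega]
      congr 1
      simp
    have e2 : ∀ r ∈ Finset.range M,
        ((-1 : F) ^ r) • componentOfList hU M (fun i => mulAt a r i) =
        U (initial (fun i => if i < r then A.twist (c i) else if i = r then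
          A.barMul (c i) (c (i + 1)) else c (i + 1)) M) := by
      intro r hr
      rw [Finset.mem_range] at hr
      rw [componentOfList_apply]
      have e : initial (fun i => if i < r then A.twist (c i) else if i = r then
          A.barMul (c i) (c (i + 1)) else c (i + 1)) M =
          initial (fun i => (if i < r then (-1 : F) else if i = r then 1 else 1) •
            (A.parity ^ (M - 1 - i)) (mulAt a r i)) M := by
        refine initial_congr fun i hi => ?_
        -- The component of arity `M` carries one involution less on each entry to the left of the
        -- product; as the involution has square one, one more is the same as one less.
        have h3 : A.parity (c i) = (A.parity ^ (M - 1 - i)) (a i) := by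
          rw [hc, ← parity_pow_add_two (M - 1 - i), show M - 1 - i + 2 = (M - i) + 1 by omega,
            pow_succ', Module.End.mul_apply]
        by_cases h1 : i < r
        · rw [if_pos h1, if_pos h1, mulAt, if_pos h1, twist_apply, h3, neg_one_smul]
        · rw [if_neg h1, if_neg h1, mulAt, if_neg h1]
          by_cases h2 : i = r
          · subst h2
            rw [if_pos rfl, if_pos rfl, if_pos rfl, barMul_apply, h3, one_smul, parity_pow_mul, hc,
              show M - 1 - i = M - (i + 1) by omega]
          · rw [if_neg h2, if_neg h2, if_neg h2, one_smul, hc,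
              show M - 1 - i = M - (i + 1) by omega]
      rw [e, hU.initial_smul, prod_range_ite _ _ hr]
      simp
    have e3 : ∀ i ∈ Finset.range M,
        ((-1 : F) ^ ((((i + 1 : ℕ) : ℤ) - 1) + (((M + 1 : ℕ) : ℤ) - ((i + 1 : ℕ) : ℤ) - 1) *
            ∑ l ∈ Finset.range (i + 1), k l)) •
          (componentOfList hU (i + 1) (fun l => a l) *
            componentOfList hU (M + 1 - (i + 1)) (fun l => a (i + 1 + l))) =
        B.parity (U (initial c (i + 1))) *
          U (initial (fun l => c (i + 1 + l)) (M + 1 - (i + 1))) := by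
      intro i hi
      rw [Finset.mem_range] at hi
      have hmem := componentOfList_mem hU hdeg (i + 1) (fun l => k l) (fun l => a l) (fun l => ha l)
      rw [Fin.sum_univ_eq_sum_range] at hmem
      -- Inside the longer list each entry of the first factor carries `M - i` involutions more than
      -- the component of arity `i + 1` does, independently of its position.
      have f1 : U (initial c (i + 1)) = ((-1 : F) ^ (∑ l ∈ Finset.range (i + 1), k l * (M - i : ℕ))) •
          componentOfList hU (i + 1) (fun l => a l) := by
        rw [componentOfList_apply, ← prod_neg_one_zpow, ← hU.initial_smul]
        congr 1
        refine initial_congr fun l hl => ?_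
        rw [hc, ← parity_pow_of_mem (parity_pow_mem (ha l) _), ← Module.End.mul_apply, ← pow_add,
          show M - i + (i + 1 - 1 - l) = M - l by omega]
      have f2 : componentOfList hU (M + 1 - (i + 1)) (fun l => a (i + 1 + l)) =
          U (initial (fun l => c (i + 1 + l)) (M + 1 - (i + 1))) := by
        rw [componentOfList_apply hU _ (fun l => a (i + 1 + l))]
        congr 1
        refine initial_congr fun l hl => ?_
        rw [hc, show M + 1 - (i + 1) - 1 - l = M - (i + 1 + l) by omega]
      rw [f1, f2, map_smul, parity_of_mem hmem, smul_smul, smul_mul_assoc, ← zpow_add₀ (by simp)]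
      congr 1
      apply neg_one_zpow_congr
      rw [← Finset.sum_mul, Nat.cast_sub hi.le]
      push_cast
      generalize ∑ l ∈ Finset.range (i + 1), k l = s
      exact ⟨i - s, by ring⟩
    have e4 : ∑ i ∈ Finset.Ico 1 (M + 1),
        ((-1 : F) ^ (((i : ℤ) - 1) + (((M + 1 : ℕ) : ℤ) - i - 1) * ∑ l ∈ Finset.range i, k l)) •
          (componentOfList hU i (fun l => a l) *
            componentOfList hU (M + 1 - i) (fun l => a (i + l))) =
        ∑ i ∈ Finset.range M, B.parity (U (initial c (i + 1))) *
          U (initial (fun l => c (i + 1 + l)) (M + 1 - (i + 1))) := by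
      rw [Finset.sum_Ico_eq_sum_range, Nat.add_sub_cancel]
      exact Finset.sum_congr rfl fun i hi => by
        rw [Nat.add_comm 1 i]
        exact e3 i hi
    rw [e0, Finset.sum_congr rfl e1, Nat.add_sub_cancel, Finset.sum_congr rfl e2, e4]
    rw [← sub_eq_zero, ← neg_eq_zero]
    refine Eq.trans ?_ h
    abel

lemma linearPart_ofList {U : List A → B} (hU : IsMl F U) (hdeg : HasDeg A.deg B.deg U 1)
    (hnil : U [] = 0) (heq : ∀ l, B.d (U l) - ins A.d A.twist l U - quad U l = 0) (x : A) :
    (ofList hU hdeg hnil heq).linearPart x = U [x] := by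
  change componentOfList hU 1 (fun _ => x) = _
  rw [componentOfList_apply hU 1 (fun _ => x), initial_succ, initial_zero]
  simp

end AInftyHom

/-! ### The exponential of a coderivation. -/

namespace ListCochain

section Exp

variable {F : Type*} [Field F] {H : Type*} [Ring H] [Algebra F H]

/-- The graded pieces of the exponential of the coderivation determined by `w`, followed by the
projection onto lists of length one. -/
def expPiece (w : H →ₗ[F] H →ₗ[F] H) : ℕ → List H → H
  | 0 => fun l => match l with
    | [a] => a
    | _ => 0
  | k + 1 => fun l => ((k + 1 : F)⁻¹) • mulIns w LinearMap.id l (expPiece w k)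

/-- The exponential of the coderivation determined by `w`, followed by the projection onto lists of
length one. -/
def expMap (w : H →ₗ[F] H →ₗ[F] H) (l : List H) : H := expPiece w (l.length - 1) l

variable (w : H →ₗ[F] H →ₗ[F] H)

@[simp] lemma expMap_nil : expMap w [] = 0 := rfl

@[simp] lemma expMap_single (a : H) : expMap w [a] = a := rfl

@[simp] lemma expMap_pair (a b : H) : expMap w [a, b] = w a b := by
  simp [expMap, expPiece]

lemma isMl_expPiece (k : ℕ) : IsMl F (expPiece w k) := by
  induction k with
  | zero =>
    refine IsMl.of_cons (fun l => ?_) (fun a => ?_)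
    · cases l with
      | nil => exact ⟨fun _ _ => rfl, fun _ _ => rfl⟩
      | cons b l => exact ⟨fun _ _ => (add_zero 0).symm, fun _ _ => (smul_zero _).symm⟩
    · rintro (_ | ⟨b, l₁⟩) l₂ <;>
        exact ⟨fun _ _ => (add_zero 0).symm, fun _ _ => (smul_zero _).symm⟩
  | succ k ih => exact (ih.mulIns w LinearMap.id).comp (((k + 1 : F)⁻¹) • LinearMap.id)

lemma isMl_expMap : IsMl F (expMap w) := by
  intro l₁ l₂
  have h : ∀ x, expMap w (l₁ ++ x :: l₂) = expPiece w (l₁.length + l₂.length) (l₁ ++ x :: l₂) := by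
    intro x
    rw [expMap]
    congr 1
    simp
  simp only [h]
  exact isMl_expPiece w _ l₁ l₂

lemma hasDeg_expPiece {𝒜 : ℤ → Submodule F H}
    (hw : ∀ k l, ∀ x ∈ 𝒜 k, ∀ y ∈ 𝒜 l, w x y ∈ 𝒜 (k + l + -1)) (k : ℕ) :
    HasDeg 𝒜 𝒜 (expPiece w k) 1 := by
  induction k with
  | zero =>
    intro l ks h
    match l, ks, h with
    | [], _, _ => exact zero_mem _
    | [a], _, .cons ha .nil =>
      change a ∈ _
      simpa using ha
    | _ :: _ :: _, _, _ => exact zero_mem _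
  | succ k ih =>
    intro l ks h
    have := ih.mulIns hw (v := LinearMap.id) (fun _ _ hx => hx) l ks h
    exact Submodule.smul_mem _ _ (by simpa using this)

lemma hasDeg_expMap {𝒜 : ℤ → Submodule F H}
    (hw : ∀ k l, ∀ x ∈ 𝒜 k, ∀ y ∈ 𝒜 l, w x y ∈ 𝒜 (k + l + -1)) : HasDeg 𝒜 𝒜 (expMap w) 1 :=
  fun l => hasDeg_expPiece w hw _ l

/-- The threshold `j` is needed because the exponential is not zero on the list consisting of the
unit alone. -/
lemma mulIns_eq_zero_of_mem {e : H} (h1 : ∀ x, w e x = 0) (h2 : ∀ x, w x e = 0) {U : List H → H}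
    (hU : IsMl F U) {j : ℕ} (h : ∀ m, j ≤ m.length → e ∈ m → U m = 0) {l : List H}
    (hl : j + 1 ≤ l.length) (hel : e ∈ l) : mulIns w LinearMap.id l U = 0 := by
  induction l generalizing U j with
  | nil => simp
  | cons a l ih =>
    cases l with
    | nil => simp
    | cons c l =>
      rw [List.length_cons, List.length_cons] at hl
      have hhead : U (w a c :: l) = 0 := by
        by_cases ha : e = a
        · rw [← ha, h1, hU.cons_zero]
        · by_cases hc : e = c
          · rw [← hc, h2, hU.cons_zero]
          · exact h _ (by simp; omega) (by simp_all)
      rw [mulIns_cons, mulHead_cons, hhead, zero_add]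
      by_cases hc : e ∈ c :: l
      · cases j with
        | zero =>
          exact ih (U := fun m => U (a :: m)) (hU.tail a) (j := 0)
            (fun m _ hm => h _ (by simp) (by simp [hm])) (by simp) hc
        | succ j =>
          exact ih (U := fun m => U (a :: m)) (hU.tail a) (j := j)
            (fun m hj hm => h _ (by simpa using hj) (by simp [hm])) (by simp; omega) hc
      · obtain rfl : e = a := by simpa [hc] using hel
        refine mulIns_eq_zero _ _ fun m hm => ?_
        rw [List.length_cons] at hm
        exact h _ (by simp; omega) (by simp)

lemma expMap_unit (h1 : ∀ x, w 1 x = 0) (h2 : ∀ x, w x 1 = 0) (l : List H) (hl : 2 ≤ l.length)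
    (h : 1 ∈ l) : expMap w l = 0 := by
  have key : ∀ k, ∀ m : List H, 2 ≤ m.length → 1 ∈ m → expPiece w k m = 0 := by
    intro k
    induction k with
    | zero =>
      intro m hm _
      match m, hm with
      | _ :: _ :: _, _ => rfl
    | succ k ih =>
      intro m hm h
      change _ • mulIns w LinearMap.id m (expPiece w k) = 0
      by_cases h3 : 3 ≤ m.length
      · rw [mulIns_eq_zero_of_mem w h1 h2 (isMl_expPiece w k) ih h3 h, smul_zero]
      · obtain ⟨a, b, rfl⟩ := List.length_eq_two.1 (show m.length = 2 by omega)
        have : w a b = 0 := by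
          rcases List.mem_pair.1 h with rfl | rfl
          · exact h1 _
          · exact h2 _
        simp [this, (isMl_expPiece w k).cons_zero]
  exact key _ l hl h

/-- The exponential takes values in the kernel of every functional that vanishes on `w`. -/
lemma expMap_functional {J : H →ₗ[F] F} (hJ : ∀ x y, J (w x y) = 0) (l : List H)
    (hl : 2 ≤ l.length) : J (expMap w l) = 0 := by
  have key : ∀ k, ∀ m : List H, J (expPiece w (k + 1) m) = 0 := by
    intro k
    induction k with
    | zero =>
      intro m
      rw [expPiece, map_smul]
      match m with
      | [] => simp
      | [a] => simp
      | [a, b] => simp [expPiece, hJ]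
      | a :: b :: c :: m =>
        rw [mulIns_eq_zero, map_zero, smul_zero]
        intro m' hm'
        match m', hm' with
        | _ :: _ :: _, _ => rfl
    | succ k ih =>
      intro m
      rw [expPiece, map_smul, ← mulIns_comp, mulIns_eq_zero _ _ (fun m' _ => ih m'), smul_zero]
  rw [expMap, show l.length - 1 = l.length - 2 + 1 by omega]
  exact key _ l

/-- The piece of arity `N` is `w` iterated `N - 1` times, divided by `(N-1)!`. Applying the
coderivation once more to the piece of arity `N - 1` therefore gives `N - 1` times the piece of
arity `N`. -/
lemma mulIns_expMap [CharZero F] (l : List H) :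
    mulIns w LinearMap.id l (expMap w) = ((l.length : F) - 1) • expMap w l := by
  match l with
  | [] => simp
  | [a] => simp
  | a :: b :: l =>
    rw [mulIns_congr (V := expPiece w l.length), expMap]
    · have h : ((l.length : F) + 1) ≠ 0 := Nat.cast_add_one_ne_zero _
      simp only [List.length_cons, Nat.add_sub_cancel, expPiece]
      rw [smul_smul]
      push_cast
      rw [add_sub_cancel_right, mul_inv_cancel₀ h, one_smul]
    · intro m hm
      rw [expMap]
      congr 1
      simp at hm
      omega

/-- The exponential of an infinitesimal isometry is an isometry. -/
lemma expMap_isometry [CharZero F] {J : H →ₗ[F] F} {τ : H →ₗ[F] H}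
    (h : ∀ x y z, J (τ (w x y) * z) + J (τ x * w y z) = 0) (l : List H) (hl : 3 ≤ l.length) :
    J (cup (fun m => τ (expMap w m)) (expMap w) l) = 0 := by
  -- The coderivation obeys the Leibniz rule on cup products, and the eigenvalues `i - 1` and `N - i
  -- - 1` of the two factors add up to `N - 2`.
  have key : ∀ l : List H, mulIns w LinearMap.id l (cup (fun m => τ (expMap w m)) (expMap w)) =
      ((l.length : F) - 2) • cup (fun m => τ (expMap w m)) (expMap w) l := by
    intro l
    have e : ∀ m : List H, List.map (LinearMap.id : H →ₗ[F] H) m = m := List.map_id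
    rw [mulIns_cup]
    simp only [mulIns_comp, mulIns_expMap, map_smul, e]
    simp only [cup, Finset.smul_sum]
    rw [← Finset.sum_add_distrib]
    refine Finset.sum_congr rfl fun i hi => ?_
    rw [Finset.mem_range] at hi
    rw [smul_mul_assoc, mul_smul_comm, ← add_smul, List.length_take, List.length_drop,
      Nat.min_eq_left (by omega), Nat.cast_sub (by omega)]
    congr 1
    ring
  induction hk : l.length generalizing l with
  | zero => omega
  | succ k ih =>
    -- The eigenvalue is nonzero beyond arity 2, so the vanishing on lists one shorter propagates;
    -- it starts in arity 3 with the hypothesis on `w`.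
    have hne : (l.length : F) - 2 ≠ 0 := by
      rw [sub_ne_zero]
      exact_mod_cast (show l.length ≠ 2 by omega)
    have h1 := congrArg J (key l)
    rw [map_smul, ← mulIns_comp] at h1
    refine (smul_eq_zero.1 (h1.symm.trans ?_)).resolve_left hne
    by_cases h3 : l.length = 3
    · obtain ⟨x, y, z, rfl⟩ := List.length_eq_three.1 h3
      simpa using h x y z
    · exact mulIns_eq_zero _ _ fun m hm => ih m (by omega) (by omega)

end Exp

end ListCochain

/-! ### The morphism determined by a cyclic cochain. -/

namespace PoincareDGCA.HodgeDecomposition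

variable {F : Type*} [Field F] [CharZero F] {n n' : ℕ} {A : PoincareDGCA F n}
  {B : PoincareDGCA F n'} (D : A.HodgeDecomposition) (D' : B.HodgeDecomposition)

/-- An isomorphism of cohomology algebras that is compatible with the classes of `μ₃` by means of a
normalized cyclic cochain `g` is induced by an `A_∞`-morphism. -/
theorem exists_aInftyHom {r : ℕ} (hr : 1 < r) (hn' : n' + 3 ≤ 5 * r)
    (connA : A.IsConnectedUpTo (r - 1)) (connB : B.IsConnectedUpTo (r - 1))
    {φ : A.Cohomology ≃ₐ[F] B.Cohomology}
    (hφ : ∀ k, ∀ α ∈ A.cohDeg k, φ α ∈ B.cohDeg k)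
    (hint : ∃ c : F, ∀ α, B.int (φ α) = c * A.int α)
    (g : A.Cohomology →ₗ[F] A.Cohomology →ₗ[F] A.Cohomology)
    (hdeg : ∀ k l, ∀ α ∈ A.cohDeg k, ∀ β ∈ A.cohDeg l, g α β ∈ A.cohDeg (k + l - 1))
    (h1 : ∀ α, g 1 α = 0) (h1' : ∀ α, g α 1 = 0) (hint0 : ∀ α β, A.int (g α β) = 0)
    (hcyc : ∀ α β γ, A.int (g α β * γ) = A.int (A.cohParity α * g β γ))
    (hμ : ∀ α β γ, φ (D.mu3 ![α, β, γ]) - D'.mu3 ![φ α, φ β, φ γ] =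
      φ (A.cohParity α * g β γ - g (α * β) γ + g α (β * γ) - g α β * γ)) :
    ∃ f : AInftyHom A.toDGCA B.toDGCA, ∀ x, D'.harmClass (f.linearPart x) = φ (D.harmClass x) := by
  have hφp : ∀ α, φ (A.cohParity α) = B.cohParity (φ α) := fun α => by
    refine coh_linear_ext (f := φ.toLinearMap ∘ₗ A.cohParity) (g := B.cohParity ∘ₗ φ.toLinearMap)
      ?_ α
    intro k α hα
    simp [cohParity_of_mem hα, cohParity_of_mem (hφ k α hα)]
  have hgp : ∀ α β, A.cohParity (g α β) = -g (A.cohParity α) (A.cohParity β) := fun α β => by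
    refine coh_linear_ext (f := A.cohParity ∘ₗ g.flip β)
      (g := -(g.flip (A.cohParity β) ∘ₗ A.cohParity)) ?_ α
    intro k α hα
    refine coh_linear_ext (f := A.cohParity ∘ₗ g α)
      (g := -(g (A.cohParity α) ∘ₗ A.cohParity)) ?_ β
    intro l β hβ
    simp only [LinearMap.comp_apply, LinearMap.neg_apply, cohParity_of_mem hα, cohParity_of_mem hβ,
      cohParity_of_mem (hdeg k l α hα β hβ), map_smul, LinearMap.smul_apply, smul_smul]
    rw [zpow_sub₀ (by simp), zpow_add₀ (by simp), mul_comm]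
    simp [div_neg]
  -- After suspension `w` has degree zero, so its coderivation carries no signs and can be
  -- exponentiated.
  set w : A.Cohomology →ₗ[F] A.Cohomology →ₗ[F] A.Cohomology := g ∘ₗ A.cohParity with hw
  have hwdeg : ∀ k l, ∀ x ∈ A.cohDeg k, ∀ y ∈ A.cohDeg l, w x y ∈ A.cohDeg (k + l + -1) :=
    fun k l x hx y hy => hdeg k l _ (cohParity_mem hx) y hy
  set σ : List A.Cohomology → B.Cohomology := fun l => φ (expMap w l) with hσdef
  have hσ : IsModel σ :=
    { ml := (isMl_expMap w).comp φ.toLinearMap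
      deg := by
        have := (hasDeg_expMap w hwdeg).comp (q := φ) (𝒩 := B.cohDeg) (δ := 0)
          (fun k x hx => by rw [add_zero]; exact hφ k x hx)
        simpa using this
      nil := by simp [σ]
      one := by simp [σ]
      unit := fun l hl h => by
        rw [hσdef]
        beta_reduce
        rw [expMap_unit w (fun x => by simp [w, cohParity_one, h1]) (fun x => by simp [w, h1']) l hl h,
          map_zero] }
  have hσ1 : ∀ α, σ [α] = φ α := fun α => by simp [σ]
  have hN := isNormalized_extension D D' hσ
  obtain ⟨c, hc⟩ := hint
  have hobs := harmClass_quad_eq_zero D D' hσ hr hn' connA connB hσ1 hφp ⟨c, hc⟩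
    (fun l hl => by
      rw [hσdef]
      beta_reduce
      rw [hc, expMap_functional w (fun x y => hint0 _ _) l hl, mul_zero])
    (fun l hl => by
      have e : cup (fun m => B.cohParity (σ m)) σ l =
          φ (cup (fun m => A.cohParity (expMap w m)) (expMap w) l) := by
        simp only [hσdef, ← hφp]
        exact cup_ringHom _ _ (φ : A.Cohomology →+* B.Cohomology) l
      rw [e, hc, expMap_isometry w (J := A.int) (τ := A.cohParity) ?_ l hl, mul_zero]
      intro x y z
      simp only [hw, LinearMap.comp_apply, hgp, cohParity_cohParity, neg_mul, map_neg, hcyc]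
      exact neg_add_cancel _)
    -- The arity 3 obstruction contains `μ₃` with the sign involution on the middle argument, hence
    -- the instance of `hμ` at `cohParity β`.
    (fun α β γ => by
      have := hμ α (A.cohParity β) γ
      rw [sub_eq_iff_eq_add] at this
      rw [this]
      simp only [σ, expMap_pair, hw, LinearMap.comp_apply, cohParity_mul, cohParity_cohParity,
        ← hφp, hgp]
      simp only [map_sub, map_add, map_neg, map_mul, neg_mul]
      abel)
  refine ⟨AInftyHom.ofList hN.ml hN.deg hN.nil (extension_equation D D' hσ hobs), fun x => ?_⟩
  rw [AInftyHom.linearPart_ofList, extension_single D D' hσ, hσ1, harmClass_splitting]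

end PoincareDGCA.HodgeDecomposition

/-! ### Making the bounding cochain cyclic. -/

namespace DGCA

variable {F : Type*} [Field F] {A : DGCA F}

/-- The Hochschild differential of a bilinear map of degree `-1`. -/
noncomputable def hochDiff (g : A.Cohomology →ₗ[F] A.Cohomology →ₗ[F] A.Cohomology)
    (α β γ : A.Cohomology) : A.Cohomology :=
  A.cohParity α * g β γ - g (α * β) γ + g α (β * γ) - g α β * γ

/-- The bilinear map `(α, β) ↦ (-1)^{|α| |β|} g(β, α)`. -/
noncomputable def koszulFlip (g : A.Cohomology →ₗ[F] A.Cohomology →ₗ[F] A.Cohomology) :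
    A.Cohomology →ₗ[F] A.Cohomology →ₗ[F] A.Cohomology :=
  -- The sign `(-1)^{kl}` equals `(1 + ε + η - εη)/2` with `ε = (-1)^k` and `η = (-1)^l`, which
  -- makes the signed flip an honest bilinear map.
  (2⁻¹ : F) • (g.flip + g.flip ∘ₗ A.cohParity + (g ∘ₗ A.cohParity).flip
    - (g ∘ₗ A.cohParity).flip ∘ₗ A.cohParity)

lemma koszulFlip_apply [CharZero F] (g : A.Cohomology →ₗ[F] A.Cohomology →ₗ[F] A.Cohomology)
    {k l : ℤ} {α β : A.Cohomology} (hα : α ∈ A.cohDeg k) (hβ : β ∈ A.cohDeg l) :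
    koszulFlip g α β = ((-1 : F) ^ (k * l)) • g β α := by
  have h2 : (2 : F) ≠ 0 := two_ne_zero
  simp only [koszulFlip, LinearMap.smul_apply, LinearMap.sub_apply, LinearMap.add_apply,
    LinearMap.comp_apply, LinearMap.flip_apply, cohParity_of_mem hα, cohParity_of_mem hβ, map_smul,
    LinearMap.smul_apply]
  rcases Int.even_or_odd k with hk | hk
  · rw [hk.neg_one_zpow, (hk.mul_right l).neg_one_zpow]
    simp only [one_smul]
    rw [inv_smul_eq_iff₀ h2, two_smul]
    abel
  · rcases Int.even_or_odd l with hl | hl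
    · rw [hl.neg_one_zpow, (hl.mul_left k).neg_one_zpow]
      simp only [one_smul]
      rw [inv_smul_eq_iff₀ h2, two_smul]
      abel
    · rw [hk.neg_one_zpow, hl.neg_one_zpow, (hk.mul hl).neg_one_zpow]
      simp only [neg_smul, one_smul]
      rw [inv_smul_eq_iff₀ h2, two_smul]
      abel

lemma hochDiff_add_left (g : A.Cohomology →ₗ[F] A.Cohomology →ₗ[F] A.Cohomology)
    (α α' β γ : A.Cohomology) :
    hochDiff g (α + α') β γ = hochDiff g α β γ + hochDiff g α' β γ := by
  simp only [hochDiff, map_add, add_mul, LinearMap.add_apply]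
  abel

lemma hochDiff_add_mid (g : A.Cohomology →ₗ[F] A.Cohomology →ₗ[F] A.Cohomology)
    (α β β' γ : A.Cohomology) :
    hochDiff g α (β + β') γ = hochDiff g α β γ + hochDiff g α β' γ := by
  simp only [hochDiff, map_add, mul_add, add_mul, LinearMap.add_apply]
  abel

lemma hochDiff_add_right (g : A.Cohomology →ₗ[F] A.Cohomology →ₗ[F] A.Cohomology)
    (α β γ γ' : A.Cohomology) :
    hochDiff g α β (γ + γ') = hochDiff g α β γ + hochDiff g α β γ' := by
  simp only [hochDiff, map_add, mul_add]
  abel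

lemma hochDiff_ext {g g' : A.Cohomology →ₗ[F] A.Cohomology →ₗ[F] A.Cohomology}
    (h : ∀ i j k, ∀ α ∈ A.cohDeg i, ∀ β ∈ A.cohDeg j, ∀ γ ∈ A.cohDeg k,
      hochDiff g α β γ = hochDiff g' α β γ) (α β γ : A.Cohomology) :
    hochDiff g α β γ = hochDiff g' α β γ := by
  refine coh_induction (P := fun α => hochDiff g α β γ = hochDiff g' α β γ) (by simp [hochDiff]) ?_
    (fun α α' h1 h2 => by rw [hochDiff_add_left, hochDiff_add_left, h1, h2]) α
  intro i α hα
  refine coh_induction (P := fun β => hochDiff g α β γ = hochDiff g' α β γ) (by simp [hochDiff]) ?_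
    (fun β β' h1 h2 => by rw [hochDiff_add_mid, hochDiff_add_mid, h1, h2]) β
  intro j β hβ
  exact coh_induction (P := fun γ => hochDiff g α β γ = hochDiff g' α β γ) (by simp [hochDiff])
    (fun k γ hγ => h i j k α hα β hβ γ hγ)
    (fun γ γ' h1 h2 => by rw [hochDiff_add_right, hochDiff_add_right, h1, h2]) γ

/-- In a graded commutative algebra, reversing the arguments permutes the four terms of the
differential: the outer ones are exchanged, the inner ones are exchanged, and each exchange changes
the sign. -/
lemma hochDiff_koszulFlip [CharZero F]
    {g : A.Cohomology →ₗ[F] A.Cohomology →ₗ[F] A.Cohomology}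
    (hdeg : ∀ k l, ∀ α ∈ A.cohDeg k, ∀ β ∈ A.cohDeg l, g α β ∈ A.cohDeg (k + l - 1)) {i j k : ℤ}
    {α β γ : A.Cohomology} (hα : α ∈ A.cohDeg i) (hβ : β ∈ A.cohDeg j) (hγ : γ ∈ A.cohDeg k) :
    hochDiff (koszulFlip g) α β γ =
      -(((-1 : F) ^ (i * j + j * k + i * k)) • hochDiff g γ β α) := by
  have e1 := coh_graded_comm hα (hdeg k j γ hγ β hβ)
  have e2 := coh_graded_comm (hdeg j i β hβ α hα) hγ
  rw [hochDiff, koszulFlip_apply g hβ hγ, koszulFlip_apply g (mul_mem_cohDeg hα hβ) hγ,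
    koszulFlip_apply g hα (mul_mem_cohDeg hβ hγ), koszulFlip_apply g hα hβ, cohParity_of_mem hα,
    smul_mul_smul_comm, e1, smul_mul_assoc, e2, coh_graded_comm hα hβ, coh_graded_comm hβ hγ,
    hochDiff, cohParity_of_mem hγ]
  simp only [map_smul, LinearMap.smul_apply, smul_mul_assoc, smul_smul, smul_add, smul_sub,
    ← zpow_add₀ (show (-1 : F) ≠ 0 by simp)]
  have f1 : (-1 : F) ^ (i + j * k + i * (k + j - 1)) = (-1) ^ (i * j + j * k + i * k) :=
    neg_one_zpow_congr ⟨0, by ring⟩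
  have f2 : (-1 : F) ^ ((i + j) * k + i * j) = (-1) ^ (i * j + j * k + i * k) :=
    neg_one_zpow_congr ⟨0, by ring⟩
  have f3 : (-1 : F) ^ (i * (j + k) + j * k) = (-1) ^ (i * j + j * k + i * k) :=
    neg_one_zpow_congr ⟨0, by ring⟩
  have f4 : (-1 : F) ^ (i * j + (j + i - 1) * k) = (-1) ^ (i * j + j * k + i * k + k) :=
    neg_one_zpow_congr ⟨-k, by ring⟩
  rw [f1, f2, f3, f4]
  abel

end DGCA

namespace PoincareDGCA

variable {F : Type*} [Field F] {n : ℕ} {A : PoincareDGCA F n}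

/-- Every functional on the cohomology is given by the pairing with a class. -/
lemma exists_dual_map {M : Type*} [AddCommGroup M] [Module F M] (f : M →ₗ[F] A.Cohomology →ₗ[F] F) :
    ∃ G : M →ₗ[F] A.Cohomology, ∀ x β, A.int (G x * β) = f x β := by
  have := A.finite_coh
  let Ψ : A.Cohomology →ₗ[F] A.Cohomology →ₗ[F] F := (LinearMap.mul F A.Cohomology).compr₂ A.int
  have hinj : Function.Injective Ψ := by
    rw [injective_iff_map_eq_zero]
    intro α h
    exact A.nondegenerate α fun β => LinearMap.congr_fun h β
  have hsurj : Function.Surjective Ψ :=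
    (LinearMap.injective_iff_surjective_of_finrank_eq_finrank
      (Subspace.dual_finrank_eq (K := F) (V := A.Cohomology)).symm).1 hinj
  let e := LinearEquiv.ofBijective Ψ ⟨hinj, hsurj⟩
  exact ⟨e.symm.toLinearMap ∘ₗ f, fun x β =>
    LinearMap.congr_fun (e.apply_symm_apply (f x)) β⟩

namespace HodgeDecomposition

variable (D : A.HodgeDecomposition)

/-- The projection of the cohomology onto its component of degree `k`. -/
noncomputable def cohProj (k : ℤ) : A.Cohomology →ₗ[F] A.Cohomology :=
  D.harmClass ∘ₗ A.proj k ∘ₗ D.splitting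

lemma cohProj_mem (k : ℤ) (α : A.Cohomology) : D.cohProj k α ∈ A.cohDeg k :=
  D.harmClass_mem_deg (proj_mem _ _)

lemma cohProj_of_mem {k : ℤ} {α : A.Cohomology} (hα : α ∈ A.cohDeg k) : D.cohProj k α = α := by
  simp [cohProj, proj_of_mem (D.splitting_mem_deg hα), harmClass_splitting]

lemma cohProj_of_mem_ne {k l : ℤ} {α : A.Cohomology} (hα : α ∈ A.cohDeg k) (h : k ≠ l) :
    D.cohProj l α = 0 := by
  simp [cohProj, proj_of_mem_ne (D.splitting_mem_deg hα) h]

/-- Nondegeneracy: the class and its component of degree `m` have the same pairings. Maps obtained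
by duality are seen to be homogeneous in this way. -/
lemma mem_cohDeg_of_int (D : A.HodgeDecomposition) {m : ℤ} {x : A.Cohomology}
    (h : ∀ j, j ≠ n - m → ∀ β ∈ A.cohDeg j, A.int (x * β) = 0) : x ∈ A.cohDeg m := by
  suffices hx : x - D.cohProj m x = 0 by
    rw [sub_eq_zero] at hx
    rw [hx]
    exact D.cohProj_mem m x
  refine eq_zero_of_hom fun j β hβ => ?_
  rw [sub_mul, map_sub, sub_eq_zero]
  by_cases hj : j = n - m
  · refine coh_linear_ext (f := A.int ∘ₗ LinearMap.mulRight F β)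
      (g := A.int ∘ₗ LinearMap.mulRight F β ∘ₗ D.cohProj m) ?_ x
    intro k α hα
    by_cases hk : k = m
    · subst hk
      simp [D.cohProj_of_mem hα]
    · simp [D.cohProj_of_mem_ne hα hk,
        A.int_eq_zero (k + j) (by omega) _ (mul_mem_cohDeg hα hβ)]
  · rw [h j hj β hβ, A.int_eq_zero (m + j) (by omega) _ (mul_mem_cohDeg (D.cohProj_mem m x) hβ)]

/-- A product with the unit is already harmonic, so `d⁻` kills it. Only the values with two adjacent
units are needed to normalize bounding cochains. -/
lemma mu3_one_one (γ : A.Cohomology) : D.mu3 ![1, 1, γ] = 0 := by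
  simp [mu3_apply, tri, splitting_one, dInv_splitting, dInv_one, parity_one]

lemma mu3_one_one' (α : A.Cohomology) : D.mu3 ![α, 1, 1] = 0 := by
  simp [mu3_apply, tri, splitting_one, dInv_splitting, dInv_one]

/-- Both terms are products of a harmonic element with an element of `ℬ`. -/
lemma int_mu3 (α β γ : A.Cohomology) : A.int (D.mu3 ![α, β, γ]) = 0 := by
  rw [mu3_apply, tri, map_sub, map_sub,
    D.int_harmClass_mul' (D.dInv_mem _) (Submodule.mem_sup_left (D.splitting_mem _)),
    D.int_harmClass_mul (Submodule.mem_sup_left (D.parity_mem_harm (D.splitting_mem _)))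
      (D.dInv_mem _), sub_zero]

/-- Graded commutativity moves each term of one side to the other term of the other side. -/
lemma mu3_reverse {i j k : ℤ} {α β γ : A.Cohomology} (hα : α ∈ A.cohDeg i) (hβ : β ∈ A.cohDeg j)
    (hγ : γ ∈ A.cohDeg k) :
    D.mu3 ![γ, β, α] = -(((-1 : F) ^ (i * j + j * k + i * k)) • D.mu3 ![α, β, γ]) := by
  have hx := D.splitting_mem_deg hα
  have hy := D.splitting_mem_deg hβ
  have hz := D.splitting_mem_deg hγ
  rw [mu3_apply, mu3_apply, ← map_smul, ← map_neg]
  congr 1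
  change D.tri (D.splitting γ) (D.splitting β) (D.splitting α) =
    -(((-1 : F) ^ (i * j + j * k + i * k)) • D.tri (D.splitting α) (D.splitting β) (D.splitting γ))
  generalize D.splitting α = x at *
  generalize D.splitting β = y at *
  generalize D.splitting γ = z at *
  have e1 := A.graded_comm _ _ _ _ (D.dInv_mem_deg (SetLike.mul_mem_graded hy hz)) hx
  have e2 := A.graded_comm _ _ _ _ hz (D.dInv_mem_deg (SetLike.mul_mem_graded hx hy))
  rw [tri, A.graded_comm k j z y hz hy, A.graded_comm j i y x hy hx, parity_of_mem hz, map_smul,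
    map_smul, smul_mul_assoc, e1, smul_mul_smul_comm, e2, tri, parity_of_mem hx]
  simp only [smul_smul, smul_sub, smul_mul_assoc, ← zpow_add₀ (show (-1 : F) ≠ 0 by simp)]
  have f1 : (-1 : F) ^ (k * j + (j + k - 1) * i) = (-1) ^ (i * j + j * k + i * k + i) :=
    neg_one_zpow_congr ⟨-i, by ring⟩
  have f2 : (-1 : F) ^ (k + j * i + k * (i + j - 1)) = (-1) ^ (i * j + j * k + i * k) :=
    neg_one_zpow_congr ⟨0, by ring⟩
  rw [f1, f2]
  abel

/-- A bilinear map whose Hochschild differential is normalized, reverses its sign under reversal of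
the arguments and has no component in the top degree can be changed by a Hochschild cocycle into a
normalized cyclic one without component in the top degree. -/
lemma exists_cyclic_cochain (D : A.HodgeDecomposition) [CharZero F]
    {T : A.Cohomology → A.Cohomology → A.Cohomology → A.Cohomology}
    {g : A.Cohomology →ₗ[F] A.Cohomology →ₗ[F] A.Cohomology}
    (hdeg : ∀ k l, ∀ α ∈ A.cohDeg k, ∀ β ∈ A.cohDeg l, g α β ∈ A.cohDeg (k + l - 1))
    (hT : ∀ α β γ, T α β γ = hochDiff g α β γ) (hT1 : ∀ γ, T 1 1 γ = 0) (hT1' : ∀ α, T α 1 1 = 0)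
    (hTint : ∀ α β γ, A.int (T α β γ) = 0)
    (hTrev : ∀ i j k, ∀ α ∈ A.cohDeg i, ∀ β ∈ A.cohDeg j, ∀ γ ∈ A.cohDeg k,
      T γ β α = -(((-1 : F) ^ (i * j + j * k + i * k)) • T α β γ)) :
    ∃ g' : A.Cohomology →ₗ[F] A.Cohomology →ₗ[F] A.Cohomology,
      (∀ k l, ∀ α ∈ A.cohDeg k, ∀ β ∈ A.cohDeg l, g' α β ∈ A.cohDeg (k + l - 1)) ∧
      (∀ α, g' 1 α = 0) ∧ (∀ α, g' α 1 = 0) ∧ (∀ α β, A.int (g' α β) = 0) ∧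
      (∀ α β γ, A.int (g' α β * γ) = A.int (A.cohParity α * g' β γ)) ∧
      (∀ α β γ, T α β γ = hochDiff g' α β γ) := by
  have h2 : (2 : F) ≠ 0 := two_ne_zero
  -- The value at `(1, 1)` has degree `-1`, hence vanishes. The differential at `(1, 1, α)` is then
  -- `f(1, α)`, and at `(α, 1, 1)` it is `-f(α, 1)`.
  have hunit : ∀ f : A.Cohomology →ₗ[F] A.Cohomology →ₗ[F] A.Cohomology,
      (∀ k l, ∀ α ∈ A.cohDeg k, ∀ β ∈ A.cohDeg l, f α β ∈ A.cohDeg (k + l - 1)) →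
      (∀ α β γ, T α β γ = hochDiff f α β γ) → (∀ α, f 1 α = 0) ∧ ∀ α, f α 1 = 0 := by
    intro f hf hTf
    have h11 : f 1 1 = 0 := by
      have := hf 0 0 1 one_mem_cohDeg 1 one_mem_cohDeg
      rwa [cohDeg_eq_bot (Or.inl (by norm_num)), Submodule.mem_bot] at this
    refine ⟨fun α => ?_, fun α => ?_⟩
    · have := hTf 1 1 α
      simpa [hT1, hochDiff, cohParity_one, h11] using this.symm
    · have := hTf α 1 1
      simpa [hT1', hochDiff, h11] using this.symm
  -- Averaging with the signed flip keeps the differential, because `T` and the differential behave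
  -- alike under reversal.
  set s : A.Cohomology →ₗ[F] A.Cohomology →ₗ[F] A.Cohomology :=
    (2⁻¹ : F) • (g + koszulFlip g) with hs
  have hsdeg : ∀ k l, ∀ α ∈ A.cohDeg k, ∀ β ∈ A.cohDeg l, s α β ∈ A.cohDeg (k + l - 1) := by
    intro k l α hα β hβ
    refine Submodule.smul_mem _ _ (add_mem (hdeg k l α hα β hβ) ?_)
    rw [koszulFlip_apply g hα hβ, add_comm k l]
    exact Submodule.smul_mem _ _ (hdeg l k β hβ α hα)
  have hflip : ∀ α β γ, hochDiff (koszulFlip g) α β γ = hochDiff g α β γ := by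
    refine hochDiff_ext fun i j k α hα β hβ γ hγ => ?_
    rw [hochDiff_koszulFlip hdeg hα hβ hγ, ← hT, ← hT, hTrev i j k α hα β hβ γ hγ, smul_neg, neg_neg,
      smul_smul, ← mul_zpow]
    simp
  have hsT : ∀ α β γ, T α β γ = hochDiff s α β γ := by
    intro α β γ
    have e : hochDiff s α β γ = (2⁻¹ : F) • (hochDiff g α β γ + hochDiff (koszulFlip g) α β γ) := by
      simp only [hochDiff, hs, LinearMap.smul_apply, LinearMap.add_apply, mul_smul_comm,
        smul_mul_assoc, mul_add, add_mul, smul_add, smul_sub]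
      abel
    rw [e, hflip, ← hT, eq_comm, inv_smul_eq_iff₀ h2, two_smul]
  obtain ⟨hs1, hs1'⟩ := hunit s hsdeg hsT
  have hssymm : ∀ k l, ∀ α ∈ A.cohDeg k, ∀ β ∈ A.cohDeg l,
      s α β = ((-1 : F) ^ (k * l)) • s β α := by
    intro k l α hα β hβ
    simp only [hs, LinearMap.smul_apply, LinearMap.add_apply, koszulFlip_apply g hα hβ,
      koszulFlip_apply g hβ hα, smul_add, smul_smul]
    have e : (-1 : F) ^ (k * l) * (2⁻¹ * (-1) ^ (k * l)) = 2⁻¹ := by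
      rw [mul_left_comm, ← mul_zpow]
      simp
    rw [mul_comm l k, e, add_comm, mul_comm]
  -- Half of the integral of `s` is represented by the pairing with `G`. Subtracting the Hochschild
  -- coboundary of `G` leaves the differential of `s` unchanged.
  obtain ⟨G, hG⟩ := exists_dual_map ((2⁻¹ : F) • s.compr₂ A.int)
  have hG' : ∀ α β, A.int (G α * β) = 2⁻¹ * A.int (s α β) := hG
  have hGdeg : ∀ k, ∀ α ∈ A.cohDeg k, G α ∈ A.cohDeg (k - 1) := by
    intro k α hα
    refine D.mem_cohDeg_of_int fun j hj β hβ => ?_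
    rw [hG', A.int_eq_zero _ (by omega) _ (hsdeg k j α hα β hβ), mul_zero]
  set g' : A.Cohomology →ₗ[F] A.Cohomology →ₗ[F] A.Cohomology :=
    s - ((LinearMap.mul F A.Cohomology ∘ₗ A.cohParity).compl₂ G - (LinearMap.mul F A.Cohomology).compr₂ G
      + LinearMap.mul F A.Cohomology ∘ₗ G) with hg'
  have hg'a : ∀ α β, g' α β = s α β - (A.cohParity α * G β - G (α * β) + G α * β) :=
    fun α β => rfl
  have hg'deg : ∀ k l, ∀ α ∈ A.cohDeg k, ∀ β ∈ A.cohDeg l, g' α β ∈ A.cohDeg (k + l - 1) := by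
    intro k l α hα β hβ
    rw [hg'a]
    refine sub_mem (hsdeg k l α hα β hβ) (add_mem (sub_mem ?_ ?_) ?_)
    · rw [add_sub_assoc]
      exact mul_mem_cohDeg (cohParity_mem hα) (hGdeg l β hβ)
    · exact hGdeg _ _ (mul_mem_cohDeg hα hβ)
    · rw [add_sub_right_comm]
      exact mul_mem_cohDeg (hGdeg k α hα) hβ
  have hg'T : ∀ α β γ, T α β γ = hochDiff g' α β γ := by
    intro α β γ
    rw [hsT, hochDiff, hochDiff]
    simp only [hg'a, cohParity_mul, mul_sub, sub_mul, mul_add, add_mul, mul_assoc]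
    abel
  obtain ⟨hg1, hg1'⟩ := hunit g' hg'deg hg'T
  have hg'int : ∀ α β, A.int (g' α β) = 0 := by
    intro α β
    refine coh_linear_ext (f := A.int ∘ₗ g'.flip β) (g := 0) ?_ α
    intro k α hα
    refine coh_linear_ext (f := A.int ∘ₗ g' α) (g := 0) ?_ β
    intro l β hβ
    -- In the coboundary of `G` the middle term has integral zero because `s` is normalized. The two
    -- outer terms each have integral half of that of `s`, one of them by the symmetry of `s`.
    have e1 : A.int (G (α * β)) = 0 := by
      rw [← mul_one (G (α * β)), hG', hs1', map_zero, mul_zero]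
    have e2 : A.int (A.cohParity α * G β) = 2⁻¹ * A.int (s α β) := by
      rw [cohParity_of_mem hα, smul_mul_assoc, coh_graded_comm hα (hGdeg l β hβ), smul_smul, map_smul,
        hG', hssymm k l α hα β hβ, map_smul, smul_eq_mul, smul_eq_mul, mul_left_comm,
        ← zpow_add₀ (by simp)]
      congr 2
      exact neg_one_zpow_congr ⟨0, by ring⟩
    rw [LinearMap.comp_apply, hg'a, map_sub, map_add, map_sub, e1, e2, hG', LinearMap.zero_apply]
    field_simp
    ring
  refine ⟨g', hg'deg, hg1, hg1', hg'int, fun α β γ => ?_, hg'T⟩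
  -- The two inner terms of the differential have integral zero, so integrating it compares exactly
  -- the outer terms; this is cyclicity.
  have := hTint α β γ
  rw [hg'T, hochDiff, map_sub, map_add, map_sub, hg'int, hg'int, sub_zero, add_zero,
    sub_eq_zero] at this
  exact this.symm

end HodgeDecomposition

end PoincareDGCA

/-! ### Hochschild coboundaries of arity three as differentials of bilinear maps. -/

lemma update_two_one {M : Type*} (a b x : M) :
    Function.update (![a, b] : Fin 2 → M) 1 x = ![a, x] := by
  ext i
  fin_cases i <;> rfl

lemma update_three_one {M : Type*} (a b c x : M) :
    Function.update (![a, b, c] : Fin 3 → M) 1 x = ![a, x, c] := by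
  ext i
  fin_cases i <;> rfl

lemma update_three_two {M : Type*} (a b c x : M) :
    Function.update (![a, b, c] : Fin 3 → M) 2 x = ![a, b, x] := by
  ext i
  fin_cases i <;> rfl

/-- The bilinear map given by a multilinear map in two variables. -/
def MultilinearMap.toBilinear {F M N : Type*} [Field F] [AddCommGroup M] [Module F M]
    [AddCommGroup N] [Module F N] (f : MultilinearMap F (fun _ : Fin 2 => M) N) :
    M →ₗ[F] M →ₗ[F] N :=
  LinearMap.mk₂ F (fun a b => f ![a, b])
    (fun a a' b => f.cons_add ![b] a a') (fun c a b => f.cons_smul ![b] c a)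
    (fun a b b' => by
      have := f.map_update_add ![a, b] 1 b b'
      rwa [update_two_one, update_two_one, update_two_one] at this)
    (fun c a b => by
      have := f.map_update_smul ![a, b] 1 c b
      rwa [update_two_one, update_two_one] at this)

/-- The multilinear map in two variables given by a bilinear map. -/
def LinearMap.toMultilinear₂ {F M N : Type*} [Field F] [AddCommGroup M] [Module F M]
    [AddCommGroup N] [Module F N] (g : M →ₗ[F] M →ₗ[F] N) :
    MultilinearMap F (fun _ : Fin 2 => M) N :=
  MultilinearMap.mk' (fun v => g (v 0) (v 1))
    (by
      intro v i x y
      fin_cases i <;> simp)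
    (by
      intro v i c x
      fin_cases i <;> simp)

namespace DGCA

variable {F : Type*} [Field F] {A : DGCA F}

lemma coh_trilinear_ext {f : MultilinearMap F (fun _ : Fin 3 => A.Cohomology) A.Cohomology}
    {g : A.Cohomology →ₗ[F] A.Cohomology →ₗ[F] A.Cohomology}
    (h : ∀ i j k, ∀ α ∈ A.cohDeg i, ∀ β ∈ A.cohDeg j, ∀ γ ∈ A.cohDeg k,
      f ![α, β, γ] = hochDiff g α β γ) (α β γ : A.Cohomology) :
    f ![α, β, γ] = hochDiff g α β γ := by
  have f0 : ∀ β γ, f ![0, β, γ] = 0 := fun β γ => f.map_coord_zero 0 rfl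
  have f1 : ∀ α γ, f ![α, 0, γ] = 0 := fun α γ => f.map_coord_zero 1 rfl
  have f2 : ∀ α β, f ![α, β, 0] = 0 := fun α β => f.map_coord_zero 2 rfl
  refine coh_induction (P := fun α => f ![α, β, γ] = hochDiff g α β γ)
    (by simp [hochDiff, f0]) ?_ (fun α α' h1 h2 => ?_) α
  · intro i α hα
    refine coh_induction (P := fun β => f ![α, β, γ] = hochDiff g α β γ)
      (by simp [hochDiff, f1]) ?_ (fun β β' h1 h2 => ?_) β
    · intro j β hβ
      refine coh_induction (P := fun γ => f ![α, β, γ] = hochDiff g α β γ)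
        (by simp [hochDiff, f2]) (fun k γ hγ => h i j k α hα β hβ γ hγ) (fun γ γ' h1 h2 => ?_) γ
      rw [hochDiff_add_right, ← h1, ← h2]
      have := f.map_update_add ![α, β, γ] 2 γ γ'
      rwa [update_three_two, update_three_two, update_three_two] at this
    · rw [hochDiff_add_mid, ← h1, ← h2]
      have := f.map_update_add ![α, β, γ] 1 β β'
      rwa [update_three_one, update_three_one, update_three_one] at this
  · rw [hochDiff_add_left, ← h1, ← h2]
    exact f.cons_add ![β, γ] α α'

lemma hochD_two (g : MultilinearMap F (fun _ : Fin 2 => A.Cohomology) A.Cohomology)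
    {k : ℕ → ℤ} {a : ℕ → A.Cohomology} (h : a 0 ∈ A.cohDeg (k 0)) :
    hochD 2 (-1) g k a = hochDiff g.toBilinear (a 0) (a 1) (a 2) := by
  have hk : (-1 : F) ^ (-1 * k 0) = (-1 : F) ^ k 0 := neg_one_zpow_congr ⟨-k 0, by ring⟩
  have e : ∀ v : Fin 2 → A.Cohomology, g v = g.toBilinear (v 0) (v 1) := by
    intro v
    change g v = g ![v 0, v 1]
    congr 1
    ext i
    fin_cases i <;> rfl
  rw [hochD, hk, hochDiff, cohParity_of_mem h]
  simp only [e, Finset.sum_range_succ, Finset.sum_range_zero, mulAt]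
  have h3 : (-1 : F) ^ 3 = -1 := by norm_num
  simp [h3]
  abel

/-- The definition tests homogeneous arguments only; multilinearity extends the identity to all
arguments, so the signs become the linear operator `cohParity`. -/
lemma mem_hochCoboundaries_iff
    {f : MultilinearMap F (fun _ : Fin 3 => A.Cohomology) A.Cohomology}
    (hf : f ∈ hochCochains A.cohDeg 3 (-1)) :
    f ∈ hochCoboundaries A.cohDeg 3 (-1) ↔
      ∃ g : A.Cohomology →ₗ[F] A.Cohomology →ₗ[F] A.Cohomology,
        (∀ k l, ∀ α ∈ A.cohDeg k, ∀ β ∈ A.cohDeg l, g α β ∈ A.cohDeg (k + l - 1)) ∧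
        ∀ α β γ, f ![α, β, γ] = hochDiff g α β γ := by
  have e : ∀ a : ℕ → A.Cohomology, (fun i : Fin 3 => a i) = ![a 0, a 1, a 2] := by
    intro a
    ext i
    fin_cases i <;> rfl
  constructor
  · rintro ⟨-, g, hg, h⟩
    refine ⟨g.toBilinear, fun k l α hα β hβ => ?_, ?_⟩
    · have := hg ![k, l] ![α, β] (by
        intro i
        fin_cases i
        exacts [hα, hβ])
      rwa [Fin.sum_univ_two] at this
    · refine coh_trilinear_ext fun i j k α hα β hβ γ hγ => ?_
      obtain ⟨a, d, ha, rfl, rfl, rfl⟩ : ∃ (a : ℕ → A.Cohomology) (d : ℕ → ℤ),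
          (∀ m, a m ∈ A.cohDeg (d m)) ∧ a 0 = α ∧ a 1 = β ∧ a 2 = γ := by
        refine ⟨fun m => if m = 0 then α else if m = 1 then β else γ,
          fun m => if m = 0 then i else if m = 1 then j else k, fun m => ?_, rfl, rfl, rfl⟩
        beta_reduce
        split_ifs
        exacts [hα, hβ, hγ]
      rw [← e, h d a ha, hochD_two g (ha 0)]
  · rintro ⟨g, hg, h⟩
    have hbil : g.toMultilinear₂.toBilinear = g := rfl
    refine ⟨hf, g.toMultilinear₂, fun k a ha => ?_, fun k a ha => ?_⟩
    · rw [Fin.sum_univ_two]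
      exact hg (k 0) (k 1) (a 0) (ha 0) (a 1) (ha 1)
    · rw [hochD_two _ (ha 0), e, h, hbil]

end DGCA

/-! ### Naturality of the class of `μ₃`. -/

namespace PoincareDGCA.HodgeDecomposition

variable {F : Type*} [Field F] {n n' : ℕ} {A : PoincareDGCA F n} {B : PoincareDGCA F n'}
  (D : A.HodgeDecomposition) (D' : B.HodgeDecomposition)

lemma splitting_harmClass_of_closed {x : A.toDGCA} (hx : A.d x = 0) :
    D.splitting (D.harmClass x) = x - A.d (D.dInv x) := by
  rw [splitting_harmClass, harmProj_of_closed D hx]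

/-- An injective map preserving degrees also reflects them, because it commutes with the projections
onto the components. -/
lemma mem_cohDeg_of_map_mem (D : A.HodgeDecomposition) (D' : B.HodgeDecomposition)
    {φ : A.Cohomology →ₗ[F] B.Cohomology} (hinj : Function.Injective φ)
    (hφ : ∀ k, ∀ α ∈ A.cohDeg k, φ α ∈ B.cohDeg k) {k : ℤ} {α : A.Cohomology}
    (h : φ α ∈ B.cohDeg k) : α ∈ A.cohDeg k := by
  have e : φ (D.cohProj k α) = D'.cohProj k (φ α) := by
    refine coh_linear_ext (f := φ ∘ₗ D.cohProj k) (g := D'.cohProj k ∘ₗ φ) (fun l α hα => ?_) α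
    by_cases hl : l = k
    · subst hl
      simp [D.cohProj_of_mem hα, D'.cohProj_of_mem (hφ _ α hα)]
    · simp [D.cohProj_of_mem_ne hα hl, D'.cohProj_of_mem_ne (hφ _ α hα) hl]
  rw [D'.cohProj_of_mem h] at e
  rw [← hinj e]
  exact D.cohProj_mem k α

/-- The defect in associativity of a multiplicative system `j` with homotopies `k`. -/
noncomputable def assocDefect {C : DGCA F} (j : A.Cohomology →ₗ[F] C)
    (k : A.Cohomology →ₗ[F] A.Cohomology →ₗ[F] C) (α β γ : A.Cohomology) : C :=
  k α β * j γ - C.parity (j α) * k β γ + k (α * β) γ - k α (β * γ)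

/-- If `j` and `j'` are multiplicative up to homotopies `k` and `k'` and `s` is a homotopy from `j'`
to `j`, then the associativity defects of `j` and `j'` differ up to a coboundary by the Hochschild
differential of the closed bilinear map `u`. -/
lemma assocDefect_sub {C : DGCA F} {j j' s : A.Cohomology →ₗ[F] C}
    {k k' u : A.Cohomology →ₗ[F] A.Cohomology →ₗ[F] C}
    (hk : ∀ α β, C.d (k α β) = j α * j β - j (α * β))
    (hk' : ∀ α β, C.d (k' α β) = j' α * j' β - j' (α * β))
    (hs : ∀ α, C.d (s α) = j α - j' α) (hu : ∀ α β, C.d (u α β) = 0)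
    (hku : ∀ α β, k α β = k' α β + s α * j β + C.parity (j' α) * s β - s (α * β) + u α β)
    (α β γ : A.Cohomology) :
    assocDefect j k α β γ - assocDefect j' k' α β γ =
      assocDefect j u α β γ + C.d (C.parity (k' α β) * s γ + C.parity (s α) * (k β γ - u β γ)) := by
  have hj : ∀ α, j α = j' α + C.d (s α) := fun α => by rw [hs]; abel
  have e : C.d (C.parity (k' α β) * s γ + C.parity (s α) * (k β γ - u β γ)) =
      -(C.parity (j' α) * C.parity (j' β) - C.parity (j' (α * β))) * s γ + k' α β * C.d (s γ)
        - C.parity (C.d (s α)) * (k β γ - u β γ) + s α * (j β * j γ - j (β * γ)) := by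
    simp only [map_add, map_sub, d_mul, parity_parity, d_parity, hk, hk', hu, parity_mul]
    noncomm_ring
  rw [e]
  simp only [assocDefect, hku, hj, map_add, mul_assoc α β γ]
  noncomm_ring

/-- The ternary multiplication as an associativity defect. -/
lemma map_mu3_eq {f₁ : A.toDGCA →ₗ[F] B.toDGCA} {f₂ : A.toDGCA →ₗ[F] A.toDGCA →ₗ[F] B.toDGCA}
    {φ : A.Cohomology →ₗ[F] B.Cohomology}
    (hp : ∀ x, f₁ (A.parity x) = B.parity (f₁ x))
    (h₂ : ∀ x y, f₁ (x * y) = f₁ x * f₁ y + B.d (f₂ x y) + f₂ (A.d x) y + f₂ (A.parity x) (A.d y))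
    {α β γ : A.Cohomology}
    (h₃ : f₂ (D.splitting α * D.splitting β) (D.splitting γ)
        - f₂ (D.splitting α) (D.splitting β * D.splitting γ)
        - B.parity (f₁ (D.splitting α)) * f₂ (D.splitting β) (D.splitting γ)
        + f₂ (D.splitting α) (D.splitting β) * f₁ (D.splitting γ) ∈ LinearMap.range B.d)
    (hφ : ∀ x, A.d x = 0 → D'.harmClass (f₁ x) = φ (D.harmClass x)) :
    D'.harmClass (assocDefect (f₁ ∘ₗ D.splitting)
      (((LinearMap.mul F A.toDGCA).compr₂ (f₁ ∘ₗ D.dInv) - f₂).compl₁₂ D.splitting D.splitting)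
        α β γ) = φ (D.mu3 ![α, β, γ]) := by
  obtain ⟨w, hw⟩ := h₃
  have ha := D.d_splitting α
  have hb := D.d_splitting β
  have hc := D.d_splitting γ
  have h1 := D.splitting_mul α β
  have h2 := D.splitting_mul β γ
  -- Subtracting `d⁻ d` makes the ternary expression closed without changing its harmonic class. The
  -- terms with `f₂` are exact, by the relation `h₂` and the primitive `w`.
  have key : assocDefect (f₁ ∘ₗ D.splitting)
      (((LinearMap.mul F A.toDGCA).compr₂ (f₁ ∘ₗ D.dInv) - f₂).compl₁₂ D.splitting D.splitting)
        α β γ =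
      f₁ (D.tri (D.splitting α) (D.splitting β) (D.splitting γ)
        - D.dInv (A.d (D.tri (D.splitting α) (D.splitting β) (D.splitting γ))))
      + B.d (f₂ (A.parity (D.splitting α)) (D.dInv (D.splitting β * D.splitting γ))
        - f₂ (D.dInv (D.splitting α * D.splitting β)) (D.splitting γ) - w) := by
    have e1 := h₂ (D.dInv (D.splitting α * D.splitting β)) (D.splitting γ)
    have e2 := h₂ (A.parity (D.splitting α)) (D.dInv (D.splitting β * D.splitting γ))
    simp only [assocDefect, LinearMap.compl₁₂_apply, LinearMap.sub_apply, LinearMap.compr₂_apply,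
      LinearMap.comp_apply, LinearMap.mul_apply', h1, h2, tri, map_sub, d_mul, parity_parity,
      d_parity, ha, hc, sub_mul, mul_sub, map_zero, neg_zero, zero_mul, mul_zero, zero_add, add_zero,
      e1, e2, hw, hp, LinearMap.zero_apply, mul_assoc]
    abel
  rw [key, map_add, harmClass_d, add_zero, hφ _ (D.d_corrected _), map_sub, harmClass_dInv, sub_zero]
  rfl

/-- The two terms of the defect that are values of `k` alone lie in `ℬ`, so they have no harmonic
class. -/
lemma mu3_eq_assocDefect (φ : A.Cohomology ≃ₐ[F] B.Cohomology) (α β γ : A.Cohomology) :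
    D'.harmClass (assocDefect (D'.splitting ∘ₗ φ.toLinearMap)
      ((LinearMap.mul F B.toDGCA).compr₂ D'.dInv |>.compl₁₂ (D'.splitting ∘ₗ φ.toLinearMap)
        (D'.splitting ∘ₗ φ.toLinearMap)) α β γ) = D'.mu3 ![φ α, φ β, φ γ] := by
  simp [assocDefect, mu3_apply, tri, harmClass_dInv]

/-- Naturality of the class of `μ₃`: the first two components of an `A_∞`-morphism inducing an
isomorphism `φ` in cohomology determine a Hochschild cochain whose differential is the difference
of the ternary multiplications. -/
lemma exists_hochDiff_eq {f₁ : A.toDGCA →ₗ[F] B.toDGCA}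
    {f₂ : A.toDGCA →ₗ[F] A.toDGCA →ₗ[F] B.toDGCA} {φ : A.Cohomology ≃ₐ[F] B.Cohomology}
    (hdeg₁ : ∀ k, ∀ x ∈ A.deg k, f₁ x ∈ B.deg k)
    (hdeg₂ : ∀ k l, ∀ x ∈ A.deg k, ∀ y ∈ A.deg l, f₂ x y ∈ B.deg (k + l - 1))
    (hd : ∀ x, f₁ (A.d x) = B.d (f₁ x))
    (h₂ : ∀ x y, f₁ (x * y) = f₁ x * f₁ y + B.d (f₂ x y) + f₂ (A.d x) y + f₂ (A.parity x) (A.d y))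
    (h₃ : ∀ k, ∀ x ∈ A.deg k, A.d x = 0 → ∀ l, ∀ y ∈ A.deg l, A.d y = 0 → ∀ m, ∀ z ∈ A.deg m,
      A.d z = 0 → f₂ (x * y) z - f₂ x (y * z) - B.parity (f₁ x) * f₂ y z + f₂ x y * f₁ z ∈
        LinearMap.range B.d)
    (hφ : ∀ x, A.d x = 0 → D'.harmClass (f₁ x) = φ (D.harmClass x)) :
    ∃ g : A.Cohomology →ₗ[F] A.Cohomology →ₗ[F] A.Cohomology,
      (∀ k l, ∀ α ∈ A.cohDeg k, ∀ β ∈ A.cohDeg l, g α β ∈ A.cohDeg (k + l - 1)) ∧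
      ∀ α β γ, D.mu3 ![α, β, γ] - φ.symm (D'.mu3 ![φ α, φ β, φ γ]) = hochDiff g α β γ := by
  have hφdeg : ∀ k, ∀ α ∈ A.cohDeg k, φ α ∈ B.cohDeg k := by
    intro k α hα
    rw [← D.harmClass_splitting α, ← hφ _ (D.d_splitting α)]
    exact D'.harmClass_mem_deg (hdeg₁ k _ (D.splitting_mem_deg hα))
  have hp : ∀ x, f₁ (A.parity x) = B.parity (f₁ x) := by
    refine linear_ext (f := f₁ ∘ₗ A.parity) (g := B.parity ∘ₗ f₁) fun k x hx => ?_
    simp [parity_of_mem hx, parity_of_mem (hdeg₁ k x hx)]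
  have hφp : ∀ α, φ (A.cohParity α) = B.cohParity (φ α) := by
    refine coh_linear_ext (f := φ.toLinearMap ∘ₗ A.cohParity)
      (g := B.cohParity ∘ₗ φ.toLinearMap) fun k α hα => ?_
    simp [cohParity_of_mem hα, cohParity_of_mem (hφdeg k α hα)]
  -- The membership is additive in each argument, so it extends from homogeneous classes to all.
  have h₃' : ∀ α β γ, f₂ (D.splitting α * D.splitting β) (D.splitting γ)
        - f₂ (D.splitting α) (D.splitting β * D.splitting γ)
        - B.parity (f₁ (D.splitting α)) * f₂ (D.splitting β) (D.splitting γ)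
        + f₂ (D.splitting α) (D.splitting β) * f₁ (D.splitting γ) ∈ LinearMap.range B.d := by
    obtain ⟨E, hE⟩ : ∃ E : A.toDGCA → A.toDGCA → A.toDGCA → B.toDGCA, ∀ x y z, E x y z =
        f₂ (x * y) z - f₂ x (y * z) - B.parity (f₁ x) * f₂ y z + f₂ x y * f₁ z :=
      ⟨_, fun _ _ _ => rfl⟩
    simp only [← hE] at h₃ ⊢
    intro α β γ
    refine coh_induction (P := fun α => E (D.splitting α) (D.splitting β) (D.splitting γ) ∈
      LinearMap.range B.d) (by simp [hE]) (fun i α hα => ?_) (fun α α' h h' => ?_) α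
    · refine coh_induction (P := fun β => E (D.splitting α) (D.splitting β) (D.splitting γ) ∈
        LinearMap.range B.d) (by simp [hE]) (fun j β hβ => ?_) (fun β β' h h' => ?_) β
      · refine coh_induction (P := fun γ => E (D.splitting α) (D.splitting β) (D.splitting γ) ∈
          LinearMap.range B.d) (by simp [hE]) (fun k γ hγ => ?_) (fun γ γ' h h' => ?_) γ
        · exact h₃ i _ (D.splitting_mem_deg hα) (D.d_splitting α) j _ (D.splitting_mem_deg hβ)
            (D.d_splitting β) k _ (D.splitting_mem_deg hγ) (D.d_splitting γ)
        · convert add_mem h h' using 1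
          simp only [hE, map_add, mul_add]
          abel
      · convert add_mem h h' using 1
        simp only [hE, map_add, mul_add, add_mul, LinearMap.add_apply]
        abel
    · convert add_mem h h' using 1
      simp only [hE, map_add, add_mul, LinearMap.add_apply]
      abel
  set j : A.Cohomology →ₗ[F] B.toDGCA := f₁ ∘ₗ D.splitting with hj
  set j' : A.Cohomology →ₗ[F] B.toDGCA := D'.splitting ∘ₗ φ.toLinearMap with hj'
  set s : A.Cohomology →ₗ[F] B.toDGCA := D'.dInv ∘ₗ j with hs
  set k : A.Cohomology →ₗ[F] A.Cohomology →ₗ[F] B.toDGCA :=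
    ((LinearMap.mul F A.toDGCA).compr₂ (f₁ ∘ₗ D.dInv) - f₂).compl₁₂ D.splitting D.splitting with hk
  set k' : A.Cohomology →ₗ[F] A.Cohomology →ₗ[F] B.toDGCA :=
    ((LinearMap.mul F B.toDGCA).compr₂ D'.dInv).compl₁₂ j' j' with hk'
  -- This is the difference of the multiplicativity homotopies of `j` and `j'` after transport along
  -- the homotopy `s`. It is closed and represents a bilinear map on cohomology.
  set u : A.Cohomology →ₗ[F] A.Cohomology →ₗ[F] B.toDGCA :=
    k - k' - (LinearMap.mul F B.toDGCA).compl₁₂ s j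
      - (LinearMap.mul F B.toDGCA).compl₁₂ (B.parity ∘ₗ j') s
      + (LinearMap.mul F A.Cohomology).compr₂ s with hu
  have hka : ∀ α β, k α β = f₁ (D.dInv (D.splitting α * D.splitting β)) -
      f₂ (D.splitting α) (D.splitting β) := fun _ _ => rfl
  have hk'a : ∀ α β, k' α β = D'.dInv (j' α * j' β) := fun _ _ => rfl
  have hua : ∀ α β, u α β = k α β - k' α β - s α * j β - B.parity (j' α) * s β + s (α * β) :=
    fun _ _ => rfl
  have hja : ∀ α, j α = f₁ (D.splitting α) := fun _ => rfl
  have hj'a : ∀ α, j' α = D'.splitting (φ α) := fun _ => rfl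
  have hjd : ∀ α, B.d (j α) = 0 := fun α => by rw [hja, ← hd, d_splitting, map_zero]
  have hj'd : ∀ α, B.d (j' α) = 0 := fun α => D'.d_splitting _
  have hjφ : ∀ α, D'.harmClass (j α) = φ α := fun α => by
    rw [hja, hφ _ (D.d_splitting α), harmClass_splitting]
  have hdk : ∀ α β, B.d (k α β) = j α * j β - j (α * β) := fun α β => by
    have e := h₂ (D.splitting α) (D.splitting β)
    simp only [d_splitting, map_zero, LinearMap.zero_apply, add_zero] at e
    rw [hka, hja (α * β), D.splitting_mul, map_sub, map_sub, e, hd, hja, hja]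
    abel
  have hdk' : ∀ α β, B.d (k' α β) = j' α * j' β - j' (α * β) := fun α β => by
    rw [hk'a, hj'a (α * β), map_mul φ, D'.splitting_mul, hj'a, hj'a]
    abel
  have hds : ∀ α, B.d (s α) = j α - j' α := fun α => by
    have := D'.splitting_harmClass_of_closed (hjd α)
    rw [hjφ] at this
    rw [hj'a, this]
    simp only [hs, LinearMap.comp_apply]
    abel
  have hdu : ∀ α β, B.d (u α β) = 0 := fun α β => by
    rw [hua]
    simp only [map_add, map_sub, d_mul, hdk, hdk', hds, parity_parity, d_parity, hjd, hj'd, map_zero]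
    noncomm_ring
  have key : ∀ α β γ, φ (D.mu3 ![α, β, γ]) - D'.mu3 ![φ α, φ β, φ γ] =
      D'.harmClass (u α β) * φ γ - B.cohParity (φ α) * D'.harmClass (u β γ)
        + D'.harmClass (u (α * β) γ) - D'.harmClass (u α (β * γ)) := by
    intro α β γ
    have e1 := map_mu3_eq D D' (φ := φ.toLinearMap) hp h₂ (h₃' α β γ) hφ
    have e2 := mu3_eq_assocDefect D' φ α β γ
    rw [← e2, ← hjφ γ, ← hjφ α, ← harmClass_parity, ← D'.harmClass_mul (hdu α β) (hjd γ),
      ← D'.harmClass_mul (parity_closed (hjd α)) (hdu β γ)]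
    refine (congrArg (· - _) e1.symm).trans ?_
    rw [← map_sub, assocDefect_sub hdk hdk' hds hdu (fun α β => by rw [hua]; abel) α β γ, map_add,
      harmClass_d, add_zero, assocDefect, map_sub, map_add, map_sub]
  -- The defect with `u` in place of `k` represents minus the Hochschild differential, hence the
  -- sign.
  refine ⟨u.compr₂ (-(φ.symm.toLinearMap ∘ₗ D'.harmClass)), fun p q α hα β hβ => ?_,
    fun α β γ => ?_⟩
  · have hj₁ : ∀ k, ∀ α ∈ A.cohDeg k, j α ∈ B.deg k := fun k α hα =>
      hdeg₁ k _ (D.splitting_mem_deg hα)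
    have hj₂ : ∀ k, ∀ α ∈ A.cohDeg k, j' α ∈ B.deg k := fun k α hα =>
      D'.splitting_mem_deg (hφdeg k α hα)
    have hs₁ : ∀ k, ∀ α ∈ A.cohDeg k, s α ∈ B.deg (k - 1) := fun k α hα =>
      D'.dInv_mem_deg (hj₁ k α hα)
    have hα' := D.splitting_mem_deg hα
    have hβ' := D.splitting_mem_deg hβ
    refine D.mem_cohDeg_of_map_mem D' (φ := φ.toLinearMap) φ.injective hφdeg ?_
    simp only [LinearMap.compr₂_apply, LinearMap.neg_apply, LinearMap.comp_apply,
      AlgEquiv.toLinearMap_apply, map_neg, AlgEquiv.apply_symm_apply]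
    refine neg_mem (D'.harmClass_mem_deg ?_)
    rw [hua, hka, hk'a]
    refine add_mem (sub_mem (sub_mem (sub_mem (sub_mem ?_ ?_) ?_) ?_) ?_) ?_
    · exact hdeg₁ _ _ (D.dInv_mem_deg (SetLike.mul_mem_graded hα' hβ'))
    · exact hdeg₂ _ _ _ hα' _ hβ'
    · exact D'.dInv_mem_deg (SetLike.mul_mem_graded (hj₂ _ _ hα) (hj₂ _ _ hβ))
    · rw [add_sub_right_comm]
      exact SetLike.mul_mem_graded (hs₁ _ _ hα) (hj₁ _ _ hβ)
    · rw [add_sub_assoc]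
      exact SetLike.mul_mem_graded (parity_mem_deg (hj₂ _ _ hα)) (hs₁ _ _ hβ)
    · exact hs₁ _ _ (mul_mem_cohDeg hα hβ)
  · apply φ.injective
    rw [map_sub, AlgEquiv.apply_symm_apply, key]
    simp only [hochDiff, LinearMap.compr₂_apply, LinearMap.neg_apply, LinearMap.comp_apply,
      AlgEquiv.toLinearMap_apply, map_sub, map_add, map_mul, map_neg, AlgEquiv.apply_symm_apply, hφp]
    noncomm_ring

end PoincareDGCA.HodgeDecomposition

/-! ### The relations of an `A_∞`-morphism in arities two and three. -/

namespace AInftyHom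

variable {F : Type*} [Field F] {A B : DGCA F} (f : AInftyHom A B)

lemma linearPart_mem {k : ℤ} {x : A} (hx : x ∈ A.deg k) : f.linearPart x ∈ B.deg k := by
  have := f.map_mem 1 le_rfl (fun _ => k) (fun _ => x) fun _ => hx
  have e : ∑ _i : Fin 1, k + (1 - ((1 : ℕ) : ℤ)) = k := by simp
  rwa [e] at this

/-- The quadratic component `f₂`. -/
def bilinearPart : A →ₗ[F] A →ₗ[F] B := (f.map 2).toBilinear

lemma bilinearPart_mem {k l : ℤ} {x y : A} (hx : x ∈ A.deg k) (hy : y ∈ A.deg l) :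
    f.bilinearPart x y ∈ B.deg (k + l - 1) := by
  have := f.map_mem 2 (by norm_num) ![k, l] ![x, y] (by
    intro i
    fin_cases i
    exacts [hx, hy])
  have e : ∑ i, ![k, l] i + (1 - ((2 : ℕ) : ℤ)) = k + l - 1 := by
    rw [Fin.sum_univ_two]
    simp
    ring
  rwa [e] at this

lemma map_one_eq (v : Fin 1 → A) : f.map 1 v = f.linearPart (v 0) := by
  change f.map 1 v = f.map 1 fun _ => v 0
  congr 1
  ext i
  rw [Subsingleton.elim i 0]

lemma map_two_eq (v : Fin 2 → A) : f.map 2 v = f.bilinearPart (v 0) (v 1) := by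
  change f.map 2 v = f.map 2 ![v 0, v 1]
  congr 1
  ext i
  fin_cases i <;> rfl

lemma linearPart_mul (x y : A) : f.linearPart (x * y) = f.linearPart x * f.linearPart y +
    B.d (f.bilinearPart x y) + f.bilinearPart (A.d x) y + f.bilinearPart (A.parity x) (A.d y) := by
  refine linear_ext (f := f.linearPart ∘ₗ LinearMap.mulRight F y)
    (g := LinearMap.mulRight F (f.linearPart y) ∘ₗ f.linearPart + B.d ∘ₗ f.bilinearPart.flip y +
      f.bilinearPart.flip y ∘ₗ A.d + f.bilinearPart.flip (A.d y) ∘ₗ A.parity) (fun k x hx => ?_) x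
  refine linear_ext (f := f.linearPart ∘ₗ LinearMap.mulLeft F x)
    (g := LinearMap.mulLeft F (f.linearPart x) ∘ₗ f.linearPart + B.d ∘ₗ f.bilinearPart x +
      f.bilinearPart (A.d x) + f.bilinearPart (A.parity x) ∘ₗ A.d) (fun l y hy => ?_) y
  -- The relation takes infinite sequences; entries beyond the arity do not matter and are filled
  -- with repetitions.
  obtain ⟨a, d, ha, rfl, rfl, rfl⟩ : ∃ (a : ℕ → A) (d : ℕ → ℤ),
      (∀ m, a m ∈ A.deg (d m)) ∧ a 0 = x ∧ a 1 = y ∧ d 0 = k := by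
    refine ⟨fun m => if m = 0 then x else y, fun m => if m = 0 then k else l, fun m => ?_,
      rfl, rfl, rfl⟩
    beta_reduce
    split_ifs
    exacts [hx, hy]
  have h := f.relation 2 (by norm_num) d a ha
  simp [Finset.sum_range_succ, map_two_eq, map_one_eq, mulAt,
    Function.update_apply] at h
  simp [parity_of_mem (ha 0)]
  rw [zpow_add₀ (by simp)] at h
  simp only [zpow_one, neg_mul, one_mul, neg_smul] at h
  linear_combination (norm := abel) h

/-- On cocycles the terms of the arity 3 relation with `d` inside the ternary component vanish, and
the value of that component is the primitive, so no further component is needed. -/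
lemma bilinearPart_mul_sub {k l m : ℤ} {x y z : A} (hx : x ∈ A.deg k) (hdx : A.d x = 0)
    (hy : y ∈ A.deg l) (hdy : A.d y = 0) (hz : z ∈ A.deg m) (hdz : A.d z = 0) :
    f.bilinearPart (x * y) z - f.bilinearPart x (y * z)
      - B.parity (f.linearPart x) * f.bilinearPart y z + f.bilinearPart x y * f.linearPart z ∈
        LinearMap.range B.d := by
  obtain ⟨a, d, ha, rfl, rfl, rfl, rfl, had⟩ : ∃ (a : ℕ → A) (d : ℕ → ℤ),
      (∀ m, a m ∈ A.deg (d m)) ∧ a 0 = x ∧ a 1 = y ∧ a 2 = z ∧ d 0 = k ∧ ∀ m, A.d (a m) = 0 := by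
    refine ⟨fun i => if i = 0 then x else if i = 1 then y else z,
      fun i => if i = 0 then k else if i = 1 then l else m, fun i => ?_, rfl, rfl, rfl, rfl,
      fun i => ?_⟩
    · beta_reduce
      split_ifs
      exacts [hx, hy, hz]
    · beta_reduce
      split_ifs
      exacts [hdx, hdy, hdz]
  have h := f.relation 3 (by norm_num) d a ha
  have h0 : ∀ r < 3, f.map 3 (fun i : Fin 3 => Function.update a r 0 i) = 0 := fun r hr =>
    (f.map 3).map_coord_zero ⟨r, hr⟩ (by simp)
  simp [Finset.sum_range_succ, Finset.sum_Ico_succ_top, map_two_eq, map_one_eq, mulAt, had, h0] at h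
  refine ⟨f.map 3 fun i => a i, ?_⟩
  rw [parity_of_mem (f.linearPart_mem (ha 0))]
  rw [smul_mul_assoc]
  linear_combination (norm := abel) -h

end AInftyHom

/-! ### Both directions of the theorem. -/

namespace PoincareDGCA

variable {F : Type*} [Field F] {n n' : ℕ} {A : PoincareDGCA F n} {B : PoincareDGCA F n'}

namespace HodgeDecomposition

variable (D : A.HodgeDecomposition) (D' : B.HodgeDecomposition)

lemma cohMap_harmClass (f : AInftyHom A.toDGCA B.toDGCA) {x : A.toDGCA} (hx : A.d x = 0) :
    D'.harmClass (f.linearPart x) = f.cohMap (D.harmClass x) := by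
  have hfx : f.linearPart x ∈ B.cocycles := by
    rw [mem_cocycles, ← f.linearPart_d, hx, map_zero]
  have e := D.harmClass_of_closed ⟨x, hx⟩
  have e' := D'.harmClass_of_closed ⟨_, hfx⟩
  rw [e, e']
  rfl

lemma isQuasiIso_of_harmClass {f : AInftyHom A.toDGCA B.toDGCA}
    {φ : A.Cohomology ≃ₐ[F] B.Cohomology}
    (h : ∀ x, D'.harmClass (f.linearPart x) = φ (D.harmClass x)) : f.IsQuasiIso := by
  have e : ⇑f.cohMap = φ := by
    ext α
    rw [← D.harmClass_splitting α, ← D.cohMap_harmClass D' f (D.d_splitting α), h]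
  rw [AInftyHom.IsQuasiIso, e]
  exact φ.bijective

/-- The isomorphism of graded algebras induced in cohomology by an `A_∞`-quasi-isomorphism. -/
lemma exists_gradedAlgIso (D : A.HodgeDecomposition) (D' : B.HodgeDecomposition)
    {f : AInftyHom A.toDGCA B.toDGCA} (hf : f.IsQuasiIso) :
    ∃ φ : GradedAlgIso A.cohDeg B.cohDeg, ∀ α, φ.toAlgEquiv α = f.cohMap α := by
  have hmul : ∀ α β, f.cohMap (α * β) = f.cohMap α * f.cohMap β := by
    intro α β
    have hα := D.d_splitting α
    have hβ := D.d_splitting β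
    have h := f.linearPart_mul (D.splitting α) (D.splitting β)
    have hαβ : A.d (D.splitting α * D.splitting β) = 0 := by simp [d_mul, hα, hβ]
    have hc : ∀ {x}, A.d x = 0 → B.d (f.linearPart x) = 0 := fun hx => by
      rw [← f.linearPart_d, hx, map_zero]
    simp only [hα, hβ, map_zero, LinearMap.zero_apply, add_zero] at h
    rw [← D.harmClass_splitting_mul, ← D.cohMap_harmClass D' f hαβ, h, map_add, harmClass_d, add_zero,
      D'.harmClass_mul (hc hα) (hc hβ), D.cohMap_harmClass D' f hα, D.cohMap_harmClass D' f hβ,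
      harmClass_splitting, harmClass_splitting]
  -- Unitality is not part of the notion of `A_∞`-morphism; in cohomology it follows from
  -- multiplicativity and surjectivity, by multiplying with a preimage of `1`.
  have hone : f.cohMap 1 = 1 := by
    obtain ⟨α, hα⟩ := hf.2 1
    rw [← mul_one (f.cohMap 1), ← hα, ← hmul, one_mul]
  have hdeg : ∀ k, ∀ α ∈ A.cohDeg k, f.cohMap α ∈ B.cohDeg k := by
    intro k α hα
    rw [← D.harmClass_splitting α, ← D.cohMap_harmClass D' f (D.d_splitting α)]
    exact D'.harmClass_mem_deg (f.linearPart_mem (D.splitting_mem_deg hα))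
  exact ⟨⟨AlgEquiv.ofLinearEquiv (LinearEquiv.ofBijective f.cohMap hf) hone hmul, fun k α =>
    ⟨D.mem_cohDeg_of_map_mem D' hf.1 hdeg, hdeg k α⟩⟩, fun α => rfl⟩

/-- It turns equality of Hochschild classes into the existence of a bounding bilinear map, the form
used in both directions. -/
lemma mu3Class_eq_iff (φ : GradedAlgIso A.cohDeg B.cohDeg) :
    φ.hochPullback 3 (-1) D'.mu3Class = D.mu3Class ↔
      ∃ g : A.Cohomology →ₗ[F] A.Cohomology →ₗ[F] A.Cohomology,
        (∀ k l, ∀ α ∈ A.cohDeg k, ∀ β ∈ A.cohDeg l, g α β ∈ A.cohDeg (k + l - 1)) ∧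
        ∀ α β γ, D.mu3 ![α, β, γ] - φ.toAlgEquiv.symm
          (D'.mu3 ![φ.toAlgEquiv α, φ.toAlgEquiv β, φ.toAlgEquiv γ]) = hochDiff g α β γ := by
  have e : ∀ α β γ, (D.mu3 - multilinearPullback φ.toAlgEquiv 3 D'.mu3) ![α, β, γ] =
      D.mu3 ![α, β, γ] - φ.toAlgEquiv.symm
          (D'.mu3 ![φ.toAlgEquiv α, φ.toAlgEquiv β, φ.toAlgEquiv γ]) := by
    intro α β γ
    rw [sub_apply, multilinearPullback_apply]
    congr 3
  rw [mu3Class, mu3Class, φ.hochPullback_hochClass, eq_comm, hochClass_eq_iff,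
    mem_hochCoboundaries_iff (sub_mem D.mu3_mem_cochains
      (φ.pullback_cochain 3 (-1) D'.mu3_mem_cochains))]
  simp only [e]

/-- The class of `μ₃` does not depend on the Hodge type decomposition. -/
theorem mu3Class_eq (D₁ D₂ : A.HodgeDecomposition) : D₁.mu3Class = D₂.mu3Class := by
  obtain ⟨g, hg, h⟩ := D₁.exists_hochDiff_eq D₂ (f₁ := LinearMap.id) (f₂ := 0)
    (φ := AlgEquiv.refl) (fun k x hx => hx) (fun k l x _ y _ => zero_mem _) (fun x => rfl)
    (fun x y => by simp) (fun k x _ _ l y _ _ m z _ _ => by simp)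
    (fun x hx => by
      have e := D₁.harmClass_of_closed ⟨x, hx⟩
      exact (D₂.harmClass_of_closed ⟨x, hx⟩).trans e.symm)
  let φ : GradedAlgIso A.cohDeg A.cohDeg := ⟨AlgEquiv.refl, fun k x => Iff.rfl⟩
  have := (D₁.mu3Class_eq_iff D₂ φ).2 ⟨g, hg, h⟩
  rw [← this]
  rfl

/-- An `A_∞`-quasi-isomorphism preserves the class of `μ₃`. -/
theorem exists_gradedAlgIso_mu3Class {f : AInftyHom A.toDGCA B.toDGCA} (hf : f.IsQuasiIso) :
    ∃ φ : GradedAlgIso A.cohDeg B.cohDeg, φ.hochPullback 3 (-1) D'.mu3Class = D.mu3Class := by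
  obtain ⟨φ, hφ⟩ := D.exists_gradedAlgIso D' hf
  refine ⟨φ, (D.mu3Class_eq_iff D' φ).2 ?_⟩
  refine D.exists_hochDiff_eq D' (f₁ := f.linearPart) (f₂ := f.bilinearPart)
    (fun k x hx => f.linearPart_mem hx) (fun k l x hx y hy => f.bilinearPart_mem hx hy)
    f.linearPart_d f.linearPart_mul
    (fun k x hx hdx l y hy hdy m z hz hdz => f.bilinearPart_mul_sub hx hdx hy hdy hz hdz)
    (fun x hx => ?_)
  rw [hφ, D.cohMap_harmClass D' f hx]

end HodgeDecomposition

/-- A class of degree `n` with integral 1 has nonzero image, and the target has no cohomology above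
`n'`. -/
lemma degree_le_of_iso {m : ℕ} (hA : A.IsConnectedUpTo m) (φ : GradedAlgIso A.cohDeg B.cohDeg) :
    n ≤ n' := by
  by_contra h
  obtain ⟨ω, hω, h1⟩ := exists_int_eq_one hA
  have h2 := (φ.mem_iff n ω).2 hω
  rw [cohDeg_eq_bot (Or.inr (by omega)), Submodule.mem_bot, map_eq_zero_iff _
    φ.toAlgEquiv.injective] at h2
  rw [h2, map_zero] at h1
  exact zero_ne_one h1

lemma exists_int_comp_eq {m : ℕ} {B : PoincareDGCA F n} (hA : A.IsConnectedUpTo m)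
    (φ : A.Cohomology ≃ₐ[F] B.Cohomology) (hφ : ∀ k, ∀ α ∈ A.cohDeg k, φ α ∈ B.cohDeg k) :
    ∃ c, ∀ α, B.int (φ α) = c * A.int α :=
  eq_smul_int hA (J := B.int ∘ₗ φ.toLinearMap) fun k hk α hα => B.int_eq_zero k hk _ (hφ k α hα)

/-- An isomorphism of the cohomology algebras preserving the class of `μ₃` is induced by an
`A_∞`-quasi-isomorphism. -/
theorem HodgeDecomposition.aInftyQuasiIsomorphic [CharZero F] (D : A.HodgeDecomposition)
    (D' : B.HodgeDecomposition) {r : ℕ} (hr : 1 < r) (hn' : n' + 3 ≤ 5 * r)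
    (connA : A.IsConnectedUpTo (r - 1)) (connB : B.IsConnectedUpTo (r - 1))
    (φ : GradedAlgIso A.cohDeg B.cohDeg)
    (h : φ.hochPullback 3 (-1) D'.mu3Class = D.mu3Class) :
    AInftyQuasiIsomorphic A.toDGCA B.toDGCA := by
  -- With equal top degrees, `φ` transports one integral to a multiple of the other.
  obtain rfl : n = n' := le_antisymm (degree_le_of_iso connA φ) (degree_le_of_iso connB
    ⟨φ.toAlgEquiv.symm, fun k x => by rw [← φ.mem_iff]; simp⟩)
  obtain ⟨g, hg, hgT⟩ := (D.mu3Class_eq_iff D' φ).1 h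
  have hφ : ∀ k, ∀ α ∈ A.cohDeg k, φ.toAlgEquiv α ∈ B.cohDeg k := fun k α hα =>
    (φ.mem_iff k α).2 hα
  -- The scalar for the inverse isomorphism shows that the pulled back `μ₃` has integral zero as
  -- well.
  obtain ⟨c, hc⟩ := exists_int_comp_eq connB φ.toAlgEquiv.symm fun k α hα => φ.symm_mem hα
  obtain ⟨g', hg'deg, h1, h1', hint0, hcyc, hg'⟩ := D.exists_cyclic_cochain hg hgT
    (fun γ => by simp [mu3_one_one]) (fun α => by simp [mu3_one_one'])
    (fun α β γ => by simp [int_mu3, hc])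
    (fun i j k α hα β hβ γ hγ => by
      rw [D.mu3_reverse hα hβ hγ, D'.mu3_reverse (hφ i α hα) (hφ j β hβ) (hφ k γ hγ), map_neg,
        map_smul, smul_sub]
      abel)
  obtain ⟨f, hf⟩ := D.exists_aInftyHom D' hr hn' connA connB hφ
    (exists_int_comp_eq connA φ.toAlgEquiv hφ) g' hg'deg h1 h1' hint0 hcyc (fun α β γ => by
      rw [← hochDiff, ← hg', map_sub, AlgEquiv.apply_symm_apply])
  exact ⟨f, D.isQuasiIso_of_harmClass D' hf⟩

end PoincareDGCA

theorem theorem4p7 {F : Type*} [Field F] [CharZero F] (r n₁ n₂ : ℕ) (hr : 1 < r)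
    (hn₁ : n₁ + 3 ≤ 5 * r) (hn₂ : n₂ + 3 ≤ 5 * r)
    (A₁ : PoincareDGCA F n₁) (A₂ : PoincareDGCA F n₂)
    (hodge₁ : A₁.IsHodgeType) (hodge₂ : A₂.IsHodgeType)
    (conn₁ : A₁.IsConnectedUpTo (r - 1)) (conn₂ : A₂.IsConnectedUpTo (r - 1)) :
    ∃ (c₁ : HochCohomology A₁.cohDeg 3 (-1)) (c₂ : HochCohomology A₂.cohDeg 3 (-1)),
      (∀ D : A₁.HodgeDecomposition, D.mu3Class = c₁) ∧
      (∀ D : A₂.HodgeDecomposition, D.mu3Class = c₂) ∧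
      (AInftyQuasiIsomorphic A₁.toDGCA A₂.toDGCA ↔
        ∃ φ : GradedAlgIso A₁.cohDeg A₂.cohDeg, φ.hochPullback 3 (-1) c₂ = c₁) := by
  obtain ⟨D₁⟩ := hodge₁
  obtain ⟨D₂⟩ := hodge₂
  refine ⟨D₁.mu3Class, D₂.mu3Class, fun D => D.mu3Class_eq D₁, fun D => D.mu3Class_eq D₂, ?_, ?_⟩
  · rintro ⟨f, hf⟩
    exact D₁.exists_gradedAlgIso_mu3Class D₂ hf
  · rintro ⟨φ, hφ⟩
    exact D₁.aInftyQuasiIsomorphic D₂ hr hn₂ conn₁ conn₂ φ hφ
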